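/- All graphs $G=(V,E)$ are finite, simple, undirected, connected, with $n=|V|$ and $m=|E|$; $G$ is chordal if it has no induced cycle of length larger than $3$. For a vertex order $\sigma=(v_1,\dots,v_n)$ let $\sigma^-=(v_n,\dots,v_1)$. *Searches.* All searches start at a given vertex $s$. LexDFS: initially $s$ has label $(0)$ and all other vertices have the empty label; in step $i=1,\dots,n$ an unvisited vertex with lexicographically largest label is visited, and $i$ is prepended to the labels of its unvisited neighbours. LexBFS: the same with initial label $(n)$ of $s$, and $n-i$ is appended in step $i$. BFS (DFS): after $s$, the next vertex is an unvisited neighbour of the first (last) visited vertex that still has an unvisited neighbour. For each search $\mathcal P$, a $\mathcal P$-order is an order in which $\mathcal P$ may visit the vertices, and $\mathcal P^+(\rho)$ is the order obtained by always taking, among all vertices that $\mathcal P$ may visit next, the rightmost one in the vertex order $\rho$. The last-in tree of a vertex order is the tree, rooted in the first vertex, in which each other vertex is joined to its rightmost neighbour among those to its left. *Chordal LexDFS$^+$ algorithm.* Input: a chordal graph $G$, a vertex $s$, a vertex order $\rho$ ending in $s$. 1. Let $\pi$ be the LexBFS$^+(\rho)$ order of $G$ and $T$ its last-in tree. 2.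 Let $\beta$ be the reverse of any BFS order of $T$ starting at $s$. Start with the ordered partition $\mathcal Q=(V)$ and, for $v=\beta(1),\dots,\beta(n)$, refine it with $S_v=\{w\in N(v): w\prec_\beta v\}$, i.e. replace each class $A$ by $A\cap S_v,\ A\setminus S_v$ (in this order) whenever both are non-empty. 3. Order every class of $\mathcal Q$ with respect to $\rho^-$, move $s$ to the leftmost position, and let $\tau$ be the reverse of the resulting order of $V$. 4. Return the DFS$^+(\tau)$ order of $T$. **Corollary.** This algorithm can compute every LexDFS order of a chordal graph: if $G$ is a connected chordal graph and $\sigma$ is a LexDFS order of $G$ starting at $s$, then $\sigma^-$ ends in $s$, and on the input $(G,s,\sigma^-)$ the algorithm has exactly one output, whichever BFS order is chosen in step 2, namely $\sigma$. Moreover, the algorithm has a linear-time implementation: there are a program for the unit-cost random access machine (whose only arithmetic operations are adding and subtracting $1$) and a constant $C$ such that, for every connected chordal graph $G$ on $\{0,\dots,n-1\}$ given by adjacency lists, every vertex $s$ and every vertex order $\rho$ ending in $s$, the program computes an output of the algorithm on the input $(G,s,\rho)$ in at most $C\,(n+m)$ steps. -/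

import Mathlib

namespace GraphSearch

section Orders

variable {V : Type*}

/-- A chordal graph: it has no induced cycle of length larger than 3. -/
def IsChordal (G : SimpleGraph V) : Prop :=
  ∀ k : ℕ, 4 ≤ k → IsEmpty (SimpleGraph.cycleGraph k ↪g G)

/-- A linear order of the vertices, written as a list from left to right. -/
def IsVertexOrder (l : List V) : Prop :=
  l.Nodup ∧ ∀ v, v ∈ l

/-- `l` is a vertex order whose last (rightmost) vertex is `s`. -/
def IsOrderEndingIn (l : List V) (s : V) : Prop :=
  IsVertexOrder l ∧ l.getLast? = some s

/-- A graph search protocol is given by a predicate `elig p v`: after the vertices of the list `p`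
have been visited, in this order, the protocol allows `v` to be visited next.
`σ` is an order of that search if each of its vertices was allowed when it was visited. -/
def IsSearchOrder (elig : List V → V → Prop) (σ : List V) : Prop :=
  IsVertexOrder σ ∧ ∀ p v q, σ = p ++ v :: q → elig p v

/-- `σ` is the order of the "plus" variant of the search with tie-break order `ρ`: among all the
vertices that may be visited next, the rightmost one in `ρ` is taken. -/
def IsPlusOrder [DecidableEq V] (elig : List V → V → Prop) (ρ σ : List V) : Prop :=
  IsVertexOrder σ ∧ ∀ p v q, σ = p ++ v :: q →
    elig p v ∧ ∀ w, elig p w → w ≠ v → ρ.idxOf w < ρ.idxOf v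

/-- Breadth first search from `s` (unvisited neighbours are kept in a queue): the next vertex is an
unvisited neighbour of the first visited vertex that still has an unvisited neighbour. -/
def bfsElig (G : SimpleGraph V) (s : V) (p : List V) (v : V) : Prop :=
  v ∉ p ∧ ((p = [] ∧ v = s) ∨
    ∃ a u b, p = a ++ u :: b ∧ G.Adj u v ∧ ∀ x ∈ a, ∀ w, G.Adj x w → w ∈ p)

/-- Depth first search from `s` (unvisited neighbours are kept on a stack): the next vertex is an
unvisited neighbour of the last visited vertex that still has an unvisited neighbour. -/
def dfsElig (G : SimpleGraph V) (s : V) (p : List V) (v : V) : Prop :=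
  v ∉ p ∧ ((p = [] ∧ v = s) ∨
    ∃ a u b, p = a ++ u :: b ∧ G.Adj u v ∧ ∀ x ∈ b, ∀ w, G.Adj x w → w ∈ p)

/-- The LexDFS label of `w` after the vertices of `p` have been visited. The start vertex `s` has
the initial label `(0)`, all the others the empty one; the `i`-th visited vertex (`i ≥ 1`) prepends
`i` to the labels of its neighbours. (Labels of visited vertices are never looked at.) -/
def lexDFSLabel [DecidableEq V] (G : SimpleGraph V) [DecidableRel G.Adj] (s : V)
    (p : List V) (w : V) : List ℕ :=
  (p.zipIdx 1).foldl (fun L x => if G.Adj x.1 w then x.2 :: L else L) (if w = s then [0] else [])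

/-- The LexBFS label of `w` after the vertices of `p` have been visited. The start vertex `s` has
the initial label `(n)`, all the others the empty one; the `i`-th visited vertex (`i ≥ 1`) appends
`n - i` to the labels of its neighbours. -/
def lexBFSLabel [Fintype V] [DecidableEq V] (G : SimpleGraph V) [DecidableRel G.Adj] (s : V)
    (p : List V) (w : V) : List ℕ :=
  (p.zipIdx 1).foldl (fun L x => if G.Adj x.1 w then L ++ [Fintype.card V - x.2] else L)
    (if w = s then [Fintype.card V] else [])

/-- LexDFS from `s`: the next vertex is an unvisited vertex with lexicographically largest label
(`<` on lists of numbers is the lexicographic order). -/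
def lexDFSElig [DecidableEq V] (G : SimpleGraph V) [DecidableRel G.Adj] (s : V)
    (p : List V) (v : V) : Prop :=
  v ∉ p ∧ ∀ w, w ∉ p → ¬ lexDFSLabel G s p v < lexDFSLabel G s p w

/-- LexBFS from `s`. -/
def lexBFSElig [Fintype V] [DecidableEq V] (G : SimpleGraph V) [DecidableRel G.Adj] (s : V)
    (p : List V) (v : V) : Prop :=
  v ∉ p ∧ ∀ w, w ∉ p → ¬ lexBFSLabel G s p v < lexBFSLabel G s p w

/-- `σ` is a LexDFS order of `G` starting at `s`. -/
def IsLexDFSOrder [DecidableEq V] (G : SimpleGraph V) [DecidableRel G.Adj] (s : V)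
    (σ : List V) : Prop :=
  IsSearchOrder (lexDFSElig G s) σ

/-- In the order `π`, the vertex `u` is the rightmost one among the neighbours of `v` that are to
the left of `v`. -/
def IsLastInParent [DecidableEq V] (G : SimpleGraph V) (π : List V) (u v : V) : Prop :=
  G.Adj u v ∧ π.idxOf u < π.idxOf v ∧
    ∀ x, G.Adj x v → π.idxOf x < π.idxOf v → π.idxOf x ≤ π.idxOf u

/-- The last-in tree of `π` (its root is the first vertex of `π`): each vertex is joined to its
rightmost neighbour among those to its left. -/
def lastInTree [DecidableEq V] (G : SimpleGraph V) (π : List V) : SimpleGraph V :=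
  SimpleGraph.fromRel (IsLastInParent G π)

end Orders

section Algorithm

variable {V : Type*} [Fintype V] [DecidableEq V]

/-- Refinement of an ordered partition `Q` by a set `S`: each class `A` is replaced by
`A ∩ S, A \ S`, in this order, whenever both are non-empty. -/
def refine (Q : List (Finset V)) (S : Finset V) : List (Finset V) :=
  Q.flatMap fun A => if (A ∩ S).Nonempty ∧ (A \ S).Nonempty then [A ∩ S, A \ S] else [A]

/-- The ordered partition obtained from `(V)` by going through `β` from left to right and refining,
for each vertex `v`, with the set of the neighbours of `v` that are to the left of `v` in `β`. -/
def refinedPartition (G : SimpleGraph V) [DecidableRel G.Adj] (β : List V) : List (Finset V) :=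
  β.foldl (fun Q v => refine Q {w | G.Adj v w ∧ β.idxOf w < β.idxOf v}) [Finset.univ]

/-- The tie-break order `τ`: the classes of the partition are listed one after the other, each one
sorted by the reverse of `ρ`, then `s` is moved to the front, and the whole order is reversed. -/
def tieBreak (G : SimpleGraph V) [DecidableRel G.Adj] (s : V) (ρ β : List V) : List V :=
  (s :: ((refinedPartition G β).flatMap fun A => ρ.reverse.filter (· ∈ A)).erase s).reverse

/-- `σ` is an output of the procedure Ordering`(G, T, s, ρ)`: for some choice of a BFS order of the
tree `T` from `s`, with reverse `β`, it is the order of DFS⁺`(τ)` on the tree `T`, where `τ` is the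
tie-break order computed from `β` and `ρ`. -/
def OrderingOutput (G : SimpleGraph V) [DecidableRel G.Adj] (T : SimpleGraph V) (s : V)
    (ρ σ : List V) : Prop :=
  ∃ β : List V, IsSearchOrder (bfsElig T s) β.reverse ∧
    IsPlusOrder (dfsElig T s) (tieBreak G s ρ β) σ

/-- `σ` is an output of the algorithm LexDFS⁺ for chordal graphs on the input `(G, s, ρ)`:
take the LexBFS⁺`(ρ)` order `π` and its last-in tree `T`, and return Ordering`(G, T, s, ρ)`. -/
def ChordalLexDFSPlusOutput (G : SimpleGraph V) [DecidableRel G.Adj] (s : V)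
    (ρ σ : List V) : Prop :=
  ∃ π : List V, IsPlusOrder (lexBFSElig G s) ρ π ∧ OrderingOutput G (lastInTree G π) s ρ σ

end Algorithm

end GraphSearch

/-! A random access machine: finitely many registers and arrays of natural numbers are used by a
program, and each elementary operation has unit cost. The only arithmetic is adding or subtracting
one, so that no number exceeds the size of the input by more than the number of steps. -/

namespace Ram

/-- The memory: registers, and arrays of numbers. -/
structure Store where
  reg : ℕ → ℕ
  arr : ℕ → ℕ → ℕ

/-- Expressions: constants, registers, adding one, (truncated) subtracting one, array access. -/
inductive Expr where
  | const (k : ℕ)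
  | reg (r : ℕ)
  | succ (e : Expr)
  | pred (e : Expr)
  | get (a : ℕ) (i : Expr)

/-- The value of an expression. -/
def Expr.eval (m : Store) : Expr → ℕ
  | .const k => k
  | .reg r => m.reg r
  | .succ e => e.eval m + 1
  | .pred e => e.eval m - 1
  | .get a i => m.arr a (i.eval m)

/-- The number of elementary operations in the evaluation of an expression. -/
def Expr.cost : Expr → ℕ
  | .const _ => 1
  | .reg _ => 1
  | .succ e => e.cost + 1
  | .pred e => e.cost + 1
  | .get _ i => i.cost + 1

/-- Tests: comparisons of two numbers. -/
inductive Test where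
  | eq (e f : Expr)
  | lt (e f : Expr)

/-- The truth of a test. -/
def Test.Holds (m : Store) : Test → Prop
  | .eq e f => e.eval m = f.eval m
  | .lt e f => e.eval m < f.eval m

/-- The cost of a test. -/
def Test.cost : Test → ℕ
  | .eq e f => e.cost + f.cost + 1
  | .lt e f => e.cost + f.cost + 1

/-- Programs: assignment to a register, assignment to an array cell, control structures. -/
inductive Prog where
  | skip
  | set (r : ℕ) (e : Expr)
  | put (a : ℕ) (i e : Expr)
  | seq (P Q : Prog)
  | ite (c : Test) (P Q : Prog)
  | while (c : Test) (P : Prog)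

/-- The memory after the assignment of `x` to the register `r`. -/
def Store.setReg (m : Store) (r x : ℕ) : Store :=
  { m with reg := Function.update m.reg r x }

/-- The memory after the assignment of `x` to the cell `i` of the array `a`. -/
def Store.setCell (m : Store) (a i x : ℕ) : Store :=
  { m with arr := Function.update m.arr a (Function.update (m.arr a) i x) }

/-- `Runs P m t m'`: started in the memory `m`, the program `P` terminates after exactly `t` steps
in the memory `m'`. -/
inductive Runs : Prog → Store → ℕ → Store → Prop where
  | skip (m : Store) : Runs .skip m 1 m
  | set (r : ℕ) (e : Expr) (m : Store) :
      Runs (.set r e) m (e.cost + 1) (m.setReg r (e.eval m))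
  | put (a : ℕ) (i e : Expr) (m : Store) :
      Runs (.put a i e) m (i.cost + e.cost + 1) (m.setCell a (i.eval m) (e.eval m))
  | seq {P Q : Prog} {m m₁ m₂ : Store} {t₁ t₂ : ℕ} :
      Runs P m t₁ m₁ → Runs Q m₁ t₂ m₂ → Runs (.seq P Q) m (t₁ + t₂) m₂
  | iteTrue {c : Test} {P Q : Prog} {m m₁ : Store} {t : ℕ} :
      c.Holds m → Runs P m t m₁ → Runs (.ite c P Q) m (c.cost + t) m₁
  | iteFalse {c : Test} {P Q : Prog} {m m₁ : Store} {t : ℕ} :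
      ¬ c.Holds m → Runs Q m t m₁ → Runs (.ite c P Q) m (c.cost + t) m₁
  | whileTrue {c : Test} {P : Prog} {m m₁ m₂ : Store} {t₁ t₂ : ℕ} :
      c.Holds m → Runs P m t₁ m₁ → Runs (.while c P) m₁ t₂ m₂ →
      Runs (.while c P) m (c.cost + t₁ + t₂) m₂
  | whileFalse {c : Test} {P : Prog} {m : Store} :
      ¬ c.Holds m → Runs (.while c P) m c.cost m

/-- An array that holds the list `l`, followed by zeros. -/
def cells (l : List ℕ) (i : ℕ) : ℕ := l.getD i 0

/-- `adj` is an adjacency list representation of `G`: `adj v` lists the neighbours of `v`, each of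
them once, in an arbitrary order. -/
def IsAdjacencyList {n : ℕ} (G : SimpleGraph (Fin n)) (adj : Fin n → List (Fin n)) : Prop :=
  ∀ v, (adj v).Nodup ∧ ∀ w, w ∈ adj v ↔ G.Adj v w

/-- The adjacency lists of all vertices, one after the other. -/
def adjacencyCells {n : ℕ} (adj : Fin n → List (Fin n)) : List ℕ :=
  (List.finRange n).flatMap fun v => (adj v).map Fin.val

/-- The `n + 1` boundaries of the adjacency lists in `adjacencyCells`: the list of the vertex `v`
occupies the positions from the `v`-th boundary up to, but excluding, the `v + 1`-st one. -/
def adjacencyBounds {n : ℕ} (adj : Fin n → List (Fin n)) : List ℕ :=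
  (List.range (n + 1)).map fun k => (((List.finRange n).take k).map fun v => (adj v).length).sum

/-- The initial memory for a graph on `Fin n` given by adjacency lists, a vertex `s` and a vertex
order `ρ`: register 0 holds `n`, register 1 holds `s`, array 0 holds `ρ`, arrays 1 and 2 hold the
boundaries and the contents of the adjacency lists; everything else is zero. -/
def inputStore {n : ℕ} (adj : Fin n → List (Fin n)) (s : Fin n) (ρ : List (Fin n)) : Store where
  reg
    | 0 => n
    | 1 => s
    | _ => 0
  arr
    | 0 => cells (ρ.map Fin.val)
    | 1 => cells (adjacencyBounds adj)
    | 2 => cells (adjacencyCells adj)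
    | _ => fun _ => 0

/-- In the memory `m`, the first `n` cells of array 3 hold the list `σ` of length `n`. -/
def Holds {n : ℕ} (m : Store) (σ : List (Fin n)) : Prop :=
  (List.range n).map (m.arr 3) = σ.map Fin.val

end Ram

/-!
# Every LexDFS order of a chordal graph from LexBFS⁺ and partition refinement

*The algorithm returns `σ`.* A LexBFS or LexDFS order of a connected chordal graph `G` visits
vertices with inclusion-maximal sets of visited neighbours, and therefore the left neighbourhood of
each vertex is a clique (`IsCliqueOrder`). In such an order the edges of `G` join vertices that are
comparable in the last-in tree, and a vertex order that lists parents before children has the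
same last-in tree (`IsCliqueOrder.lastInTree_congr`). Since LexBFS⁺ breaks ties by `σ⁻`, it visits
parents of the last-in tree of `σ` before children, so that its last-in tree `T` is that of `σ`. The
partition refinement compares two vertices by the first vertex in `β` that has one of them, but not
the other, as a neighbour to the left. For two children of the same vertex, this comparison does not
depend on the choice of `β`, as long as its reverse lists parents before children
(`before_leftSets_congr`). With `σ⁻` for `β`, the comparison is that of the LexDFS labels, and what
the vertices allowed by a DFS of a tree have in common is their parent; hence `σ` is the DFS⁺ order
of `T`, and this order is unique (`IsLexDFSOrder.chordalLexDFSPlusOutput_iff`).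

*Linear time.* By `isPlusOrder_tieBreak`, the output only depends on how siblings are ordered. So
the program does not need a BFS order of `T`: it refines along the reverse of the LexBFS⁺ order
itself, and runs a DFS with a stack on which siblings are pushed in the opposite of the order
obtained (`IsDFSState`). Both refinements, the one for LexBFS⁺ and the one for the tie-break order,
keep the vertices in a doubly linked list in which classes are segments; a vertex that belongs to
the refining set is moved in front of the first vertex of its class (`Round.step`). If the refining
set is gone through in the order `ρ⁻`, then each class stays sorted by `ρ⁻`, which resolves ties.
To this end the adjacency lists are sorted beforehand (`sortAdj_terminates`), and they are sorted
once more, by the final order, before the DFS.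

Running times are bounded by a predicate `Terminates` with rules for loops: `terminates_foreach` for
loops through a list, `terminates_while` for loops with a potential, and evaluation (`Prog.exec`)
for programs without loops. What a program leaves unchanged is read off from its text (`Frame`).
-/

namespace GraphSearch

/-! ### Comparing vertices by a list of sets -/

section Lex

variable {V : Type*}

/-- `a` lies in the first set of the list `l` that distinguishes `a` from `b`. -/
def LexPrec : List (V → Prop) → V → V → Prop
  | [], _, _ => False
  | S :: l, a, b => (S a ∧ ¬ S b) ∨ ((S a ↔ S b) ∧ LexPrec l a b)

/-- No set of the list `l` distinguishes `a` from `b`. -/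
def LexEqv (l : List (V → Prop)) (a b : V) : Prop := ∀ S ∈ l, (S a ↔ S b)

@[simp] lemma lexPrec_nil (a b : V) : ¬ LexPrec [] a b := id

lemma lexPrec_cons (S : V → Prop) (l : List (V → Prop)) (a b : V) :
    LexPrec (S :: l) a b ↔ (S a ∧ ¬ S b) ∨ ((S a ↔ S b) ∧ LexPrec l a b) := Iff.rfl

@[simp] lemma lexEqv_nil (a b : V) : LexEqv [] a b := by simp [LexEqv]

lemma lexEqv_cons (S : V → Prop) (l : List (V → Prop)) (a b : V) :
    LexEqv (S :: l) a b ↔ (S a ↔ S b) ∧ LexEqv l a b := by simp [LexEqv]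

lemma lexEqv_append (l₁ l₂ : List (V → Prop)) (a b : V) :
    LexEqv (l₁ ++ l₂) a b ↔ LexEqv l₁ a b ∧ LexEqv l₂ a b := by
  simp [LexEqv, or_imp, forall_and]

lemma lexPrec_append (l₁ l₂ : List (V → Prop)) (a b : V) :
    LexPrec (l₁ ++ l₂) a b ↔ LexPrec l₁ a b ∨ (LexEqv l₁ a b ∧ LexPrec l₂ a b) := by
  induction l₁ with
  | nil => simp
  | cons S l ih => simp only [List.cons_append, lexPrec_cons, lexEqv_cons, ih]; tauto

lemma lexEqv_concat (l : List (V → Prop)) (S : V → Prop) (a b : V) :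
    LexEqv (l ++ [S]) a b ↔ LexEqv l a b ∧ (S a ↔ S b) := by
  simp [lexEqv_append, lexEqv_cons]

lemma lexPrec_concat (l : List (V → Prop)) (S : V → Prop) (a b : V) :
    LexPrec (l ++ [S]) a b ↔ LexPrec l a b ∨ (LexEqv l a b ∧ S a ∧ ¬ S b) := by
  simp [lexPrec_append, lexPrec_cons]

lemma LexEqv.refl (l : List (V → Prop)) (a : V) : LexEqv l a a := fun _ _ => Iff.rfl

lemma LexEqv.symm {l : List (V → Prop)} {a b : V} (h : LexEqv l a b) : LexEqv l b a :=
  fun S hS => (h S hS).symm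

lemma LexEqv.trans {l : List (V → Prop)} {a b c : V} (h : LexEqv l a b) (h' : LexEqv l b c) :
    LexEqv l a c := fun S hS => (h S hS).trans (h' S hS)

lemma lexPrec_trichotomy (l : List (V → Prop)) (a b : V) :
    LexPrec l a b ∨ LexEqv l a b ∨ LexPrec l b a := by
  induction l with
  | nil => simp
  | cons S l ih => simp only [lexPrec_cons, lexEqv_cons]; tauto

lemma LexPrec.not_lexEqv {l : List (V → Prop)} {a b : V} (h : LexPrec l a b) :
    ¬ LexEqv l a b := by
  induction l with
  | nil => exact h.elim
  | cons S l ih => simp only [lexPrec_cons, lexEqv_cons] at *; tauto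

lemma LexPrec.asymm {l : List (V → Prop)} {a b : V} (h : LexPrec l a b) : ¬ LexPrec l b a := by
  induction l with
  | nil => exact h.elim
  | cons S l ih => simp only [lexPrec_cons] at *; tauto

lemma LexPrec.trans {l : List (V → Prop)} {a b c : V} (h : LexPrec l a b) (h' : LexPrec l b c) :
    LexPrec l a c := by
  induction l with
  | nil => exact h.elim
  | cons S l ih => simp only [lexPrec_cons] at *; tauto

lemma LexPrec.trans_eqv {l : List (V → Prop)} {a b c : V} (h : LexPrec l a b)
    (h' : LexEqv l b c) : LexPrec l a c := by
  induction l with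
  | nil => exact h.elim
  | cons S l ih => simp only [lexPrec_cons, lexEqv_cons] at *; tauto

lemma lexPrec_iff_exists_split {X : Type*} (r : X → V → Prop) (l : List X) (a b : V) :
    LexPrec (l.map r) a b ↔
      ∃ l₁ x l₂, l = l₁ ++ x :: l₂ ∧ LexEqv (l₁.map r) a b ∧ r x a ∧ ¬ r x b := by
  induction l with
  | nil => simp
  | cons y l ih =>
    simp only [List.map_cons, lexPrec_cons, ih]
    constructor
    · rintro (h | ⟨h, l₁, x, l₂, rfl, h2, h3⟩)
      · exact ⟨[], y, l, rfl, by simp, h⟩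
      · exact ⟨y :: l₁, x, l₂, rfl, by simp [lexEqv_cons, h, h2], h3⟩
    · rintro ⟨l₁, x, l₂, h, h2, h3⟩
      cases l₁ with
      | nil => simp only [List.nil_append, List.cons.injEq] at h; exact .inl (h.1 ▸ h3)
      | cons z l₁ =>
        simp only [List.cons_append, List.cons.injEq] at h
        obtain ⟨rfl, rfl⟩ := h
        simp only [List.map_cons, lexEqv_cons] at h2
        exact .inr ⟨h2.1, l₁, x, l₂, rfl, h2.2, h3⟩

lemma LexPrec.exists_mem {l : List (V → Prop)} {a b : V} (h : LexPrec l a b) :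
    ∃ S ∈ l, S a ∧ ¬ S b := by
  induction l with
  | nil => exact h.elim
  | cons S l ih =>
    rcases h with h | ⟨-, h⟩
    · exact ⟨S, by simp, h⟩
    · obtain ⟨S, hS, h⟩ := ih h
      exact ⟨S, by simp [hS], h⟩

lemma lexEqv_map_congr {X : Type*} {r r' : X → V → Prop} {l : List X} {a b : V}
    (h : ∀ x ∈ l, (r x a ↔ r' x a) ∧ (r x b ↔ r' x b)) :
    LexEqv (l.map r) a b ↔ LexEqv (l.map r') a b := by
  simp only [LexEqv, List.forall_mem_map]
  exact forall₂_congr fun x hx => by rw [(h x hx).1, (h x hx).2]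

lemma lexPrec_map_congr {X : Type*} {r r' : X → V → Prop} {l : List X} {a b : V}
    (h : ∀ x ∈ l, (r x a ↔ r' x a) ∧ (r x b ↔ r' x b)) :
    LexPrec (l.map r) a b ↔ LexPrec (l.map r') a b := by
  induction l with
  | nil => simp
  | cons x l ih =>
    simp only [List.map_cons, lexPrec_cons, ih fun y hy => h y (by simp [hy]),
      (h x (by simp)).1, (h x (by simp)).2]

variable [DecidableEq V]

/-- `a` comes before `b` when one compares first by the sets in `l`, then by the order `q`. -/
def Before (l : List (V → Prop)) (q : List V) (a b : V) : Prop :=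
  LexPrec l a b ∨ (LexEqv l a b ∧ q.idxOf a < q.idxOf b)

lemma Before.asymm {l : List (V → Prop)} {q : List V} {a b : V} (h : Before l q a b) :
    ¬ Before l q b a := by
  rintro (h' | ⟨h', h''⟩) <;> rcases h with h | ⟨h, h'''⟩
  · exact h.asymm h'
  · exact h'.not_lexEqv h.symm
  · exact h.not_lexEqv h'.symm
  · omega

end Lex

/-! ### Positions in a list -/

section Positions

variable {V : Type*}

lemma IsVertexOrder.reverse {σ : List V} (h : IsVertexOrder σ) : IsVertexOrder σ.reverse :=
  ⟨List.nodup_reverse.2 h.1, fun v => List.mem_reverse.2 (h.2 v)⟩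

lemma IsVertexOrder.exists_split {σ : List V} (h : IsVertexOrder σ) (v : V) :
    ∃ p q, σ = p ++ v :: q := List.append_of_mem (h.2 v)

variable [DecidableEq V]

lemma mem_iff_idxOf_lt {σ p q : List V} {v : V} (hσ : σ.Nodup) (h : σ = p ++ v :: q) (x : V) :
    x ∈ p ↔ σ.idxOf x < σ.idxOf v := by
  subst h
  have hv : v ∉ p := by
    intro hv
    exact (List.nodup_append.1 hσ).2.2 v hv v (by simp) rfl
  rw [List.idxOf_append_of_notMem hv]
  by_cases hx : x ∈ p
  · rw [List.idxOf_append_of_mem hx]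
    have := List.idxOf_lt_length_of_mem hx
    simp [hx]; omega
  · rw [List.idxOf_append_of_notMem hx]
    simp [hx]

lemma IsVertexOrder.idxOf_inj {σ : List V} (h : IsVertexOrder σ) {x y : V}
    (hxy : σ.idxOf x = σ.idxOf y) : x = y := (List.idxOf_inj (h.2 x)).1 hxy

lemma idxOf_lt_of_pairwise {l : List V} {R : V → V → Prop} (hl : l.Pairwise R)
    {a b : V} (ha : a ∈ l) (hb : b ∈ l) (hne : a ≠ b) (hR : ¬ R b a) :
    l.idxOf a < l.idxOf b := by
  induction l with
  | nil => simp at ha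
  | cons x l ih =>
    rw [List.pairwise_cons] at hl
    by_cases hxa : x = a
    · subst hxa
      simp [List.idxOf_cons_ne _ hne]
    · by_cases hxb : x = b
      · subst hxb
        exact absurd (hl.1 a (by simpa [Ne.symm hxa] using ha)) hR
      · rw [List.idxOf_cons_ne _ hxa, List.idxOf_cons_ne _ hxb]
        have := ih hl.2 (by simpa [Ne.symm hxa] using ha) (by simpa [Ne.symm hxb] using hb)
        omega

lemma pairwise_idxOf_lt {l : List V} (hl : l.Nodup) :
    l.Pairwise (fun a b => l.idxOf a < l.idxOf b) := by
  induction l with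
  | nil => simp
  | cons x l ih =>
    rw [List.nodup_cons] at hl
    rw [List.pairwise_cons]
    refine ⟨fun y hy => ?_, (ih hl.2).imp_of_mem ?_⟩
    · rw [List.idxOf_cons_self, List.idxOf_cons_ne _ (by rintro rfl; exact hl.1 hy)]
      omega
    · intro a b ha hb hab
      rw [List.idxOf_cons_ne _ (by rintro rfl; exact hl.1 ha),
        List.idxOf_cons_ne _ (by rintro rfl; exact hl.1 hb)]
      omega

lemma idxOf_reverse_lt_iff {l : List V} (hl : l.Nodup) {a b : V} (ha : a ∈ l) (hb : b ∈ l) :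
    l.reverse.idxOf a < l.reverse.idxOf b ↔ l.idxOf b < l.idxOf a := by
  have key : ∀ {l : List V}, l.Nodup → ∀ {a b : V}, a ∈ l → b ∈ l → l.idxOf b < l.idxOf a →
      l.reverse.idxOf a < l.reverse.idxOf b := by
    intro l hl a b ha hb h
    refine idxOf_lt_of_pairwise (R := fun x y => l.idxOf y < l.idxOf x)
      (List.pairwise_reverse.2 (pairwise_idxOf_lt hl)) (by simpa) (by simpa) ?_ (by omega)
    rintro rfl
    omega
  refine ⟨fun h => ?_, key hl ha hb⟩
  have := key (List.nodup_reverse.2 hl) (List.mem_reverse.2 hb) (List.mem_reverse.2 ha) h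
  simpa using this

/-- A property of all elements of an order that holds for an element as soon as it holds for all
elements to its left. -/
lemma idxOf_induction (σ : List V) {C : V → Prop}
    (H : ∀ v, (∀ u, σ.idxOf u < σ.idxOf v → C u) → C v) (v : V) : C v := by
  induction hk : σ.idxOf v using Nat.strong_induction_on generalizing v with
  | _ k ih => exact H v fun u hu => ih _ (hk ▸ hu) u rfl

end Positions

/-! ### Searches with tie-breaking -/

section Greedy

variable {V : Type*} [DecidableEq V]

lemma IsPlusOrder.isSearchOrder {elig : List V → V → Prop} {ρ σ : List V}
    (h : IsPlusOrder elig ρ σ) : IsSearchOrder elig σ :=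
  ⟨h.1, fun p v q hs => (h.2 p v q hs).1⟩

lemma IsPlusOrder.unique {elig : List V → V → Prop} {ρ σ τ : List V}
    (hσ : IsPlusOrder elig ρ σ) (hτ : IsPlusOrder elig ρ τ) : σ = τ := by
  have key : ∀ p q q' : List V, σ = p ++ q → τ = p ++ q' → q = q' := by
    intro p q
    induction q generalizing p with
    | nil =>
      intro q' h1 h2
      cases q' with
      | nil => rfl
      | cons v q' =>
        have hv : v ∈ p := by simpa [h1] using hσ.1.2 v
        have := hτ.1.1
        rw [h2] at this
        exact absurd rfl ((List.nodup_append.1 this).2.2 v hv v (by simp))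
    | cons v q ih =>
      intro q' h1 h2
      cases q' with
      | nil =>
        have hv : v ∈ p := by simpa [h2] using hτ.1.2 v
        have := hσ.1.1
        rw [h1] at this
        exact absurd rfl ((List.nodup_append.1 this).2.2 v hv v (by simp))
      | cons w q' =>
        have hvw : v = w := by
          by_contra hne
          have a := (hσ.2 p v q h1).2 w (hτ.2 p w q' h2).1 (Ne.symm hne)
          have b := (hτ.2 p w q' h2).2 v (hσ.2 p v q h1).1 hne
          omega
        subst hvw
        rw [ih (p ++ [v]) q' (by simp [h1]) (by simp [h2])]
  exact key [] σ τ rfl rfl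

variable [Fintype V]

lemma exists_isPlusOrder {elig : List V → V → Prop} {ρ : List V} (hρ : IsVertexOrder ρ)
    (hnot : ∀ p v, elig p v → v ∉ p) (hex : ∀ p v, v ∉ p → ∃ w, elig p w) :
    ∃ σ, IsPlusOrder elig ρ σ := by
  have key : ∀ k ≤ Fintype.card V, ∃ l : List V, l.length = k ∧ l.Nodup ∧
      ∀ p v q, l = p ++ v :: q →
        elig p v ∧ ∀ w, elig p w → w ≠ v → ρ.idxOf w < ρ.idxOf v := by
    intro k hk
    induction k with
    | zero => exact ⟨[], rfl, List.nodup_nil, by simp⟩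
    | succ k ih =>
      obtain ⟨l, hlen, hnd, hl⟩ := ih (by omega)
      have hv : ∃ v, v ∉ l := by
        by_contra! h
        have := Fintype.card_le_of_surjective (fun i : Fin l.length => l.get i)
          (fun v => by obtain ⟨i, hi⟩ := List.mem_iff_get.1 (h v); exact ⟨i, hi⟩)
        simp at this
        omega
      obtain ⟨v, hv⟩ := hv
      obtain ⟨w, hw⟩ := hex l v hv
      obtain ⟨x, hx, hmax⟩ := (Set.toFinite {w | elig l w}).exists_maximalFor
        (fun w => ρ.idxOf w) _ ⟨w, hw⟩
      refine ⟨l ++ [x], by simp [hlen], ?_, ?_⟩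
      · rw [List.nodup_append]
        refine ⟨hnd, by simp, ?_⟩
        rintro a ha b hb rfl
        simp only [List.mem_singleton] at hb
        exact hnot l x hx (hb ▸ ha)
      · intro p v q h
        rcases List.eq_nil_or_concat q with rfl | ⟨q', y, rfl⟩
        · obtain ⟨h1, h2⟩ := List.append_inj' h rfl
          subst h1
          obtain rfl : x = v := by simpa using h2
          refine ⟨hx, fun w hw hne => ?_⟩
          have h1 : ρ.idxOf w ≤ ρ.idxOf x := by
            by_contra hlt
            exact hlt (hmax hw (not_le.1 hlt).le)
          have h2 : ρ.idxOf w ≠ ρ.idxOf x := fun h => hne (hρ.idxOf_inj h)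
          omega
        · rw [List.concat_eq_append, ← List.cons_append, ← List.append_assoc] at h
          exact hl p v q' (List.append_inj' h rfl).1
  obtain ⟨l, hlen, hnd, hl⟩ := key _ le_rfl
  refine ⟨l, ⟨hnd, fun v => ?_⟩, hl⟩
  by_contra hv
  have := (List.nodup_cons.2 ⟨hv, hnd⟩).length_le_card
  rw [List.length_cons] at this
  omega

end Greedy

/-! ### Labels of LexBFS and LexDFS -/

section Labels

variable {V : Type*} (G : SimpleGraph V) [DecidableRel G.Adj]

/-- The numbers that the vertices of `p`, visited in the steps `k, k + 1, …`, append to the LexBFS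
label of `w` in a graph with `n` vertices. -/
def bfsSuffix (n : ℕ) : ℕ → List V → V → List ℕ
  | _, [], _ => []
  | k, x :: p, w => if G.Adj x w then (n - k) :: bfsSuffix n (k + 1) p w
      else bfsSuffix n (k + 1) p w

lemma foldl_eq_append_bfsSuffix (n : ℕ) (p : List V) (w : V) (k : ℕ) (L : List ℕ) :
    (p.zipIdx k).foldl (fun L x => if G.Adj x.1 w then L ++ [n - x.2] else L) L =
      L ++ bfsSuffix G n k p w := by
  induction p generalizing k L with
  | nil => simp [bfsSuffix]
  | cons x p ih =>
    rw [List.zipIdx_cons, List.foldl_cons, ih, bfsSuffix]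
    split_ifs <;> simp

lemma lt_of_mem_bfsSuffix {n : ℕ} {p : List V} {w : V} {k : ℕ} (h : k + p.length ≤ n + 1)
    {i : ℕ} (hi : i ∈ bfsSuffix G n k p w) : i + k < n + 1 ∧ k ≤ n := by
  induction p generalizing k with
  | nil => simp [bfsSuffix] at hi
  | cons x p ih =>
    rw [List.length_cons] at h
    rw [bfsSuffix] at hi
    split_ifs at hi
    · rcases List.mem_cons.1 hi with rfl | hi
      · omega
      · have := ih (by omega) hi
        omega
    · have := ih (by omega) hi
      omega

lemma bfsSuffix_lt {n : ℕ} {p : List V} {a b : V} {k : ℕ} (h : k + p.length ≤ n + 1)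
    (hab : LexPrec (p.map G.Adj) a b) : bfsSuffix G n k p b < bfsSuffix G n k p a := by
  induction p generalizing k with
  | nil => exact hab.elim
  | cons x p ih =>
    rw [List.length_cons] at h
    rw [bfsSuffix, bfsSuffix]
    rcases hab with ⟨ha, hb⟩ | ⟨he, hab⟩
    · rw [if_pos ha, if_neg hb]
      rcases hs : bfsSuffix G n (k + 1) p b with _ | ⟨i, l⟩
      · exact List.nil_lt_cons _ _
      · have := lt_of_mem_bfsSuffix G (p := p) (w := b) (k := k + 1) (n := n) (i := i) (by omega)
          (by simp [hs])
        exact List.cons_lt_cons_iff.2 (.inl (by omega))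
    · have := ih (k := k + 1) (by omega) hab
      by_cases ha : G.Adj x a
      · rw [if_pos ha, if_pos (he.1 ha)]
        exact List.cons_lt_cons_iff.2 (.inr ⟨rfl, this⟩)
      · rw [if_neg ha, if_neg (mt he.2 ha)]
        exact this

lemma bfsSuffix_eq {n : ℕ} {p : List V} {a b : V} {k : ℕ}
    (hab : LexEqv (p.map G.Adj) a b) : bfsSuffix G n k p b = bfsSuffix G n k p a := by
  induction p generalizing k with
  | nil => rfl
  | cons x p ih =>
    rw [List.map_cons, lexEqv_cons] at hab
    rw [bfsSuffix, bfsSuffix, ih hab.2]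
    simp only [hab.1]

variable [DecidableEq V]

lemma lexDFSLabel_concat (s : V) (p : List V) (x w : V) :
    lexDFSLabel G s (p ++ [x]) w =
      if G.Adj x w then (p.length + 1) :: lexDFSLabel G s p w else lexDFSLabel G s p w := by
  simp [lexDFSLabel, List.zipIdx_append, add_comm]

lemma le_length_of_mem_lexDFSLabel {s : V} {p : List V} {w : V} {i : ℕ}
    (hi : i ∈ lexDFSLabel G s p w) : i ≤ p.length := by
  induction p using List.reverseRecOn with
  | nil => simp only [lexDFSLabel, List.zipIdx_nil, List.foldl_nil] at hi; split_ifs at hi <;> simp_all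
  | append_singleton p x ih =>
    rw [lexDFSLabel_concat] at hi
    rw [List.length_append, List.length_singleton]
    split_ifs at hi
    · rcases List.mem_cons.1 hi with rfl | hi
      · exact le_rfl
      · have := ih hi
        omega
    · have := ih hi
      omega

lemma lexDFSLabel_lt {s : V} {p : List V} {a b : V}
    (hab : LexPrec (p.reverse.map G.Adj) a b) : lexDFSLabel G s p b < lexDFSLabel G s p a := by
  induction p using List.reverseRecOn with
  | nil => exact hab.elim
  | append_singleton p x ih =>
    rw [List.reverse_append, List.reverse_singleton, List.singleton_append, List.map_cons] at hab
    rw [lexDFSLabel_concat, lexDFSLabel_concat]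
    rcases hab with ⟨ha, hb⟩ | ⟨he, hab⟩
    · rw [if_pos ha, if_neg hb]
      rcases hs : lexDFSLabel G s p b with _ | ⟨i, l⟩
      · exact List.nil_lt_cons _ _
      · have := le_length_of_mem_lexDFSLabel G (s := s) (p := p) (w := b) (i := i) (by simp [hs])
        exact List.cons_lt_cons_iff.2 (.inl (by omega))
    · have := ih hab
      by_cases ha : G.Adj x a
      · rw [if_pos ha, if_pos (he.1 ha)]
        exact List.cons_lt_cons_iff.2 (.inr ⟨rfl, this⟩)
      · rw [if_neg ha, if_neg (mt he.2 ha)]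
        exact this

lemma lexDFSElig_nil {s v : V} (h : lexDFSElig G s [] v) : v = s := by
  by_contra hne
  have := h.2 s (by simp)
  simp [lexDFSLabel, hne] at this

variable [Fintype V]

lemma lexBFSLabel_lt {s : V} {p : List V} {a b : V} (ha : a ≠ s) (hb : b ≠ s)
    (hp : p.length ≤ Fintype.card V) (hab : LexPrec (p.map G.Adj) a b) :
    lexBFSLabel G s p b < lexBFSLabel G s p a := by
  rw [lexBFSLabel, lexBFSLabel, foldl_eq_append_bfsSuffix, foldl_eq_append_bfsSuffix,
    if_neg ha, if_neg hb]
  exact bfsSuffix_lt G (by omega) hab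

lemma lexBFSLabel_eq {s : V} {p : List V} {a b : V} (ha : a ≠ s) (hb : b ≠ s)
    (hab : LexEqv (p.map G.Adj) a b) :
    lexBFSLabel G s p b = lexBFSLabel G s p a := by
  rw [lexBFSLabel, lexBFSLabel, foldl_eq_append_bfsSuffix, foldl_eq_append_bfsSuffix,
    if_neg ha, if_neg hb, bfsSuffix_eq G hab]

lemma lexBFSElig_nil_iff {s v : V} : lexBFSElig G s [] v ↔ v = s := by
  constructor
  · intro h
    by_contra hne
    have := h.2 s (by simp)
    simp [lexBFSLabel, hne] at this
  · rintro rfl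
    refine ⟨by simp, fun w _ => ?_⟩
    by_cases hw : w = v
    · subst hw; exact List.lt_irrefl _
    · simp [lexBFSLabel, hw]

end Labels

/-! ### Maximal neighbourhood search on chordal graphs -/

section MNS

variable {V : Type*}

/-- An order of maximal neighbourhood search: the set of visited neighbours of the next vertex is
never a proper subset of that of another unvisited vertex. -/
def IsMNSOrder (G : SimpleGraph V) (σ : List V) : Prop :=
  IsVertexOrder σ ∧ ∀ p v q, σ = p ++ v :: q → ∀ w, w ∉ p →
    (∀ y ∈ p, G.Adj y v → G.Adj y w) → ∀ y ∈ p, G.Adj y w → G.Adj y v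

lemma adj_of_not_lexPrec {G : SimpleGraph V} {p l : List V} (hl : ∀ x, x ∈ l ↔ x ∈ p) {v w : V}
    (h : ¬ LexPrec (l.map G.Adj) w v) (hvw : ∀ y ∈ p, G.Adj y v → G.Adj y w) :
    ∀ y ∈ p, G.Adj y w → G.Adj y v := by
  intro y hy hyw
  rcases lexPrec_trichotomy (l.map G.Adj) v w with h' | h' | h'
  · obtain ⟨S, hS, h1, h2⟩ := h'.exists_mem
    obtain ⟨x, hx, rfl⟩ := List.mem_map.1 hS
    exact absurd (hvw x ((hl x).1 hx) h1) h2
  · exact (h' _ (List.mem_map.2 ⟨y, (hl y).2 hy, rfl⟩)).2 hyw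
  · exact absurd h' h

lemma IsVertexOrder.cons_of_head {σ : List V} (h : IsVertexOrder σ) {s : V}
    (hs : ∀ v q, σ = v :: q → v = s) : ∃ q, σ = s :: q := by
  cases σ with
  | nil => simpa using h.2 s
  | cons v q => exact ⟨q, by rw [hs v q rfl]⟩

lemma ne_head_of_not_mem {s : V} {p q : List V} {v : V} {σ : List V} (hs : ∃ q, σ = s :: q)
    (h : σ = p ++ v :: q) (hp : p ≠ []) {w : V} (hw : w ∉ p) : w ≠ s := by
  obtain ⟨q', rfl⟩ := hs
  rintro rfl
  cases p with
  | nil => exact hp rfl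
  | cons x p =>
    simp only [List.cons_append, List.cons.injEq] at h
    simp [h.1] at hw

lemma IsVertexOrder.length_prefix_le [Fintype V] {σ p q : List V} (h : IsVertexOrder σ) (hp : σ = p ++ q) :
    p.length ≤ Fintype.card V := by
  have := h.1.length_le_card
  simp [hp] at this
  omega

variable [DecidableEq V] {G : SimpleGraph V} [DecidableRel G.Adj]

lemma IsLexDFSOrder.cons {s : V} {σ : List V} (h : IsLexDFSOrder G s σ) : ∃ q, σ = s :: q :=
  h.1.cons_of_head fun v q hq => lexDFSElig_nil G (h.2 [] v q hq)

lemma IsLexDFSOrder.isMNSOrder {s : V} {σ : List V} (h : IsLexDFSOrder G s σ) :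
    IsMNSOrder G σ := by
  refine ⟨h.1, fun p v q hp w hw => ?_⟩
  exact adj_of_not_lexPrec (l := p.reverse) (by simp) fun hlt =>
    (h.2 p v q hp).2 w hw (lexDFSLabel_lt G hlt)

variable [Fintype V]

lemma IsSearchOrder.lexBFS_cons {s : V} {σ : List V} (h : IsSearchOrder (lexBFSElig G s) σ) :
    ∃ q, σ = s :: q :=
  h.1.cons_of_head fun v q hq => (lexBFSElig_nil_iff G).1 (h.2 [] v q hq)

lemma IsSearchOrder.isMNSOrder_of_lexBFS {s : V} {σ : List V}
    (h : IsSearchOrder (lexBFSElig G s) σ) : IsMNSOrder G σ := by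
  refine ⟨h.1, fun p v q hp w hw => ?_⟩
  have he := h.2 p v q hp
  by_cases hnil : p = []
  · simp [hnil]
  · refine adj_of_not_lexPrec (l := p) (by simp) fun hlt => he.2 w hw ?_
    exact lexBFSLabel_lt G (ne_head_of_not_mem h.lexBFS_cons hp hnil hw)
      (ne_head_of_not_mem h.lexBFS_cons hp hnil he.1) (h.1.length_prefix_le hp) hlt

end MNS

section Chordal

variable {V : Type*} {G : SimpleGraph V}

/-- An induced path with at least three vertices, closed by a vertex that is adjacent to its two
ends and to no other vertex of it, gives an induced cycle. -/
lemma not_isChordal_of_cycle {f : ℕ → V} {k : ℕ} (hk : 2 ≤ k)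
    (hinj : ∀ i j, i ≤ k + 1 → j ≤ k + 1 → f i = f j → i = j)
    (hadj : ∀ i j, i < j → j ≤ k + 1 → (G.Adj (f i) (f j) ↔ j = i + 1 ∨ (i = 0 ∧ j = k + 1))) :
    ¬ IsChordal G := by
  intro hG
  refine (hG (k + 2) (by omega)).false ⟨⟨fun i => f i, fun i j h => ?_⟩, ?_⟩
  · exact Fin.ext (hinj i j (by omega) (by omega) h)
  · intro a b
    show G.Adj (f a) (f b) ↔ _
    have key : ∀ a b : Fin (k + 2), a < b →
        (G.Adj (f a) (f b) ↔ (SimpleGraph.cycleGraph (k + 2)).Adj a b) := by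
      intro a b hab
      rw [hadj a b hab (by omega), SimpleGraph.cycleGraph_adj']
      have h1 : (b - a).val = b.val - a.val := Fin.sub_val_of_le hab.le
      have h2 : (a - b).val = k + 2 - (b.val - a.val) := by
        rw [Fin.val_sub]
        have : a.val < b.val := hab
        have := b.2
        rw [show k + 2 - b.val + a.val = k + 2 - (b.val - a.val) by omega, Nat.mod_eq_of_lt]
        omega
      rw [h1, h2]
      have : a.val < b.val := hab
      have := b.2
      omega
    rcases lt_trichotomy a b with h | h | h
    · exact key a b h
    · subst h; simp
    · rw [G.adj_comm, (SimpleGraph.cycleGraph _).adj_comm]; exact key b a h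

variable [DecidableEq V]

/-- If `b` was visited although the later vertex `c` had the visited neighbour `a` that `b` did not
have, then `b` had a visited neighbour that `c` did not have. -/
lemma IsMNSOrder.exists_adj {σ : List V} (h : IsMNSOrder G σ) {a b c : V}
    (hab : σ.idxOf a < σ.idxOf b) (hbc : σ.idxOf b < σ.idxOf c) (hac : G.Adj a c)
    (hnab : ¬ G.Adj a b) : ∃ x, σ.idxOf x < σ.idxOf b ∧ G.Adj x b ∧ ¬ G.Adj x c := by
  obtain ⟨p, q, hp⟩ := h.1.exists_split b
  have hmem := mem_iff_idxOf_lt h.1.1 hp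
  by_contra! hcon
  refine hnab (h.2 p b q hp c (fun hc => ?_) (fun y hy hyb => hcon y ((hmem y).1 hy) hyb) a
    ((hmem a).2 hab) hac)
  have := (hmem c).1 hc
  omega

/-- No induced path has all its inner vertices to the right of both ends. If it had, the right end
could be replaced by a vertex further to the left, since the first inner vertex has a neighbour
(the left end) that the right end does not have. -/
lemma IsMNSOrder.no_induced_path {σ : List V} (h : IsMNSOrder G σ) (hG : IsChordal G) (N : ℕ) :
    ∀ (f : ℕ → V) (k : ℕ), 2 ≤ k → σ.idxOf (f k) = N → σ.idxOf (f 0) < N →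
      (∀ i, 0 < i → i < k → N < σ.idxOf (f i)) →
      (∀ i j, i ≤ k → j ≤ k → f i = f j → i = j) →
      (∀ i j, i < j → j ≤ k → (G.Adj (f i) (f j) ↔ j = i + 1)) → False := by
  induction N using Nat.strong_induction_on with
  | _ N ih =>
  intro f k hk hN h0 hint hinj hadj
  obtain ⟨x, hxk, hadjk, hnx1⟩ := h.exists_adj (a := f 0) (b := f k) (c := f 1) (by omega)
    (by have := hint 1 (by omega) (by omega); omega) ((hadj 0 1 (by omega) (by omega)).2 rfl)
    (fun h => by have := (hadj 0 k (by omega) le_rfl).1 h; omega)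
  -- the first vertex after `f 0` that is adjacent to `x`
  have hex : ∃ j, 0 < j ∧ j ≤ k ∧ G.Adj x (f j) := ⟨k, by omega, le_rfl, hadjk⟩
  classical
  obtain ⟨hj0, hjk, hxj⟩ := Nat.find_spec hex
  have hmin : ∀ i, 0 < i → i < Nat.find hex → ¬ G.Adj x (f i) := fun i hi hlt hadj =>
    Nat.find_min hex hlt ⟨hi, by omega, hadj⟩
  set j := Nat.find hex
  have hj2 : 2 ≤ j := by
    by_contra hlt
    obtain h1 : j = 1 := by omega
    exact hnx1 (h1 ▸ hxj)
  have hxf : ∀ i, 0 < i → i ≤ k → x ≠ f i := by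
    rintro i hi hik rfl
    rcases eq_or_lt_of_le hik with rfl | hlt
    · omega
    · have := hint i hi hlt
      omega
  have hx0 : x ≠ f 0 := by
    rintro rfl
    have := (hadj 0 k (by omega) le_rfl).1 hadjk
    omega
  -- the path from `f 0` to `f j`, continued to `x`
  let g : ℕ → V := fun i => if i = j + 1 then x else f i
  have hg : ∀ i, i ≤ j → g i = f i := fun i hi => if_neg (by omega)
  have hgx : g (j + 1) = x := if_pos rfl
  have ginj : ∀ i i', i ≤ j + 1 → i' ≤ j + 1 → g i = g i' → i = i' := by
    have hne : ∀ i ≤ j, g i ≠ x := fun i hi hx => by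
      rw [hg i hi] at hx
      rcases Nat.eq_zero_or_pos i with rfl | hpos
      · exact hx0 hx.symm
      · exact hxf i hpos (by omega) hx.symm
    intro i i' hi hi' he
    rcases Nat.lt_or_ge j i with h1 | h1 <;> rcases Nat.lt_or_ge j i' with h2 | h2
    · omega
    · obtain rfl : i = j + 1 := by omega
      exact absurd (hgx ▸ he).symm (hne i' h2)
    · obtain rfl : i' = j + 1 := by omega
      exact absurd (hgx ▸ he) (hne i h1)
    · rw [hg i h1, hg i' h2] at he
      exact hinj i i' (by omega) (by omega) he
  by_cases hx : G.Adj x (f 0)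
  · refine not_isChordal_of_cycle (f := g) (k := j) hj2 ginj ?_ hG
    intro i i' hlt hle
    rcases Nat.lt_or_ge j i' with h2 | h2
    · obtain rfl : i' = j + 1 := by omega
      rw [hgx, hg i (by omega), G.adj_comm]
      rcases Nat.eq_zero_or_pos i with rfl | hpos
      · simp [hx]
      · rcases eq_or_lt_of_le (show i ≤ j by omega) with rfl | hlt'
        · simp [hxj]
        · have := hmin i hpos hlt'
          simp only [this, false_iff]
          omega
    · rw [hg i (by omega), hg i' h2, hadj i i' hlt (by omega)]
      omega
  · have gadj : ∀ i i', i < i' → i' ≤ j + 1 → (G.Adj (g i) (g i') ↔ i' = i + 1) := by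
      intro i i' hlt hle
      rcases Nat.lt_or_ge j i' with h2 | h2
      · obtain rfl : i' = j + 1 := by omega
        rw [hgx, hg i (by omega), G.adj_comm]
        rcases Nat.eq_zero_or_pos i with rfl | hpos
        · simp only [hx, false_iff]; omega
        · rcases eq_or_lt_of_le (show i ≤ j by omega) with rfl | hlt'
          · simp [hxj]
          · have := hmin i hpos hlt'
            simp only [this, false_iff]
            omega
      · rw [hg i (by omega), hg i' h2, hadj i i' hlt (by omega)]
    have gint : ∀ i, 0 < i → i < j + 1 → N ≤ σ.idxOf (g i) := by
      intro i hi hlt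
      rw [hg i (by omega)]
      rcases eq_or_lt_of_le (show i ≤ k by omega) with rfl | hik
      · exact hN.ge
      · exact (hint i hi hik).le
    have hg0 : g 0 = f 0 := hg 0 (by omega)
    -- an induced path from `f 0` to `x`, whose right end is to the left of `f k`
    rcases lt_trichotomy (σ.idxOf (f 0)) (σ.idxOf x) with hlt | heq | hlt
    · refine ih (σ.idxOf x) (by omega) g (j + 1) (by omega) (by rw [hgx]) (by rwa [hg0]) ?_ ginj
        gadj
      intro i hi hlt'
      have := gint i hi hlt'
      omega
    · exact hx0 (h.1.idxOf_inj heq).symm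
    · refine ih (σ.idxOf (f 0)) (by omega) (fun i => g (j + 1 - i)) (j + 1) (by omega) ?_ ?_ ?_ ?_ ?_
      · simp [hg0]
      · simpa [hgx] using hlt
      · intro i hi hlt'
        have := gint (j + 1 - i) (by omega) (by omega)
        show _ < σ.idxOf (g (j + 1 - i))
        omega
      · intro i i' hi hi' he
        have := ginj _ _ (by omega) (by omega) he
        omega
      · intro i i' hlt' hle
        show G.Adj (g (j + 1 - i)) (g (j + 1 - i')) ↔ _
        rw [G.adj_comm, gadj _ _ (by omega) (by omega)]
        omega

/-- In a maximal neighbourhood search order of a chordal graph, the neighbours of a vertex that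
are to its left form a clique. -/
lemma IsMNSOrder.adj_of_left {σ : List V} (h : IsMNSOrder G σ) (hG : IsChordal G) {a b v : V}
    (hav : G.Adj a v) (hbv : G.Adj b v) (ha : σ.idxOf a < σ.idxOf v) (hb : σ.idxOf b < σ.idxOf v)
    (hab : a ≠ b) : G.Adj a b := by
  have key : ∀ a b, G.Adj a v → G.Adj b v → σ.idxOf a < σ.idxOf b → σ.idxOf b < σ.idxOf v →
      G.Adj a b := by
    intro a b hav hbv hab hb
    by_contra hnab
    have h1 : a ≠ v := hav.ne
    have h2 : b ≠ v := hbv.ne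
    have h3 : a ≠ b := by rintro rfl; omega
    refine h.no_induced_path hG _ (fun i => if i = 0 then a else if i = 1 then v else b) 2 le_rfl
      rfl (by simpa) ?_ ?_ ?_
    · intro i h0 hi
      obtain rfl : i = 1 := by omega
      simpa using hb
    · intro i j hi hj
      interval_cases i <;> interval_cases j <;> simp [h1, h2, h3, h1.symm, h2.symm, h3.symm]
    · intro i j hi hj
      interval_cases j <;> interval_cases i <;> simp [hav, hbv.symm, hnab]
  rcases lt_trichotomy (σ.idxOf a) (σ.idxOf b) with hlt | heq | hlt
  · exact key a b hav hbv hlt hb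
  · exact absurd (h.1.idxOf_inj heq) hab
  · exact (key b a hbv hav hlt ha).symm

/-- In a connected graph, every vertex but the first one has a neighbour to its left. -/
lemma IsMNSOrder.exists_left {σ : List V} (h : IsMNSOrder G σ) (hG : G.Connected) {s : V}
    (hs : ∃ q, σ = s :: q) {v : V} (hv : v ≠ s) : ∃ u, G.Adj u v ∧ σ.idxOf u < σ.idxOf v := by
  obtain ⟨p, q, hp⟩ := h.1.exists_split v
  have hmem := mem_iff_idxOf_lt h.1.1 hp
  have hsp : s ∈ p := by
    obtain ⟨q', rfl⟩ := hs
    cases p with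
    | nil => simp only [List.nil_append, List.cons.injEq] at hp; exact absurd hp.1.symm hv
    | cons x p => simp only [List.cons_append, List.cons.injEq] at hp; simp [hp.1]
  have hvp : v ∉ p := fun hc => by have := (hmem v).1 hc; omega
  obtain ⟨w⟩ := hG s v
  obtain ⟨d, -, h1, h2⟩ := w.exists_boundary_dart {x | x ∈ p} hsp hvp
  by_contra! hcon
  have hno : ∀ y ∈ p, ¬ G.Adj y v := fun y hy hyv => by
    have := hcon y hyv
    have := (hmem y).1 hy
    omega
  exact hno _ h1 (h.2 p v q hp d.snd h2 (fun y hy hyv => absurd hyv (hno y hy)) d.fst h1 d.adj)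

end Chordal

/-! ### Boundary edges and breadth first search -/

section Boundary

variable {V : Type*}

lemma exists_boundary_adj {T : SimpleGraph V} (hT : T.Connected) {p : List V} {v : V}
    (hp : p ≠ []) (hv : v ∉ p) : ∃ u ∈ p, ∃ w, w ∉ p ∧ T.Adj u w := by
  obtain ⟨x, hx⟩ := List.exists_mem_of_ne_nil p hp
  obtain ⟨W⟩ := hT x v
  obtain ⟨d, -, h1, h2⟩ := W.exists_boundary_dart {x | x ∈ p} hx hv
  exact ⟨d.fst, h1, d.snd, h2, d.adj⟩

lemma exists_bfsElig {T : SimpleGraph V} (hT : T.Connected) (s : V) (p : List V) (v : V)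
    (hv : v ∉ p) : ∃ w, bfsElig T s p w := by
  by_cases hp : p = []
  · exact ⟨s, by simp [hp], .inl ⟨hp, rfl⟩⟩
  · obtain ⟨u₀, hu₀, w₀, hw₀, hadj₀⟩ := exists_boundary_adj hT hp hv
    have key : ∀ l : List V, u₀ ∈ l → ∃ a u b, l = a ++ u :: b ∧ (∃ w, w ∉ p ∧ T.Adj u w) ∧
        ∀ x ∈ a, ∀ w, T.Adj x w → w ∈ p := by
      intro l
      induction l with
      | nil => simp
      | cons x l ih =>
        intro hl
        by_cases hx : ∃ w, w ∉ p ∧ T.Adj x w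
        · exact ⟨[], x, l, rfl, hx, by simp⟩
        · have hne : u₀ ≠ x := by rintro rfl; exact hx ⟨w₀, hw₀, hadj₀⟩
          obtain ⟨a, u, b, rfl, h1, h2⟩ := ih (by simpa [hne] using hl)
          refine ⟨x :: a, u, b, rfl, h1, ?_⟩
          simp only [List.mem_cons, forall_eq_or_imp]
          refine ⟨fun w hw => ?_, h2⟩
          by_contra hc
          exact hx ⟨w, hc, hw⟩
    obtain ⟨a, u, b, h, ⟨w, hw, hadj⟩, h2⟩ := key p hu₀
    exact ⟨w, hw, .inr ⟨a, u, b, h, hadj, h2⟩⟩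

/-- Each vertex but the first one is joined by an edge to a vertex visited before. -/
lemma bfsElig.exists_adj {T : SimpleGraph V} {s v : V} {p : List V} (h : bfsElig T s p v) :
    v = s ∨ ∃ u ∈ p, T.Adj u v := by
  rcases h.2 with h | ⟨a, u, b, rfl, hadj, -⟩
  · exact .inl h.2
  · exact .inr ⟨u, by simp, hadj⟩

end Boundary

/-! ### Last-in trees of elimination orders -/

section Tree

open Relation

variable {V : Type*} [DecidableEq V] {G : SimpleGraph V} {s : V} {σ : List V}

/-- An order that starts at `s`, in which every other vertex has a neighbour to its left, and the
neighbours to the left of any vertex form a clique. -/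
structure IsCliqueOrder (G : SimpleGraph V) (s : V) (σ : List V) : Prop where
  isVertexOrder : IsVertexOrder σ
  head : ∃ q, σ = s :: q
  exists_left : ∀ v, v ≠ s → ∃ u, G.Adj u v ∧ σ.idxOf u < σ.idxOf v
  adj_of_left : ∀ a b v, G.Adj a v → G.Adj b v → σ.idxOf a < σ.idxOf v → σ.idxOf b < σ.idxOf v →
    a ≠ b → G.Adj a b

lemma IsMNSOrder.isCliqueOrder (h : IsMNSOrder G σ) (hG : G.Connected) (hc : IsChordal G)
    (hs : ∃ q, σ = s :: q) : IsCliqueOrder G s σ :=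
  ⟨h.1, hs, fun _ hv => h.exists_left hG hs hv, fun _ _ _ => h.adj_of_left hc⟩

lemma IsLastInParent.unique (hσ : IsVertexOrder σ) {u u' v : V} (h : IsLastInParent G σ u v)
    (h' : IsLastInParent G σ u' v) : u = u' :=
  hσ.idxOf_inj (le_antisymm (h'.2.2 u h.1 h.2.1) (h.2.2 u' h'.1 h'.2.1))

lemma exists_isLastInParent (σ : List V) {x v : V} (hx : G.Adj x v)
    (hlt : σ.idxOf x < σ.idxOf v) : ∃ u, IsLastInParent G σ u v := by
  have hbdd : ∃ k, ∃ x, G.Adj x v ∧ σ.idxOf x < σ.idxOf v ∧ σ.idxOf v - σ.idxOf x = k :=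
    ⟨_, x, hx, hlt, rfl⟩
  classical
  obtain ⟨u, hu, hlt', he⟩ := Nat.find_spec hbdd
  refine ⟨u, hu, hlt', fun y hy hylt => ?_⟩
  by_contra hcon
  exact Nat.find_min hbdd (m := σ.idxOf v - σ.idxOf y) (by omega) ⟨y, hy, hylt, rfl⟩

/-- In the last-in tree of `σ`, the vertex `x` is a proper ancestor of `y`. -/
abbrev Above (G : SimpleGraph V) (σ : List V) : V → V → Prop := TransGen (IsLastInParent G σ)

lemma Above.idxOf_lt {x y : V} (h : Above G σ x y) : σ.idxOf x < σ.idxOf y := by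
  induction h with
  | single h => exact h.2.1
  | tail _ h ih => exact ih.trans h.2.1

/-- The order `τ` is a linear extension of the last-in tree of `σ`: parents precede their children. -/
def IsTreeExtension (G : SimpleGraph V) (σ τ : List V) : Prop :=
  ∀ u v, IsLastInParent G σ u v → τ.idxOf u < τ.idxOf v

lemma IsTreeExtension.idxOf_lt {τ : List V} (h : IsTreeExtension G σ τ) {x y : V}
    (hxy : Above G σ x y) : τ.idxOf x < τ.idxOf y := by
  induction hxy with
  | single h' => exact h _ _ h'
  | tail _ h' ih => exact ih.trans (h _ _ h')

lemma IsTreeExtension.refl (G : SimpleGraph V) (σ : List V) : IsTreeExtension G σ σ :=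
  fun _ _ h => h.2.1

lemma lastInTree_adj {u v : V} :
    (lastInTree G σ).Adj u v ↔ IsLastInParent G σ u v ∨ IsLastInParent G σ v u := by
  rw [lastInTree, SimpleGraph.fromRel_adj]
  exact ⟨fun h => h.2, fun h => ⟨h.elim (fun h => h.1.ne) (fun h => h.1.ne'), h⟩⟩

lemma Above.iff_of_parent (hσ : IsVertexOrder σ) {u v x : V} (h : IsLastInParent G σ u v) :
    Above G σ x v ↔ x = u ∨ Above G σ x u := by
  constructor
  · intro hx
    obtain ⟨y, hxy, hy⟩ := TransGen.tail'_iff.1 hx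
    obtain rfl := hy.unique hσ h
    exact (reflTransGen_iff_eq_or_transGen.1 hxy).imp_left Eq.symm
  · rintro (rfl | hx)
    · exact .single h
    · exact hx.tail h

lemma Above.trichotomy (hσ : IsVertexOrder σ) {x y v : V} (hx : Above G σ x v)
    (hy : Above G σ y v) : x = y ∨ Above G σ x y ∨ Above G σ y x := by
  induction hx with
  | single h =>
    rcases (Above.iff_of_parent hσ h).1 hy with rfl | h'
    · exact .inl rfl
    · exact .inr (.inr h')
  | tail hx h ih =>
    rcases (Above.iff_of_parent hσ h).1 hy with rfl | h'
    · exact .inr (.inl hx)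
    · exact ih h'

namespace IsCliqueOrder

lemma above_of_adj (h : IsCliqueOrder G s σ) {x y : V} (hxy : G.Adj x y)
    (hlt : σ.idxOf x < σ.idxOf y) : Above G σ x y := by
  induction y using idxOf_induction σ with
  | _ y ih =>
    obtain ⟨u, hu⟩ := exists_isLastInParent σ hxy hlt
    rw [Above.iff_of_parent h.isVertexOrder hu]
    by_cases hxu : x = u
    · exact .inl hxu
    · refine .inr (ih u hu.2.1 (h.adj_of_left _ _ _ hxy hu.1 hlt hu.2.1 hxu) ?_)
      exact lt_of_le_of_ne (hu.2.2 x hxy hlt) fun he => hxu (h.isVertexOrder.idxOf_inj he)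

/-- Every edge joins an ancestor to a descendant. -/
lemma above_or_above (h : IsCliqueOrder G s σ) {x y : V} (hxy : G.Adj x y) :
    Above G σ x y ∨ Above G σ y x := by
  rcases lt_trichotomy (σ.idxOf x) (σ.idxOf y) with hlt | heq | hlt
  · exact .inl (h.above_of_adj hxy hlt)
  · exact absurd (h.isVertexOrder.idxOf_inj heq) hxy.ne
  · exact .inr (h.above_of_adj hxy.symm hlt)

/-- If an ancestor of `c` is adjacent to a descendant of `c`, it is adjacent to `c`. -/
lemma adj_of_above (h : IsCliqueOrder G s σ) {x c w : V} (hxc : Above G σ x c)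
    (hcw : ReflTransGen (IsLastInParent G σ) c w) (hxw : G.Adj x w) : G.Adj x c := by
  induction hcw with
  | refl => exact hxw
  | tail hcu huw ih =>
    have hxu := Above.idxOf_lt (hxc.trans_left hcu)
    refine ih (h.adj_of_left _ _ _ hxw huw.1 (hxu.trans huw.2.1) huw.2.1 ?_)
    rintro rfl
    exact lt_irrefl _ hxu

lemma exists_parent (h : IsCliqueOrder G s σ) {v : V} (hv : v ≠ s) :
    ∃ u, IsLastInParent G σ u v := by
  obtain ⟨x, hx, hlt⟩ := h.exists_left v hv
  exact exists_isLastInParent σ hx hlt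

lemma idxOf_head (h : IsCliqueOrder G s σ) : σ.idxOf s = 0 := by
  obtain ⟨q, rfl⟩ := h.head
  simp

lemma not_isLastInParent_head (h : IsCliqueOrder G s σ) (u : V) : ¬ IsLastInParent G σ u s := by
  intro hu
  have := hu.2.1
  rw [h.idxOf_head] at this
  omega

/-- All tree extensions of the last-in tree of `σ` have the same last-in tree. -/
lemma isLastInParent_congr (h : IsCliqueOrder G s σ) {τ : List V} (hτ : IsVertexOrder τ)
    (hext : IsTreeExtension G σ τ) {u v : V} :
    IsLastInParent G τ u v ↔ IsLastInParent G σ u v := by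
  have left_iff : ∀ {x v}, G.Adj x v → (τ.idxOf x < τ.idxOf v ↔ σ.idxOf x < σ.idxOf v) := by
    intro x v hxv
    rcases h.above_or_above hxv with h' | h' <;>
    · have := h'.idxOf_lt
      have := hext.idxOf_lt h'
      omega
  have mp : ∀ {u v}, IsLastInParent G σ u v → IsLastInParent G τ u v := by
    intro u v huv
    refine ⟨huv.1, hext _ _ huv, fun x hx hlt => ?_⟩
    rw [left_iff hx] at hlt
    rcases (Above.iff_of_parent h.isVertexOrder huv).1 (h.above_of_adj hx hlt) with rfl | h'
    · exact le_rfl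
    · exact (hext.idxOf_lt h').le
  refine ⟨fun huv => ?_, mp⟩
  obtain ⟨u', hu'⟩ := exists_isLastInParent σ huv.1 ((left_iff huv.1).1 huv.2.1)
  rwa [huv.unique hτ (mp hu')]

lemma lastInTree_congr (h : IsCliqueOrder G s σ) {τ : List V} (hτ : IsVertexOrder τ)
    (hext : IsTreeExtension G σ τ) : lastInTree G τ = lastInTree G σ := by
  ext u v
  rw [lastInTree_adj, lastInTree_adj, h.isLastInParent_congr hτ hext,
    h.isLastInParent_congr hτ hext]

lemma lastInTree_connected (h : IsCliqueOrder G s σ) : (lastInTree G σ).Connected := by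
  have key : ∀ v, (lastInTree G σ).Reachable s v := by
    intro v
    induction v using idxOf_induction σ with
    | _ v ih =>
      by_cases hv : v = s
      · rw [hv]
      · obtain ⟨u, hu⟩ := h.exists_parent hv
        exact (ih u hu.2.1).trans (SimpleGraph.Adj.reachable (lastInTree_adj.2 (.inl hu)))
  have : Nonempty V := ⟨s⟩
  exact ⟨fun u v => (key u).symm.trans (key v)⟩

end IsCliqueOrder

/-! ### Breadth first and depth first search on a tree -/

/-- A search on a last-in tree that starts at its root and always visits a neighbour of a visited
vertex visits parents before their children. -/
lemma IsCliqueOrder.isTreeExtension (h : IsCliqueOrder G s σ) {τ : List V} (hτ : IsVertexOrder τ)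
    (H : ∀ p v q, τ = p ++ v :: q → v = s ∨ ∃ u ∈ p, (lastInTree G σ).Adj u v) :
    IsTreeExtension G σ τ := by
  intro u v huv
  induction v using idxOf_induction τ generalizing u with
  | _ v ih =>
    obtain ⟨p, q, hp⟩ := hτ.exists_split v
    have hmem := mem_iff_idxOf_lt hτ.1 hp
    rcases H p v q hp with rfl | ⟨x, hx, hxv⟩
    · exact absurd huv (h.not_isLastInParent_head u)
    · rw [hmem] at hx
      rcases lastInTree_adj.1 hxv with h' | h'
      · rwa [huv.unique h.isVertexOrder h']
      · have := ih x hx v h'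
        omega

/-- The next vertices allowed by a depth first search on a last-in tree are siblings. -/
lemma dfsElig.exists_parent (h : IsCliqueOrder G s σ) {p : List V} (hnd : p.Nodup)
    (hp : ∀ x ∈ p, ∀ y, IsLastInParent G σ y x → y ∈ p) {v w : V}
    (hv : dfsElig (lastInTree G σ) s p v) (hw : dfsElig (lastInTree G σ) s p w) (hvw : v ≠ w) :
    ∃ u ∈ p, IsLastInParent G σ u v ∧ IsLastInParent G σ u w := by
  have par : ∀ {u v}, u ∈ p → v ∉ p → (lastInTree G σ).Adj u v → IsLastInParent G σ u v := by
    intro u v hu hv hadj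
    rcases lastInTree_adj.1 hadj with h' | h'
    · exact h'
    · exact absurd (hp u hu v h') hv
  rcases hv.2 with ⟨rfl, rfl⟩ | ⟨a, u, b, hpu, hadj, hb⟩
  · rcases hw.2 with ⟨-, rfl⟩ | ⟨a, u, b, hpu, -, -⟩
    · exact absurd rfl hvw
    · simp at hpu
  · rcases hw.2 with ⟨rfl, rfl⟩ | ⟨a', u', b', hpu', hadj', hb'⟩
    · simp at hpu
    · have hu : u ∈ p := by simp [hpu]
      have hu' : u' ∈ p := by simp [hpu']
      have huu : u = u' := by
        have h1 := mem_iff_idxOf_lt hnd hpu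
        have h2 := mem_iff_idxOf_lt hnd hpu'
        by_contra hne
        have hmem : u' ∈ a ∨ u' ∈ b := by
          have := hu'
          rw [hpu] at this
          simpa [Ne.symm hne] using this
        rcases hmem with hm | hm
        · have hm' : u ∈ b' := by
            have := hu
            rw [hpu'] at this
            have h3 : u ∉ a' := fun hc => by
              have := (h1 u').1 hm
              have := (h2 u).1 hc
              omega
            simpa [hne, h3] using this
          exact hv.1 (hb' u hm' v hadj)
        · exact hw.1 (hb u' hm w hadj')
      subst huu
      exact ⟨u, hu, par hu hv.1 hadj, par hu hw.1 hadj'⟩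

end Tree

/-! ### The tie-break order as a comparison of vertices -/

section TieBreak

variable {V : Type*} [DecidableEq V]

/-- The classes of the ordered partition `Q` are the classes of `LexEqv l`, from left to right in
the order `LexPrec l`. -/
structure IsLexPartition (l : List (V → Prop)) (Q : List (Finset V)) : Prop where
  exists_mem : ∀ v, ∃ A ∈ Q, v ∈ A
  lexEqv : ∀ A ∈ Q, ∀ a ∈ A, ∀ b ∈ A, LexEqv l a b
  lexPrec : Q.Pairwise fun A B => ∀ a ∈ A, ∀ b ∈ B, LexPrec l a b

lemma mem_refine_class {A B S : Finset V}
    (h : B ∈ if (A ∩ S).Nonempty ∧ (A \ S).Nonempty then [A ∩ S, A \ S] else [A]) :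
    B ⊆ A ∧ ((∀ x ∈ B, x ∈ S) ∨ ∀ x ∈ B, x ∉ S) := by
  split_ifs at h with hif
  · simp only [List.mem_cons, List.not_mem_nil, or_false] at h
    rcases h with rfl | rfl
    · exact ⟨Finset.inter_subset_left, .inl fun x hx => (Finset.mem_inter.1 hx).2⟩
    · exact ⟨Finset.sdiff_subset, .inr fun x hx => (Finset.mem_sdiff.1 hx).2⟩
  · obtain rfl : B = A := by simpa using h
    refine ⟨subset_rfl, ?_⟩
    rcases not_and_or.1 hif with h' | h'
    · exact .inr fun x hx hxS => h' ⟨x, Finset.mem_inter.2 ⟨hx, hxS⟩⟩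
    · refine .inl fun x hx => ?_
      by_contra hxS
      exact h' ⟨x, Finset.mem_sdiff.2 ⟨hx, hxS⟩⟩

lemma IsLexPartition.refine {l : List (V → Prop)} {Q : List (Finset V)} (h : IsLexPartition l Q)
    (S : Finset V) : IsLexPartition (l ++ [(· ∈ S)]) (refine Q S) where
  exists_mem v := by
    obtain ⟨A, hA, hv⟩ := h.exists_mem v
    by_cases hif : (A ∩ S).Nonempty ∧ (A \ S).Nonempty
    · by_cases hS : v ∈ S
      · exact ⟨A ∩ S, List.mem_flatMap.2 ⟨A, hA, by simp [hif]⟩, by simp [hv, hS]⟩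
      · exact ⟨A \ S, List.mem_flatMap.2 ⟨A, hA, by simp [hif]⟩, by simp [hv, hS]⟩
    · exact ⟨A, List.mem_flatMap.2 ⟨A, hA, by rw [if_neg hif]; simp⟩, hv⟩
  lexEqv B hB a ha b hb := by
    obtain ⟨A, hA, hBA⟩ := List.mem_flatMap.1 hB
    obtain ⟨hsub, hS⟩ := mem_refine_class hBA
    rw [lexEqv_concat]
    refine ⟨h.lexEqv A hA a (hsub ha) b (hsub hb), ?_⟩
    rcases hS with hS | hS
    · simp [hS a ha, hS b hb]
    · simp [hS a ha, hS b hb]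
  lexPrec := by
    refine List.pairwise_flatMap.2 ⟨fun A hA => ?_, h.lexPrec.imp fun {A B} hAB A' hA' B' hB' => ?_⟩
    · split_ifs
      · refine List.pairwise_pair.2 fun a ha b hb => ?_
        rw [Finset.mem_inter] at ha
        rw [Finset.mem_sdiff] at hb
        exact (lexPrec_concat _ _ _ _).2 (.inr ⟨h.lexEqv A hA a ha.1 b hb.1, ha.2, hb.2⟩)
      · simp
    · intro a ha b hb
      exact (lexPrec_concat _ _ _ _).2
        (.inl (hAB a ((mem_refine_class hA').1 ha) b ((mem_refine_class hB').1 hb)))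

variable (G : SimpleGraph V)

/-- For each vertex `v` of `β`, the set of the neighbours of `v` to the left of `v` in `β`. -/
def leftSets (β : List V) : List (V → Prop) :=
  β.map fun v w => G.Adj v w ∧ β.idxOf w < β.idxOf v

variable [Fintype V] [DecidableRel G.Adj]

lemma isLexPartition_refinedPartition (β : List V) :
    IsLexPartition (leftSets G β) (refinedPartition G β) := by
  have key : ∀ (β' : List V) (l : List (V → Prop)) (Q : List (Finset V)), IsLexPartition l Q →
      IsLexPartition (l ++ β'.map fun v w => G.Adj v w ∧ β.idxOf w < β.idxOf v)
        (β'.foldl (fun Q v => refine Q {w | G.Adj v w ∧ β.idxOf w < β.idxOf v}) Q) := by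
    intro β'
    induction β' with
    | nil => intro l Q h; simpa using h
    | cons v β' ih =>
      intro l Q h
      rw [List.map_cons, List.foldl_cons, ← List.singleton_append, ← List.append_assoc]
      convert ih _ _ (h.refine {w | G.Adj v w ∧ β.idxOf w < β.idxOf v}) using 5
      simp
  refine key β [] [Finset.univ] ⟨fun v => ⟨Finset.univ, by simp, by simp⟩, ?_, by simp⟩
  simp

lemma tieBreak_idxOf_lt {s : V} {ρ β : List V} (hρ : IsVertexOrder ρ) {a b : V} (ha : a ≠ s)
    (hb : b ≠ s) (hab : Before (leftSets G β) ρ.reverse a b) :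
    (tieBreak G s ρ β).idxOf b < (tieBreak G s ρ β).idxOf a := by
  have hQ := isLexPartition_refinedPartition G β
  set F := (refinedPartition G β).flatMap fun A => ρ.reverse.filter (· ∈ A)
  have hF : F.Pairwise (Before (leftSets G β) ρ.reverse) := by
    refine List.pairwise_flatMap.2 ⟨fun A hA => ?_, hQ.lexPrec.imp ?_⟩
    · refine ((pairwise_idxOf_lt hρ.reverse.1).sublist List.filter_sublist).imp_of_mem ?_
      intro x y hx hy hxy
      simp only [List.mem_filter, decide_eq_true_eq] at hx hy
      exact .inr ⟨hQ.lexEqv A hA x hx.2 y hy.2, hxy⟩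
    · intro A B hAB x hx y hy
      simp only [List.mem_filter, decide_eq_true_eq] at hx hy
      exact .inl (hAB x hx.2 y hy.2)
  have hmem : ∀ v, v ∈ F := by
    intro v
    obtain ⟨A, hA, hv⟩ := hQ.exists_mem v
    exact List.mem_flatMap.2 ⟨A, hA, by simp [hv, hρ.2 v]⟩
  have hnd : F.Nodup := hF.imp fun h => by rintro rfl; exact h.asymm h
  have hE : (s :: F.erase s).Nodup :=
    List.nodup_cons.2 ⟨hnd.not_mem_erase, hnd.erase s⟩
  have ha' : a ∈ F.erase s := (List.mem_erase_of_ne ha).2 (hmem a)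
  have hb' : b ∈ F.erase s := (List.mem_erase_of_ne hb).2 (hmem b)
  show (s :: F.erase s).reverse.idxOf b < (s :: F.erase s).reverse.idxOf a
  rw [idxOf_reverse_lt_iff hE (by simp [hb']) (by simp [ha']), List.idxOf_cons_ne _ ha.symm,
    List.idxOf_cons_ne _ hb.symm]
  have := idxOf_lt_of_pairwise (hF.sublist List.erase_sublist) ha' hb'
    (by rintro rfl; exact hab.asymm hab) hab.asymm
  omega

end TieBreak

/-! ### Comparing siblings of a last-in tree -/

section Siblings

variable {V : Type*} [DecidableEq V] {G : SimpleGraph V} {s : V} {σ : List V}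

/-- Since edges join ancestors to descendants, the neighbours of `x` to the left of `x` in a reversed
tree extension are the neighbours below `x`. -/
lemma leftSet_iff (h : IsCliqueOrder G s σ) {β : List V} (hβ : IsVertexOrder β)
    (hext : IsTreeExtension G σ β.reverse) {x a : V} :
    (G.Adj x a ∧ β.idxOf a < β.idxOf x) ↔ (G.Adj x a ∧ Above G σ x a) := by
  refine and_congr_right fun hadj => ?_
  have hrev : ∀ {x y}, Above G σ x y → β.idxOf y < β.idxOf x := fun hxy =>
    (idxOf_reverse_lt_iff hβ.1 (hβ.2 _) (hβ.2 _)).1 (hext.idxOf_lt hxy)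
  refine ⟨fun hlt => ?_, hrev⟩
  rcases h.above_or_above hadj with h' | h'
  · exact h'
  · have := hrev h'
    omega

/-- On siblings, the comparison by left sets is the same for all reversed tree extensions `β`:
only common ancestors matter, and these are met from the bottom to the top. -/
lemma lexPrec_leftSets_congr (h : IsCliqueOrder G s σ) {β γ : List V} (hβ : IsVertexOrder β)
    (hβext : IsTreeExtension G σ β.reverse) (hγ : IsVertexOrder γ)
    (hγext : IsTreeExtension G σ γ.reverse) {u a b : V} (ha : IsLastInParent G σ u a)
    (hb : IsLastInParent G σ u b) (hab : LexPrec (leftSets G β) a b) :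
    LexPrec (leftSets G γ) a b := by
  have hsib : ∀ x, Above G σ x a ↔ Above G σ x b := fun x => by
    rw [Above.iff_of_parent h.isVertexOrder ha, Above.iff_of_parent h.isVertexOrder hb]
  have e : ∀ {β : List V}, IsVertexOrder β → IsTreeExtension G σ β.reverse →
      ∀ x ∈ β, ((G.Adj x a ∧ β.idxOf a < β.idxOf x) ↔ (G.Adj x a ∧ Above G σ x a)) ∧
        ((G.Adj x b ∧ β.idxOf b < β.idxOf x) ↔ (G.Adj x b ∧ Above G σ x b)) :=
    fun hβ hext x _ => ⟨leftSet_iff h hβ hext, leftSet_iff h hβ hext⟩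
  have hrev : ∀ {β : List V}, IsVertexOrder β → IsTreeExtension G σ β.reverse →
      ∀ {x y}, Above G σ x y → β.idxOf y < β.idxOf x := fun hβ hext x y hxy =>
    (idxOf_reverse_lt_iff hβ.1 (hβ.2 _) (hβ.2 _)).1 (hext.idxOf_lt hxy)
  rw [leftSets, lexPrec_map_congr (r' := fun x w => G.Adj x w ∧ Above G σ x w) (e hβ hβext),
    lexPrec_iff_exists_split] at hab
  rw [leftSets, lexPrec_map_congr (r' := fun x w => G.Adj x w ∧ Above G σ x w) (e hγ hγext)]
  obtain ⟨l₁, x, l₂, hl, heq, hxa, hxb⟩ := hab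
  rcases lexPrec_trichotomy (γ.map fun x w => G.Adj x w ∧ Above G σ x w) a b with h' | h' | h'
  · exact h'
  · exact absurd ((h' _ (List.mem_map.2 ⟨x, hγ.2 x, rfl⟩)).1 hxa) hxb
  · obtain ⟨m₁, y, m₂, hm, heq', hyb, hya⟩ := (lexPrec_iff_exists_split _ _ _ _).1 h'
    exfalso
    -- `x` and `y` are ancestors of both siblings, and the lower one comes first in `β` and in `γ`
    rcases Above.trichotomy h.isVertexOrder hxa.2 ((hsib y).2 hyb.2) with rfl | hxy | hyx
    · exact hxb hyb
    · have hy : y ∈ l₁ := (mem_iff_idxOf_lt hβ.1 hl y).2 (hrev hβ hβext hxy)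
      exact hya ((heq _ (List.mem_map.2 ⟨y, hy, rfl⟩)).2 hyb)
    · have hx : x ∈ m₁ := (mem_iff_idxOf_lt hγ.1 hm x).2 (hrev hγ hγext hyx)
      exact hxb ((heq' _ (List.mem_map.2 ⟨x, hx, rfl⟩)).2 hxa)

lemma before_leftSets_congr (h : IsCliqueOrder G s σ) {β γ : List V} (hβ : IsVertexOrder β)
    (hβext : IsTreeExtension G σ β.reverse) (hγ : IsVertexOrder γ)
    (hγext : IsTreeExtension G σ γ.reverse) {u a b : V} (ha : IsLastInParent G σ u a)
    (hb : IsLastInParent G σ u b) {q : List V} (hab : Before (leftSets G β) q a b) :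
    Before (leftSets G γ) q a b := by
  rcases hab with hab | ⟨hab, hq⟩
  · exact .inl (lexPrec_leftSets_congr h hβ hβext hγ hγext ha hb hab)
  · rcases lexPrec_trichotomy (leftSets G γ) a b with h' | h' | h'
    · exact .inl h'
    · exact .inr ⟨h', hq⟩
    · exact absurd hab.symm (lexPrec_leftSets_congr h hγ hγext hβ hβext hb ha h').not_lexEqv

lemma IsCliqueOrder.exists_bfsOrder [Fintype V] (h : IsCliqueOrder G s σ) :
    ∃ β : List V, IsSearchOrder (bfsElig (lastInTree G σ) s) β.reverse := by
  obtain ⟨β, hβ⟩ := exists_isPlusOrder (elig := bfsElig (lastInTree G σ) s) h.isVertexOrder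
    (fun p v h => h.1) (exists_bfsElig h.lastInTree_connected s)
  exact ⟨β.reverse, by simpa using hβ.isSearchOrder⟩

variable [DecidableRel G.Adj]

/-- In a LexDFS order `σ`, the next vertex is the best one among its unvisited siblings: the part
of `σ⁻` that matters for the comparison consists of the visited vertices, from right to left. -/
lemma IsLexDFSOrder.before_leftSets (h : IsCliqueOrder G s σ) (hσ : IsLexDFSOrder G s σ)
    {p q : List V} {v : V} (hp : σ = p ++ v :: q) {u w : V} (hw : w ∉ p) (hwv : w ≠ v)
    (huv : IsLastInParent G σ u v) (huw : IsLastInParent G σ u w) :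
    Before (leftSets G σ.reverse) σ v w := by
  have hmem := mem_iff_idxOf_lt hσ.1.1 hp
  have hext : IsTreeExtension G σ σ.reverse.reverse := by
    rw [List.reverse_reverse]; exact .refl G σ
  have hanc : ∀ {x z}, IsLastInParent G σ u z → Above G σ x z → x ∈ p := by
    intro x z hz hxz
    have h1 := huv.2.1
    rcases (Above.iff_of_parent h.isVertexOrder hz).1 hxz with rfl | h'
    · exact (hmem _).2 h1
    · exact (hmem _).2 (h'.idxOf_lt.trans h1)
  have habove : ∀ {z}, σ.idxOf v ≤ σ.idxOf z → ∀ x ∈ p, G.Adj x z → Above G σ x z :=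
    fun {z} hz x hx hadj => h.above_of_adj hadj (((hmem x).1 hx).trans_le hz)
  have hvw : σ.idxOf v ≤ σ.idxOf w := by
    by_contra hlt
    exact hw ((hmem w).2 (by omega))
  -- the sets of the vertices that are not yet visited contain neither `v` nor `w`
  have hpre : LexEqv (((v :: q).reverse).map fun x z => G.Adj x z ∧ Above G σ x z) v w := by
    intro S hS
    obtain ⟨x, hx, rfl⟩ := List.mem_map.1 hS
    have hxp : x ∉ p := fun hxp =>
      (List.nodup_append.1 (hp ▸ hσ.1.1)).2.2 x hxp x (List.mem_reverse.1 hx) rfl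
    exact ⟨fun h' => absurd (hanc huv h'.2) hxp, fun h' => absurd (hanc huw h'.2) hxp⟩
  have hcongr : ∀ x ∈ p.reverse, ((G.Adj x v ∧ Above G σ x v) ↔ G.Adj x v) ∧
      ((G.Adj x w ∧ Above G σ x w) ↔ G.Adj x w) := fun x hx =>
    ⟨and_iff_left_of_imp (habove le_rfl x (by simpa using hx)),
      and_iff_left_of_imp (habove hvw x (by simpa using hx))⟩
  have hsplit : σ.reverse = (v :: q).reverse ++ p.reverse := by
    conv_lhs => rw [hp]
    rw [List.reverse_append]
  have e : ∀ x ∈ σ.reverse, _ := fun x (_ : x ∈ σ.reverse) => And.intro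
    (leftSet_iff h hσ.1.reverse hext (x := x) (a := v))
    (leftSet_iff h hσ.1.reverse hext (x := x) (a := w))
  have hprec : LexPrec (leftSets G σ.reverse) v w ↔ LexPrec (p.reverse.map G.Adj) v w := by
    rw [leftSets, lexPrec_map_congr (r' := fun x w => G.Adj x w ∧ Above G σ x w) e, hsplit,
      List.map_append, lexPrec_append, lexPrec_map_congr (l := p.reverse) hcongr]
    exact ⟨fun h' => h'.elim (fun h' => absurd hpre h'.not_lexEqv) And.right, fun h' =>
      .inr ⟨hpre, h'⟩⟩
  have heqv : LexEqv (leftSets G σ.reverse) v w ↔ LexEqv (p.reverse.map G.Adj) v w := by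
    rw [leftSets, lexEqv_map_congr (r' := fun x w => G.Adj x w ∧ Above G σ x w) e, hsplit,
      List.map_append, lexEqv_append, lexEqv_map_congr (l := p.reverse) hcongr]
    exact and_iff_right hpre
  rw [Before, hprec, heqv]
  rcases lexPrec_trichotomy (p.reverse.map G.Adj) v w with h' | h' | h'
  · exact .inl h'
  · exact .inr ⟨h', lt_of_le_of_ne hvw fun he => hwv (hσ.1.idxOf_inj he).symm⟩
  · exact absurd (lexDFSLabel_lt G h') ((hσ.2 p v q hp).2 w hw)

/-- A LexDFS order is a depth first search order of its last-in tree. -/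
lemma IsLexDFSOrder.dfsElig (h : IsCliqueOrder G s σ) (hσ : IsLexDFSOrder G s σ)
    {p q : List V} {v : V} (hp : σ = p ++ v :: q) : dfsElig (lastInTree G σ) s p v := by
  have hmem := mem_iff_idxOf_lt hσ.1.1 hp
  have hv := hσ.2 p v q hp
  refine ⟨hv.1, ?_⟩
  by_cases hvs : v = s
  · refine .inl ⟨?_, hvs⟩
    refine List.eq_nil_iff_forall_not_mem.2 fun x hx => ?_
    have := (hmem x).1 hx
    rw [hvs, h.idxOf_head] at this
    omega
  · obtain ⟨u, hu⟩ := h.exists_parent hvs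
    obtain ⟨a, b, hab⟩ := List.append_of_mem ((hmem u).2 hu.2.1)
    refine .inr ⟨a, u, b, hab, lastInTree_adj.2 (.inl hu), fun x hx w hxw => ?_⟩
    by_contra hwp
    -- `w` has a visited neighbour to the right of all visited neighbours of `v`
    refine hv.2 w hwp (lexDFSLabel_lt G ?_)
    have hpr : p.reverse = b.reverse ++ u :: a.reverse := by simp [hab]
    have hno : ∀ y ∈ b, ¬ G.Adj y v := by
      intro y hy hadj
      have h1 : σ.idxOf y < σ.idxOf v := (hmem y).1 (by simp [hab, hy])
      have h2 := hu.2.2 y hadj h1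
      have h3 : σ = (a ++ [u]) ++ (b ++ v :: q) := by simp [hp, hab]
      have h4 := (mem_iff_idxOf_lt hσ.1.1 (p := a) (v := u) (q := b ++ v :: q) (by simp [hp, hab]) y)
      have hnd := hσ.1.1
      rw [h3] at hnd
      have h5 : y ∉ a ++ [u] := fun hc =>
        (List.nodup_append.1 hnd).2.2 y hc y (by simp [hy]) rfl
      rcases eq_or_lt_of_le h2 with he | hlt
      · exact h5 (by simp [hσ.1.idxOf_inj he])
      · exact h5 (by simp [h4.2 hlt])
    have hxadj : G.Adj x w := by
      rcases lastInTree_adj.1 hxw with h' | h'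
      · exact h'.1
      · exact h'.1.symm
    rw [hpr, List.map_append, lexPrec_append]
    left
    rcases lexPrec_trichotomy (b.reverse.map G.Adj) w v with h' | h' | h'
    · exact h'
    · exact absurd ((h' _ (List.mem_map.2 ⟨x, by simpa using hx, rfl⟩)).1 hxadj) (hno x hx)
    · obtain ⟨S, hS, h1, -⟩ := h'.exists_mem
      obtain ⟨y, hy, rfl⟩ := List.mem_map.1 hS
      exact absurd h1 (hno y (by simpa using hy))

lemma IsLexDFSOrder.isOrderEndingIn (hσ : IsLexDFSOrder G s σ) : IsOrderEndingIn σ.reverse s := by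
  obtain ⟨q, rfl⟩ := hσ.cons
  exact ⟨hσ.1.reverse, by simp⟩

variable [Fintype V]

/-- The DFS⁺ order of the last-in tree only depends on how siblings are compared by the tie-break
order, and this comparison is the same for `β`, the reverse of any BFS order of the tree, and for
any other reversed tree extension `γ`. -/
lemma isPlusOrder_tieBreak (h : IsCliqueOrder G s σ) {ρ β γ τ : List V} (hρ : IsVertexOrder ρ)
    (hβ : IsSearchOrder (bfsElig (lastInTree G σ) s) β.reverse) (hγ : IsVertexOrder γ)
    (hγext : IsTreeExtension G σ γ.reverse) (hτ : IsVertexOrder τ)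
    (hclosed : ∀ p v q, τ = p ++ v :: q → ∀ u, IsLastInParent G σ u v → u ∈ p)
    (hdfs : ∀ p v q, τ = p ++ v :: q → dfsElig (lastInTree G σ) s p v ∧
      ∀ u w, w ∉ p → w ≠ v → IsLastInParent G σ u v → IsLastInParent G σ u w →
        Before (leftSets G γ) ρ.reverse v w) :
    IsPlusOrder (dfsElig (lastInTree G σ) s) (tieBreak G s ρ β) τ := by
  have hβv : IsVertexOrder β := by simpa using hβ.1.reverse
  have hβext : IsTreeExtension G σ β.reverse :=
    h.isTreeExtension hβ.1 fun p v q hp => (hβ.2 p v q hp).exists_adj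
  refine ⟨hτ, fun p v q hp => ⟨(hdfs p v q hp).1, fun w hw hwv => ?_⟩⟩
  have hmem := mem_iff_idxOf_lt hτ.1 hp
  have hpcl : ∀ x ∈ p, ∀ y, IsLastInParent G σ y x → y ∈ p := by
    intro x hx y hy
    obtain ⟨p', q', hp'⟩ := hτ.exists_split x
    have h1 := (mem_iff_idxOf_lt hτ.1 hp' y).1 (hclosed p' x q' hp' y hy)
    have h2 := (hmem x).1 hx
    exact (hmem y).2 (by omega)
  have hpnd : p.Nodup := (List.nodup_append.1 (hp ▸ hτ.1)).1
  obtain ⟨u, -, huv, huw⟩ := dfsElig.exists_parent h hpnd hpcl (hdfs p v q hp).1 hw (Ne.symm hwv)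
  refine tieBreak_idxOf_lt G hρ ?_ ?_ (before_leftSets_congr h hγ hγext hβv hβext huv huw
    ((hdfs p v q hp).2 u w hw.1 hwv huv huw))
  · rintro rfl; exact h.not_isLastInParent_head u huv
  · rintro rfl; exact h.not_isLastInParent_head u huw

/-- LexBFS with tie-breaking by `σ⁻` visits parents in the last-in tree of `σ` before their
children. Otherwise let `v` be the first exception and `a` its topmost unvisited ancestor. The
visited neighbours of `v` are ancestors of `a`, hence neighbours of `a`; so the label of `a` is not
smaller, and `a` is to the left of `v` in `σ`. -/
lemma IsCliqueOrder.isTreeExtension_lexBFS (h : IsCliqueOrder G s σ) {π : List V}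
    (hπ : IsPlusOrder (lexBFSElig G s) σ.reverse π) : IsTreeExtension G σ π := by
  intro u v huv
  induction v using idxOf_induction π generalizing u with
  | _ v ih =>
    obtain ⟨p, q, hp⟩ := hπ.1.exists_split v
    have hmem := mem_iff_idxOf_lt hπ.1.1 hp
    rw [← hmem]
    by_contra hup
    obtain ⟨hv, hmax⟩ := hπ.2 p v q hp
    have hclosed : ∀ {x y}, Above G σ x y → y ∈ p → x ∈ p := by
      intro x y hxy
      induction hxy with
      | single hxy =>
        intro hy
        have := ih _ ((hmem _).1 hy) _ hxy
        have := (hmem _).1 hy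
        exact (hmem _).2 (by omega)
      | tail _ hyz ih' =>
        intro hz
        have := ih _ ((hmem _).1 hz) _ hyz
        have := (hmem _).1 hz
        exact ih' ((hmem _).2 (by omega))
    have htop : ∃ a, Above G σ a v ∧ a ∉ p ∧ ∀ x, Above G σ x a → x ∈ p := by
      have : ∀ u, Above G σ u v → u ∉ p → ∃ a, Above G σ a v ∧ a ∉ p ∧
          ∀ x, Above G σ x a → x ∈ p := by
        intro u
        induction u using idxOf_induction σ with
        | _ u ih' =>
          intro huv hup
          by_cases hx : ∀ x, Above G σ x u → x ∈ p
          · exact ⟨u, huv, hup, hx⟩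
          · push Not at hx
            obtain ⟨x, hxu, hxp⟩ := hx
            exact ih' x hxu.idxOf_lt (hxu.trans huv) hxp
      exact this u (.single huv) hup
    obtain ⟨a, hav, hap, htop⟩ := htop
    have hsub : ∀ y ∈ p, G.Adj y v → G.Adj y a := by
      intro y hy hyv
      rcases h.above_or_above hyv with h' | h'
      · rcases Above.trichotomy h.isVertexOrder h' hav with rfl | hya | hay
        · exact absurd hy hap
        · exact h.adj_of_above hya hav.to_reflTransGen hyv
        · exact absurd (hclosed hay hy) hap
      · exact absurd (hclosed h' hy) hv.1
    have hne : a ≠ v := by rintro rfl; exact lt_irrefl _ hav.idxOf_lt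
    have hpnil : p ≠ [] := by
      rintro rfl
      obtain rfl := (lexBFSElig_nil_iff G).1 hv
      exact h.not_isLastInParent_head u huv
    have hcons := hπ.isSearchOrder.lexBFS_cons
    have has := ne_head_of_not_mem hcons hp hpnil hap
    have hvs := ne_head_of_not_mem hcons hp hpnil hv.1
    have hlen := hπ.1.length_prefix_le hp
    rcases lexPrec_trichotomy (p.map G.Adj) a v with h' | h' | h'
    · exact hv.2 a hap (lexBFSLabel_lt G has hvs hlen h')
    · have hlab := lexBFSLabel_eq G has hvs h'
      have helig : lexBFSElig G s p a := ⟨hap, fun w hw => hlab ▸ hv.2 w hw⟩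
      have h1 := hmax a helig hne
      rw [idxOf_reverse_lt_iff h.isVertexOrder.1 (h.isVertexOrder.2 _) (h.isVertexOrder.2 _)] at h1
      have h2 := hav.idxOf_lt
      omega
    · obtain ⟨S, hS, h1, h2⟩ := h'.exists_mem
      obtain ⟨y, hy, rfl⟩ := List.mem_map.1 hS
      exact h2 (hsub y hy h1)

lemma exists_isPlusOrder_lexBFS (G : SimpleGraph V) [DecidableRel G.Adj] (s : V) {ρ : List V}
    (hρ : IsVertexOrder ρ) : ∃ π, IsPlusOrder (lexBFSElig G s) ρ π := by
  refine exists_isPlusOrder hρ (fun p v h => h.1) fun p v hv => ?_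
  obtain ⟨w, hw, hmax⟩ := (Set.toFinite {w | w ∉ p}).exists_maximalFor
    (fun w => lexBFSLabel G s p w) _ ⟨v, hv⟩
  exact ⟨w, hw, fun x hx hlt => lt_irrefl _ (hlt.trans_le (hmax hx hlt.le))⟩

/-- With the reverse of a LexDFS order `σ` as tie-break order, the algorithm returns `σ`, and
nothing else. -/
theorem IsLexDFSOrder.chordalLexDFSPlusOutput_iff (hG : G.Connected) (hc : IsChordal G)
    (hσ : IsLexDFSOrder G s σ) (τ : List V) :
    ChordalLexDFSPlusOutput G s σ.reverse τ ↔ τ = σ := by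
  have h : IsCliqueOrder G s σ := hσ.isMNSOrder.isCliqueOrder hG hc hσ.cons
  have htree : ∀ {π}, IsPlusOrder (lexBFSElig G s) σ.reverse π → lastInTree G π = lastInTree G σ :=
    fun hπ => h.lastInTree_congr hπ.1 (h.isTreeExtension_lexBFS hπ)
  have hplus : ∀ {β : List V}, IsSearchOrder (bfsElig (lastInTree G σ) s) β.reverse →
      IsPlusOrder (GraphSearch.dfsElig (lastInTree G σ) s) (tieBreak G s σ.reverse β) σ := by
    intro β hβ
    refine isPlusOrder_tieBreak h hσ.1.reverse hβ hσ.1.reverse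
      (by rw [List.reverse_reverse]; exact .refl G σ) hσ.1 (fun p v q hp u hu => ?_)
      fun p v q hp => ⟨hσ.dfsElig h hp, fun u w hw hwv huv huw => ?_⟩
    · exact (mem_iff_idxOf_lt hσ.1.1 hp u).2 hu.2.1
    · rw [List.reverse_reverse]
      exact hσ.before_leftSets h hp hw hwv huv huw
  constructor
  · rintro ⟨π, hπ, β, hβ, hτ⟩
    rw [htree hπ] at hβ hτ
    exact hτ.unique (hplus hβ)
  · rintro rfl
    obtain ⟨π, hπ⟩ := exists_isPlusOrder_lexBFS G s hσ.1.reverse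
    obtain ⟨β, hβ⟩ := h.exists_bfsOrder
    refine ⟨π, hπ, β, ?_, ?_⟩
    · rwa [htree hπ]
    · rw [htree hπ]; exact hplus hβ

end Siblings

/-! ### Depth first search of the tree with a stack -/

section Stack

variable {V : Type*} [DecidableEq V] {G : SimpleGraph V} {s : V} {π L p S : List V}

/-- The vertices of `p` have been visited, and the list `S`, from its top on, is the stack of their
unvisited children in the last-in tree of `π`. The children of a vertex are sorted by `L`. -/
structure IsDFSState (G : SimpleGraph V) (s : V) (π L p S : List V) : Prop where
  nodup : p.Nodup
  nodup_stack : S.Nodup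
  mem_stack : ∀ w, w ∈ S ↔ w ∉ p ∧ ((p = [] ∧ w = s) ∨ ∃ u ∈ p, IsLastInParent G π u w)
  sorted : S.Pairwise fun x y => ∀ u u', IsLastInParent G π u x → IsLastInParent G π u' y →
    p.idxOf u' < p.idxOf u ∨ (u = u' ∧ L.idxOf x < L.idxOf y)
  visited : ∀ a v b, p = a ++ v :: b → (∀ u, IsLastInParent G π u v → u ∈ a) ∧
    dfsElig (lastInTree G π) s a v ∧ ∀ u w, w ∉ a → w ≠ v → IsLastInParent G π u v →
      IsLastInParent G π u w → L.idxOf v < L.idxOf w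

namespace IsDFSState

lemma init (G : SimpleGraph V) (s : V) (π L : List V) : IsDFSState G s π L [] [s] where
  nodup := List.nodup_nil
  nodup_stack := List.nodup_singleton s
  mem_stack w := by simp
  sorted := List.pairwise_singleton _ _
  visited a v b h := by simp at h

lemma parent_mem (h : IsDFSState G s π L p S) {u x : V} (hx : x ∈ p)
    (hu : IsLastInParent G π u x) : u ∈ p := by
  obtain ⟨a, b, rfl⟩ := List.append_of_mem hx
  exact List.mem_append_left _ ((h.visited a x b rfl).1 u hu)

lemma parent_mem_of_mem_stack (h : IsDFSState G s π L p S) (hπ : IsCliqueOrder G s π) {u x : V}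
    (hx : x ∈ S) (hu : IsLastInParent G π u x) : u ∈ p := by
  obtain ⟨-, ⟨-, rfl⟩ | ⟨u', hu', hx'⟩⟩ := (h.mem_stack x).1 hx
  · exact absurd hu (hπ.not_isLastInParent_head u)
  · rwa [hu.unique hπ.isVertexOrder hx']

/-- The vertex on the top of the stack is visited, and its children are pushed. -/
lemma step {v : V} {C : List V} (h : IsDFSState G s π L p (v :: S)) (hπ : IsCliqueOrder G s π)
    (hC : C.Pairwise fun x y => L.idxOf x < L.idxOf y)
    (hmem : ∀ w, w ∈ C ↔ IsLastInParent G π v w) : IsDFSState G s π L (p ++ [v]) (C ++ S) := by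
  obtain ⟨hvp, hvp'⟩ := (h.mem_stack v).1 (by simp)
  obtain ⟨hvS, hS⟩ := List.nodup_cons.1 h.nodup_stack
  obtain ⟨hsv, hsorted⟩ := List.pairwise_cons.1 h.sorted
  have hparS : ∀ {u x}, x ∈ S → IsLastInParent G π u x → u ∈ p := fun hx hu =>
    h.parent_mem_of_mem_stack hπ (by simp [hx]) hu
  have hidx : ∀ {u}, u ∈ p → (p ++ [v]).idxOf u = p.idxOf u := fun hu =>
    List.idxOf_append_of_mem hu
  have hidxv : (p ++ [v]).idxOf v = p.length := by
    rw [List.idxOf_append_of_notMem hvp]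
    simp
  refine ⟨?_, ?_, fun w => ?_, ?_, ?_⟩
  · rw [List.nodup_append]
    refine ⟨h.nodup, by simp, ?_⟩
    rintro x hx y hy rfl
    rw [List.mem_singleton] at hy
    exact hvp (hy ▸ hx)
  · rw [List.nodup_append]
    refine ⟨hC.imp (by rintro x y h rfl; exact lt_irrefl _ h), hS, ?_⟩
    rintro x hx y hy rfl
    exact hvp (hparS hy ((hmem x).1 hx))
  · rw [List.mem_append, hmem]
    constructor
    · rintro (hw | hw)
      · refine ⟨fun hwp => ?_, .inr ⟨v, by simp, hw⟩⟩
        rcases List.mem_append.1 hwp with hwp | hwp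
        · exact hvp (h.parent_mem hwp hw)
        · rw [List.mem_singleton] at hwp
          exact hw.1.ne hwp.symm
      · have hwv : w ≠ v := by rintro rfl; exact hvS hw
        obtain ⟨hwp, ⟨hp, rfl⟩ | ⟨u, hu, huw⟩⟩ := (h.mem_stack w).1 (by simp [hw])
        · rcases hvp' with ⟨-, rfl⟩ | ⟨u, hu, -⟩
          · exact absurd rfl hwv
          · simp [hp] at hu
        · exact ⟨by simp [hwp, hwv], .inr ⟨u, by simp [hu], huw⟩⟩
    · rintro ⟨hw, ⟨hp, -⟩ | ⟨u, hu, huw⟩⟩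
      · simp at hp
      · simp only [List.mem_append, List.mem_singleton, not_or] at hw
        rcases List.mem_append.1 hu with hu | hu
        · have := (h.mem_stack w).2 ⟨hw.1, .inr ⟨u, hu, huw⟩⟩
          exact .inr ((List.mem_cons.1 this).resolve_left hw.2)
        · rw [List.mem_singleton] at hu
          exact .inl (hu ▸ huw)
  · rw [List.pairwise_append]
    refine ⟨?_, ?_, ?_⟩
    · refine hC.imp_of_mem fun {x y} hx hy hxy u u' hu hu' => .inr ⟨?_, hxy⟩
      rw [hu.unique hπ.isVertexOrder ((hmem x).1 hx), hu'.unique hπ.isVertexOrder ((hmem y).1 hy)]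
    · refine hsorted.imp_of_mem fun {x y} hx hy hxy u u' hu hu' => ?_
      rw [hidx (hparS hx hu), hidx (hparS hy hu')]
      exact hxy u u' hu hu'
    · intro x hx y hy u u' hu hu'
      obtain rfl := hu.unique hπ.isVertexOrder ((hmem x).1 hx)
      rw [hidx (hparS hy hu'), hidxv]
      exact .inl (List.idxOf_lt_length_iff.2 (hparS hy hu'))
  · intro a w b hab
    rcases List.eq_nil_or_concat b with rfl | ⟨b', y, rfl⟩
    · obtain ⟨rfl, hw⟩ := List.append_inj' hab rfl
      obtain rfl : v = w := by simpa using hw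
      refine ⟨fun u hu => h.parent_mem_of_mem_stack hπ (by simp) hu, ⟨hvp, ?_⟩, ?_⟩
      · refine hvp'.imp id ?_
        rintro ⟨u, hu, huv⟩
        obtain ⟨a, b, rfl⟩ := List.append_of_mem hu
        refine ⟨a, u, b, rfl, lastInTree_adj.2 (.inl huv), fun x hx w hxw => ?_⟩
        have hxp : x ∈ a ++ u :: b := by simp [hx]
        -- the vertices visited after the parent `u` of `v` have no unvisited neighbour, because the
        -- children of later vertices are higher on the stack than `v`
        have hux : (a ++ u :: b).idxOf u < (a ++ u :: b).idxOf x := by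
          by_contra hc
          have hne : x ≠ u := by
            rintro rfl
            exact (List.nodup_cons.1 (List.nodup_append.1 h.nodup).2.1).1 hx
          have hne' : (a ++ u :: b).idxOf x ≠ (a ++ u :: b).idxOf u := fun he =>
            hne ((List.idxOf_inj hxp).1 he)
          exact (List.nodup_append.1 h.nodup).2.2 x
            ((mem_iff_idxOf_lt h.nodup rfl x).2 (by omega)) x (by simp [hx]) rfl
        rcases lastInTree_adj.1 hxw with hxw | hxw
        · by_contra hw
          have := (h.mem_stack w).2 ⟨hw, .inr ⟨x, hxp, hxw⟩⟩
          rcases List.mem_cons.1 this with rfl | hwS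
          · obtain rfl := huv.unique hπ.isVertexOrder hxw
            exact lt_irrefl _ hux
          · rcases hsv w hwS u x huv hxw with h' | ⟨rfl, -⟩
            · omega
            · exact lt_irrefl _ hux
        · exact h.parent_mem hxp hxw
      · intro u w hw hwv huv huw
        have hu := h.parent_mem_of_mem_stack hπ (by simp) huv
        have := (h.mem_stack w).2 ⟨hw, .inr ⟨u, hu, huw⟩⟩
        rcases hsv w ((List.mem_cons.1 this).resolve_left hwv) u u huv huw with h' | h'
        · exact absurd h' (lt_irrefl _)
        · exact h'.2
    · rw [List.concat_eq_append, ← List.cons_append, ← List.append_assoc] at hab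
      exact h.visited a w b' (List.append_inj' hab rfl).1

lemma isVertexOrder (h : IsDFSState G s π L p []) (hπ : IsCliqueOrder G s π) :
    IsVertexOrder p := by
  refine ⟨h.nodup, fun w => ?_⟩
  induction w using idxOf_induction π with
  | _ w ih =>
  by_contra hw
  have hmem := mt (h.mem_stack w).2 (by simp)
  by_cases hws : w = s
  · cases p with
    | nil => exact hmem ⟨hw, .inl ⟨rfl, hws⟩⟩
    | cons x p =>
      rcases (h.visited [] x p rfl).2.1.2 with ⟨-, hx⟩ | ⟨a, u, b, hab, -⟩
      · exact hw (by simp [hws, hx])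
      · simp at hab
  · obtain ⟨u, hu⟩ := hπ.exists_parent hws
    exact hmem ⟨hw, .inr ⟨u, ih u hu.2.1, hu⟩⟩

/-- If the children are sorted by the classes of the partition and the tie-break order, then the
search with a stack computes an output of the algorithm. -/
lemma chordalLexDFSPlusOutput [Fintype V] [DecidableRel G.Adj] {ρ : List V}
    (h : IsDFSState G s π L p []) (hπ : IsCliqueOrder G s π) (hρ : IsVertexOrder ρ)
    (hplus : IsPlusOrder (lexBFSElig G s) ρ π) (hL : IsVertexOrder L)
    (hsorted : L.Pairwise (Before (leftSets G π.reverse) ρ.reverse)) :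
    ChordalLexDFSPlusOutput G s ρ p := by
  obtain ⟨β, hβ⟩ := hπ.exists_bfsOrder
  refine ⟨π, hplus, β, hβ, isPlusOrder_tieBreak hπ hρ hβ hπ.isVertexOrder.reverse
    (by rw [List.reverse_reverse]; exact .refl G π) (h.isVertexOrder hπ)
    (fun a v b hab => (h.visited a v b hab).1)
    fun a v b hab => ⟨(h.visited a v b hab).2.1, fun u w hw hwv huv huw => ?_⟩⟩
  have hlt := (h.visited a v b hab).2.2 u w hw hwv huv huw
  obtain ⟨c, d, hcd⟩ := hL.exists_split w
  have hvc := (mem_iff_idxOf_lt hL.1 hcd v).2 hlt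
  rw [hcd] at hsorted
  exact (List.pairwise_append.1 hsorted).2.2 v hvc w (by simp)

end IsDFSState

end Stack

end GraphSearch

namespace Ram

open GraphSearch

/-! ### Running time bounds for programs -/

/-- Started in the memory `m`, the program `P` terminates after at most `b` steps in a memory that
satisfies `Q`. -/
def Terminates (P : Prog) (m : Store) (b : ℕ) (Q : Store → Prop) : Prop :=
  ∃ t m', Runs P m t m' ∧ t ≤ b ∧ Q m'

lemma Terminates.mono {P : Prog} {m : Store} {b b' : ℕ} {Q Q' : Store → Prop}
    (h : Terminates P m b Q) (hb : b ≤ b') (hQ : ∀ m', Q m' → Q' m') : Terminates P m b' Q' := by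
  obtain ⟨t, m', hr, ht, hq⟩ := h
  exact ⟨t, m', hr, ht.trans hb, hQ m' hq⟩

lemma Terminates.seq {P P' : Prog} {m : Store} {b b' : ℕ} {Q Q' : Store → Prop}
    (h : Terminates P m b Q) (h' : ∀ m', Q m' → Terminates P' m' b' Q') :
    Terminates (.seq P P') m (b + b') Q' := by
  obtain ⟨t, m', hr, ht, hq⟩ := h
  obtain ⟨t', m'', hr', ht', hq'⟩ := h' m' hq
  exact ⟨t + t', m'', .seq hr hr', by omega, hq'⟩

/-- The registers to which a program assigns. -/
def Prog.regs : Prog → List ℕ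
  | .skip => []
  | .set r _ => [r]
  | .put _ _ _ => []
  | .seq P Q => P.regs ++ Q.regs
  | .ite _ P Q => P.regs ++ Q.regs
  | .while _ P => P.regs

/-- The arrays to which a program assigns. -/
def Prog.arrs : Prog → List ℕ
  | .skip => []
  | .set _ _ => []
  | .put a _ _ => [a]
  | .seq P Q => P.arrs ++ Q.arrs
  | .ite _ P Q => P.arrs ++ Q.arrs
  | .while _ P => P.arrs

/-- The memories `m` and `m'` agree outside the registers and arrays that `P` may change. -/
def Frame (P : Prog) (m m' : Store) : Prop :=
  (∀ r, r ∉ P.regs → m'.reg r = m.reg r) ∧ ∀ a, a ∉ P.arrs → m'.arr a = m.arr a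

lemma Frame.refl (P : Prog) (m : Store) : Frame P m m := ⟨fun _ _ => rfl, fun _ _ => rfl⟩

lemma Frame.trans {P : Prog} {m m' m'' : Store} (h : Frame P m m') (h' : Frame P m' m'') :
    Frame P m m'' :=
  ⟨fun r hr => (h'.1 r hr).trans (h.1 r hr), fun a ha => (h'.2 a ha).trans (h.2 a ha)⟩

lemma Frame.mono {P P' : Prog} {m m' : Store} (h : Frame P m m')
    (hr : ∀ r ∈ P.regs, r ∈ P'.regs) (ha : ∀ a ∈ P.arrs, a ∈ P'.arrs) : Frame P' m m' :=
  ⟨fun r hr' => h.1 r (mt (hr r) hr'), fun a ha' => h.2 a (mt (ha a) ha')⟩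

lemma Runs.frame {P : Prog} {m m' : Store} {t : ℕ} (h : Runs P m t m') : Frame P m m' := by
  induction h with
  | skip m => exact .refl _ _
  | set r e m =>
    refine ⟨fun r' hr' => ?_, fun _ _ => rfl⟩
    exact Function.update_of_ne (by simpa [Prog.regs] using hr') _ _
  | put a i e m =>
    refine ⟨fun _ _ => rfl, fun a' ha' => ?_⟩
    exact Function.update_of_ne (by simpa [Prog.arrs] using ha') _ _
  | seq _ _ ih ih' =>
    exact (ih.mono (by simp +contextual [Prog.regs]) (by simp +contextual [Prog.arrs])).trans
      (ih'.mono (by simp +contextual [Prog.regs]) (by simp +contextual [Prog.arrs]))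
  | iteTrue _ _ ih =>
    exact ih.mono (by simp +contextual [Prog.regs]) (by simp +contextual [Prog.arrs])
  | iteFalse _ _ ih =>
    exact ih.mono (by simp +contextual [Prog.regs]) (by simp +contextual [Prog.arrs])
  | whileTrue _ _ _ ih ih' => exact Frame.trans (P := .while _ _) ih ih'
  | whileFalse _ => exact .refl _ _

lemma Terminates.frame {P : Prog} {m : Store} {b : ℕ} {Q : Store → Prop}
    (h : Terminates P m b Q) : Terminates P m b fun m' => Q m' ∧ Frame P m m' := by
  obtain ⟨t, m', hr, ht, hq⟩ := h
  exact ⟨t, m', hr, ht, hq, hr.frame⟩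

lemma Test.cost_pos (c : Test) : 0 < c.cost := by cases c <;> simp [Test.cost]

/-- A loop with an invariant `I`, whose first argument bounds the time that is left. -/
lemma terminates_while {c : Test} {P : Prog} (I : ℕ → Store → Prop) {k : ℕ} {m : Store}
    (hI : ∀ k' m', I k' m' → Frame P m m' → c.Holds m' →
      ∃ b k'', b + c.cost + k'' ≤ k' ∧ Terminates P m' b (I k''))
    (h : I k m) : Terminates (.while c P) m (k + c.cost)
      fun m' => (∃ k', I k' m' ∧ ¬ c.Holds m') ∧ Frame P m m' := by
  have key : ∀ k m', I k m' → Frame P m m' → Terminates (.while c P) m' (k + c.cost)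
      fun m' => (∃ k', I k' m' ∧ ¬ c.Holds m') ∧ Frame P m m' := by
    intro k
    induction k using Nat.strong_induction_on with
    | _ k ih =>
    intro m' h hf
    by_cases hc : c.Holds m'
    · obtain ⟨b, k', hk, t₁, m₁, hr₁, ht₁, hI₁, hf₁⟩ :
          ∃ b k', b + c.cost + k' ≤ k ∧ Terminates P m' b fun m'' => I k' m'' ∧ Frame P m' m'' := by
        obtain ⟨b, k', hk, hT⟩ := hI k m' h hf hc
        exact ⟨b, k', hk, hT.frame⟩
      have := c.cost_pos
      obtain ⟨t₂, m₂, hr₂, ht₂, hQ⟩ := ih k' (by omega) m₁ hI₁ (hf.trans hf₁)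
      exact ⟨_, m₂, .whileTrue hc hr₁ hr₂, by omega, hQ⟩
    · exact ⟨_, m', .whileFalse hc, by omega, ⟨k, h, hc⟩, hf⟩
  exact key k m h (.refl _ _)

/-- A loop that goes through the elements of a list `l`. The invariant depends on the part of the
list that has been dealt with. -/
lemma terminates_foreach {α : Type*} {c : Test} {P : Prog} (l : List α)
    (I : List α → Store → Prop) (B : α → ℕ) {m : Store}
    (hstep : ∀ l₁ x l₂ m', l = l₁ ++ x :: l₂ → I l₁ m' → Frame P m m' →
      c.Holds m' ∧ Terminates P m' (B x) (I (l₁ ++ [x])))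
    (hend : ∀ m', I l m' → Frame P m m' → ¬ c.Holds m') (h : I [] m) :
    Terminates (.while c P) m ((l.map fun x => B x + c.cost).sum + c.cost)
      fun m' => I l m' ∧ Frame P m m' := by
  have key : ∀ l₂ l₁ m', l = l₁ ++ l₂ → I l₁ m' → Frame P m m' →
      Terminates (.while c P) m' ((l₂.map fun x => B x + c.cost).sum + c.cost)
        fun m' => I l m' ∧ Frame P m m' := by
    intro l₂
    induction l₂ with
    | nil =>
      intro l₁ m' hl hI hf
      rw [List.append_nil] at hl
      subst hl
      exact ⟨_, m', .whileFalse (hend m' hI hf), by simp, hI, hf⟩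
    | cons x l₂ ih =>
      intro l₁ m' hl hI hf
      obtain ⟨hc, hT⟩ := hstep l₁ x l₂ m' hl hI hf
      obtain ⟨t₁, m₁, hr₁, ht₁, hI₁, hf₁⟩ := hT.frame
      obtain ⟨t₂, m₂, hr₂, ht₂, hQ⟩ := ih (l₁ ++ [x]) m₁ (by simp [hl]) hI₁ (hf.trans hf₁)
      refine ⟨_, m₂, .whileTrue hc hr₁ hr₂, ?_, hQ⟩
      simp only [List.map_cons, List.sum_cons]
      omega
  exact key l [] m rfl h (.refl _ _)

instance (c : Test) (m : Store) : Decidable (c.Holds m) :=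
  match c with
  | .eq e f => inferInstanceAs (Decidable (e.eval m = f.eval m))
  | .lt e f => inferInstanceAs (Decidable (e.eval m < f.eval m))

/-- The program has no loops. -/
def Prog.LoopFree : Prog → Prop
  | .skip => True
  | .set _ _ => True
  | .put _ _ _ => True
  | .seq P Q => P.LoopFree ∧ Q.LoopFree
  | .ite _ P Q => P.LoopFree ∧ Q.LoopFree
  | .while _ _ => False

/-- The memory after the execution of a program without loops. -/
def Prog.exec : Prog → Store → Store
  | .skip, m => m
  | .set r e, m => m.setReg r (e.eval m)
  | .put a i e, m => m.setCell a (i.eval m) (e.eval m)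
  | .seq P Q, m => Q.exec (P.exec m)
  | .ite c P Q, m => if c.Holds m then P.exec m else Q.exec m
  | .while _ _, m => m

/-- A bound for the running time of a program without loops. -/
def Prog.maxCost : Prog → ℕ
  | .skip => 1
  | .set _ e => e.cost + 1
  | .put _ i e => i.cost + e.cost + 1
  | .seq P Q => P.maxCost + Q.maxCost
  | .ite c P Q => c.cost + (P.maxCost + Q.maxCost)
  | .while _ _ => 0

lemma terminates_exec {P : Prog} {m : Store} {b : ℕ} {Q : Store → Prop} (hP : P.LoopFree)
    (hb : P.maxCost ≤ b) (hQ : Q (P.exec m)) : Terminates P m b Q := by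
  suffices h : ∃ t, Runs P m t (P.exec m) ∧ t ≤ P.maxCost by
    obtain ⟨t, hr, ht⟩ := h
    exact ⟨t, _, hr, ht.trans hb, hQ⟩
  clear hQ hb
  induction P generalizing m with
  | skip => exact ⟨_, .skip m, le_rfl⟩
  | set r e => exact ⟨_, .set r e m, le_rfl⟩
  | put a i e => exact ⟨_, .put a i e m, le_rfl⟩
  | seq P P' ih ih' =>
    obtain ⟨t, hr, ht⟩ := ih (m := m) hP.1
    obtain ⟨t', hr', ht'⟩ := ih' (m := P.exec m) hP.2
    exact ⟨_, .seq hr hr', Nat.add_le_add ht ht'⟩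
  | ite c P P' ih ih' =>
    by_cases hc : c.Holds m
    · obtain ⟨t, hr, ht⟩ := ih (m := m) hP.1
      refine ⟨_, .iteTrue hc (by rwa [Prog.exec, if_pos hc]), ?_⟩
      rw [Prog.maxCost]
      omega
    · obtain ⟨t, hr, ht⟩ := ih' (m := m) hP.2
      refine ⟨_, .iteFalse hc (by rwa [Prog.exec, if_neg hc]), ?_⟩
      rw [Prog.maxCost]
      omega
  | _ => exact hP.elim

/-- The programs of a list, one after the other. -/
def block : List Prog → Prog
  | [] => .skip
  | [P] => P
  | P :: l => .seq P (block l)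

lemma block_singleton (P : Prog) : block [P] = P := rfl

lemma block_cons_cons (P P' : Prog) (l : List Prog) :
    block (P :: P' :: l) = .seq P (block (P' :: l)) := rfl

lemma terminates_block_exec {P P' : Prog} {l : List Prog} {m : Store} {b b' : ℕ}
    {Q : Store → Prop} (hP : P.LoopFree) (hb : P.maxCost + b ≤ b')
    (h : Terminates (block (P' :: l)) (P.exec m) b Q) :
    Terminates (block (P :: P' :: l)) m b' Q :=
  ((terminates_exec (Q := (· = P.exec m)) hP le_rfl rfl).seq (by rintro _ rfl; exact h)).mono hb
    fun _ h => h

lemma Terminates.block_cons {P P' : Prog} {l : List Prog} {m : Store} {b₁ b₂ b : ℕ}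
    {Q Q' : Store → Prop} (h : Terminates P m b₁ Q) (hb : b₁ + b₂ ≤ b)
    (h' : ∀ m', Q m' → Terminates (block (P' :: l)) m' b₂ Q') :
    Terminates (block (P :: P' :: l)) m b Q' :=
  (h.seq h').mono hb fun _ h => h

/-! ### The input -/

/-- The memory holds `n` in register 0 and the adjacency lists `adj` in arrays 1 and 2. -/
structure HasGraph {n : ℕ} (adj : Fin n → List (Fin n)) (m : Store) : Prop where
  reg : m.reg 0 = n
  bound : ∀ v : Fin n, m.arr 1 (v + 1) = m.arr 1 v + (adj v).length
  cell : ∀ (v : Fin n) (i : ℕ) (h : i < (adj v).length),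
    m.arr 2 (m.arr 1 v + i) = ((adj v)[i] : Fin n)

lemma HasGraph.congr {n : ℕ} {adj : Fin n → List (Fin n)} {m m' : Store} (h : HasGraph adj m)
    (h0 : m'.reg 0 = m.reg 0) (h1 : m'.arr 1 = m.arr 1) (h2 : m'.arr 2 = m.arr 2) :
    HasGraph adj m' :=
  ⟨h0 ▸ h.reg, h1 ▸ h.bound, h1 ▸ h2 ▸ h.cell⟩

/-- The array with the contents `f` holds the list `l`, from cell 0 on. -/
def ArrayHolds {n : ℕ} (f : ℕ → ℕ) (l : List (Fin n)) : Prop :=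
  ∀ (i : ℕ) (h : i < l.length), f i = (l[i] : Fin n)

lemma arrayHolds_cells {n : ℕ} (l : List (Fin n)) : ArrayHolds (cells (l.map Fin.val)) l := by
  intro i h
  simp [cells, List.getD_eq_getElem?_getD, h]

lemma getD_flatMap {α : Type*} (f : α → List ℕ) (L : List α) (k i : ℕ) (hk : k < L.length)
    (hi : i < (f L[k]).length) :
    (L.flatMap f).getD (((L.take k).map fun v => (f v).length).sum + i) 0 = (f L[k])[i] := by
  induction L generalizing k with
  | nil => simp at hk
  | cons x L ih =>
    cases k with
    | zero =>
      simp only [List.getElem_cons_zero] at hi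
      simp [List.getD_eq_getElem?_getD, List.getElem?_append_left hi, hi]
    | succ k =>
      simp only [List.getElem_cons_succ] at hi
      have := ih k (by simpa using hk) hi
      simp only [List.flatMap_cons, List.take_succ_cons, List.map_cons, List.sum_cons,
        List.getElem_cons_succ]
      rw [← this, List.getD_eq_getElem?_getD, List.getD_eq_getElem?_getD,
        List.getElem?_append_right (by omega)]
      congr 2
      omega

lemma hasGraph_inputStore {n : ℕ} (adj : Fin n → List (Fin n)) (s : Fin n) (ρ : List (Fin n)) :
    HasGraph adj (inputStore adj s ρ) := by
  have hb : ∀ k ≤ n, (inputStore adj s ρ).arr 1 k =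
      (((List.finRange n).take k).map fun v => (adj v).length).sum := by
    intro k hk
    have : k < n + 1 := by omega
    simp [inputStore, cells, adjacencyBounds, List.getD_eq_getElem?_getD, this]
  refine ⟨rfl, fun v => ?_, fun v i hi => ?_⟩
  · rw [hb _ v.2, hb _ v.2.le, List.take_add_one]
    simp
  · rw [hb _ v.2.le]
    have := getD_flatMap (fun v => (adj v).map Fin.val) (List.finRange n) v i (by simp)
      (by simpa using hi)
    simpa [inputStore, cells, adjacencyCells] using this

lemma sum_map_of_isVertexOrder {n : ℕ} {l : List (Fin n)} (h : IsVertexOrder l)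
    (f : Fin n → ℕ) : (l.map f).sum = ∑ v, f v := by
  rw [← List.sum_toFinset f h.1]
  congr 1
  ext v
  simp [h.2 v]

lemma length_of_isVertexOrder {n : ℕ} {l : List (Fin n)} (h : IsVertexOrder l) : l.length = n := by
  have := sum_map_of_isVertexOrder h fun _ => 1
  simpa using this

/-! ### Sorting the adjacency lists -/

/-!
The arrays are used as follows.

* 0, 1, 2: the input; 3: the output;
* 4, 5: the entries and the successors of the cells of linked lists, in which the cell 0 is the end;
* 6, 7: the first cells of the two families of sorted adjacency lists;
* 8, 9: successors and predecessors in the doubly linked list of vertices, with the sentinel `n`;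
* 10: the class of a vertex; 11: the first vertex of a class; 12: the class split off from a class;
* 13: marks of vertices, the mark 0 selecting the vertices that may belong to a refining set;
* 14: the parents in the last-in tree, increased by one, so that 0 stands for no parent;
* 15: the LexBFS⁺ order from right to left; 16: the final order of the partition;
* 17: the stack; 18: written by the refinement in place of 14, and never read.

Register 3 is the current vertex, register 7 the first free cell of the linked lists, and register 8
the first free class number.
-/

/-- The linked list that starts in the cell `e` (0 is the end) has the entries `l`. All its cells
are positive numbers below `K`. -/
def IsLinkedList (val nxt : ℕ → ℕ) (K : ℕ) : ℕ → List ℕ → Prop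
  | e, [] => e = 0
  | e, x :: l => 0 < e ∧ e < K ∧ val e = x ∧ IsLinkedList val nxt K (nxt e) l

lemma IsLinkedList.update {val nxt : ℕ → ℕ} {K e : ℕ} {l : List ℕ}
    (h : IsLinkedList val nxt K e l) (x y : ℕ) :
    IsLinkedList (Function.update val K x) (Function.update nxt K y) (K + 1) e l := by
  induction l generalizing e with
  | nil => exact h
  | cons z l ih =>
    obtain ⟨h0, hK, hv, hl⟩ := h
    refine ⟨h0, by omega, ?_, ?_⟩
    · rwa [Function.update_of_ne (by omega)]
    · rw [Function.update_of_ne (by omega)]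
      exact ih hl

/-- The inner loop of `sortAdj`: the vertex in register 3 is pushed to the front of the linked
lists of its neighbours. -/
def pushLoopBody (hd : ℕ) : Prog := block [
  .set 6 (.get 2 (.reg 4)),
  .put 4 (.reg 7) (.reg 3),
  .put 5 (.reg 7) (.get hd (.reg 6)),
  .put hd (.reg 6) (.reg 7),
  .set 7 (.succ (.reg 7)),
  .set 4 (.succ (.reg 4))]

/-- The outer loop of `sortAdj`: the next vertex of the order is dealt with. -/
def sortAdjBody (src hd : ℕ) : Prog := block [
  block [
    .set 3 (.get src (.reg 2)),
    .set 4 (.get 1 (.reg 3)),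
    .set 5 (.get 1 (.succ (.reg 3)))],
  .while (.lt (.reg 4) (.reg 5)) (pushLoopBody hd),
  .set 2 (.succ (.reg 2))]

/-- For each vertex `w`, make a linked list of the neighbours of `w`, in the reverse of the order
that is held by the array `src`. Its first cell is entered into the array `hd`; the entries and
successors of the cells are in arrays 4 and 5. Register 7 is the number of the first free cell. -/
def sortAdj (src hd : ℕ) : Prog := block [
  .set 2 (.const 0),
  .while (.lt (.reg 2) (.reg 0)) (sortAdjBody src hd)]

/-- The lists built by `sortAdj` have the entries `L w`. -/
structure HasLists {n : ℕ} (hd : ℕ) (L : Fin n → List (Fin n)) (m : Store) : Prop where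
  pos : 0 < m.reg 7
  list : ∀ w : Fin n, IsLinkedList (m.arr 4) (m.arr 5) (m.reg 7) (m.arr hd w) ((L w).map Fin.val)

attribute [local simp] Prog.exec Prog.regs Prog.arrs Prog.LoopFree block_singleton block_cons_cons
  Store.setReg Store.setCell Expr.eval Test.Holds

lemma HasLists.congr {n : ℕ} {hd : ℕ} {L : Fin n → List (Fin n)} {m m' : Store}
    (h : HasLists hd L m) (h7 : m'.reg 7 = m.reg 7) (h4 : m'.arr 4 = m.arr 4)
    (h5 : m'.arr 5 = m.arr 5) (hhd : m'.arr hd = m.arr hd) : HasLists hd L m' :=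
  ⟨h7 ▸ h.pos, by rw [h4, h5, h7, hhd]; exact h.list⟩

section

variable {n : ℕ} {adj : Fin n → List (Fin n)} {src hd : ℕ}

lemma pushLoopBody_exec {L : Fin n → List (Fin n)} {m : Store}
    (h4 : hd ≠ 4) (h5 : hd ≠ 5) (hL : HasLists hd L m) {v w : Fin n}
    (hv : m.reg 3 = v) (hw : m.arr 2 (m.reg 4) = w) :
    HasLists hd (Function.update L w (v :: L w)) ((pushLoopBody hd).exec m) ∧
      ((pushLoopBody hd).exec m).reg 4 = m.reg 4 + 1 := by
  have := hL.pos
  refine ⟨⟨by simp [pushLoopBody], fun x => ?_⟩, by simp [pushLoopBody]⟩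
  by_cases hx : x = w
  · subst hx
    simp [pushLoopBody, h4, h5, h4.symm, h5.symm, hw, hv, IsLinkedList, this,
      IsLinkedList.update (hL.list x)]
  · have hx' : (x : ℕ) ≠ w := fun h => hx (Fin.ext h)
    simp [pushLoopBody, h4, h5, h4.symm, h5.symm, hw, hv, hx, hx',
      IsLinkedList.update (hL.list x)]

lemma pushLoop {m : Store} (h2 : hd ≠ 2) (h4 : hd ≠ 4) (h5 : hd ≠ 5)
    (hg : HasGraph adj m) {L : Fin n → List (Fin n)} (hL : HasLists hd L m) {v : Fin n}
    (hnd : (adj v).Nodup)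
    (hv : m.reg 3 = v) (hr4 : m.reg 4 = m.arr 1 v) (hr5 : m.reg 5 = m.arr 1 (v + 1)) :
    Terminates (.while (.lt (.reg 4) (.reg 5)) (pushLoopBody hd)) m
      (((adj v).map fun _ => (pushLoopBody hd).maxCost + 3).sum + 3)
      fun m' => HasLists hd (fun w => if w ∈ adj v then v :: L w else L w) m' := by
  refine (terminates_foreach (adj v) (fun a m' => m'.reg 4 = m.arr 1 v + a.length ∧
    HasLists hd (fun w => if w ∈ a then v :: L w else L w) m')
    (fun _ => (pushLoopBody hd).maxCost) ?_ ?_ ?_).mono le_rfl fun m' h => h.1.2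
  · rintro a w b m' hab ⟨hr, hm'⟩ hf
    have e3 : m'.reg 3 = m.reg 3 := hf.1 3 (by simp [pushLoopBody])
    have e5 : m'.reg 5 = m.reg 5 := hf.1 5 (by simp [pushLoopBody])
    have ea : m'.arr 2 = m.arr 2 := hf.2 2 (by simp [pushLoopBody, h2.symm])
    have hlen : (adj v).length = a.length + (b.length + 1) := by simp [hab]
    have hwv : m'.arr 2 (m'.reg 4) = w := by
      rw [ea, hr, hg.cell v a.length (by omega)]
      simp [hab]
    have hstep := pushLoopBody_exec h4 h5 hm' (e3.trans hv) hwv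
    refine ⟨?_, terminates_exec (by simp [pushLoopBody]) le_rfl ⟨?_, ?_⟩⟩
    · show m'.reg 4 < m'.reg 5
      rw [hr, e5, hr5, hg.bound]
      omega
    · rw [hstep.2, hr]
      simp; omega
    · have hwa : w ∉ a := by
        rw [hab] at hnd
        exact fun hw => (List.nodup_append.1 hnd).2.2 w hw w (by simp) rfl
      convert hstep.1 using 1
      funext x
      by_cases hx : x = w
      · subst hx; simp [hwa]
      · simp [hx]
  · rintro m' ⟨hr, -⟩ hf
    have e5 : m'.reg 5 = m.reg 5 := hf.1 5 (by simp [pushLoopBody])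
    show ¬ m'.reg 4 < m'.reg 5
    rw [hr, e5, hr5, hg.bound]
    omega
  · exact ⟨by simp [hr4], by simpa using hL⟩

lemma sortAdjBody_terminates {m : Store} {L : Fin n → List (Fin n)}
    (h2 : hd ≠ 2) (h4 : hd ≠ 4) (h5 : hd ≠ 5) (hg : HasGraph adj m) (hL : HasLists hd L m)
    {v : Fin n} (hnd : (adj v).Nodup) (hv : m.arr src (m.reg 2) = v) :
    Terminates (sortAdjBody src hd) m (23 * (adj v).length + 20)
      fun m' => HasLists hd (fun w => if w ∈ adj v then v :: L w else L w) m' ∧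
        m'.reg 2 = m.reg 2 + 1 := by
  refine terminates_block_exec (b := 23 * (adj v).length + 7) (by simp)
    (by simp [Prog.maxCost, Expr.cost]; omega) ?_
  refine (pushLoop (v := v) h2 h4 h5 (hg.congr (by simp) (by simp) (by simp))
    (hL.congr (by simp) (by simp) (by simp) (by simp)) hnd (by simp [hv]) (by simp [hv])
    (by simp [hv])).frame.block_cons (b₂ := 4) ?_ ?_
  · have : (pushLoopBody hd).maxCost = 19 := rfl
    simp [this]
    omega
  · rintro m' ⟨hL', hf⟩
    refine terminates_exec (by simp) (by simp [Prog.maxCost, Expr.cost])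
      ⟨hL'.congr (by simp) (by simp) (by simp) (by simp), ?_⟩
    simpa using hf.1 2 (by simp [pushLoopBody])

lemma sortAdj_terminates {G : SimpleGraph (Fin n)} [DecidableRel G.Adj]
    (hadj : IsAdjacencyList G adj) {m : Store} (hsrc : src ∉ [4, 5, hd]) (h1 : hd ≠ 1)
    (h2 : hd ≠ 2) (h4 : hd ≠ 4) (h5 : hd ≠ 5) (hg : HasGraph adj m) {X : List (Fin n)}
    (hX : IsVertexOrder X) (hXm : ArrayHolds (m.arr src) X) (hhd : ∀ w : Fin n, m.arr hd w = 0)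
    (h7 : 0 < m.reg 7) :
    Terminates (sortAdj src hd) m (23 * (n + ∑ v, (adj v).length) + 5)
      fun m' => HasLists hd (fun w => X.reverse.filter (G.Adj w ·)) m' ∧
        Frame (sortAdj src hd) m m' := by
  refine Terminates.frame ?_
  simp only [List.mem_cons, List.not_mem_nil, or_false, not_or] at hsrc
  have hlenX := length_of_isVertexOrder hX
  refine terminates_block_exec (b := 23 * (n + ∑ v, (adj v).length) + 3) (by simp)
    (by simp [Prog.maxCost, Expr.cost]; omega) ?_
  refine (terminates_foreach X (fun p m' => m'.reg 2 = p.length ∧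
    HasLists hd (fun w => p.reverse.filter (G.Adj w ·)) m')
    (fun v => 23 * (adj v).length + 20) ?_ ?_ ?_).mono ?_ fun m' h => h.1.2
  · rintro p v q m' hpq ⟨hr, hL⟩ hf
    have e0 : m'.reg 0 = m.reg 0 := by
      simpa using hf.1 0 (by simp [pushLoopBody, sortAdjBody])
    have ea1 : m'.arr 1 = m.arr 1 := by
      simpa using hf.2 1 (by simp [pushLoopBody, sortAdjBody, h1.symm])
    have ea2 : m'.arr 2 = m.arr 2 := by
      simpa using hf.2 2 (by simp [pushLoopBody, sortAdjBody, h2.symm])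
    have eas : m'.arr src = m.arr src := by
      simpa using hf.2 src (by simp [pushLoopBody, sortAdjBody, hsrc])
    have hlen : X.length = p.length + (q.length + 1) := by simp [hpq]
    have hv : m'.arr src (m'.reg 2) = v := by
      rw [eas, hr, hXm p.length (by omega)]
      simp [hpq]
    refine ⟨?_, (sortAdjBody_terminates h2 h4 h5 (hg.congr e0 ea1 ea2) hL (hadj v).1
      hv).mono le_rfl fun m'' h => ⟨by simp [h.2, hr], ?_⟩⟩
    · show m'.reg 2 < m'.reg 0
      rw [hr, e0, hg.reg]
      omega
    · convert h.1 using 1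
      funext w
      simp only [(hadj v).2, List.reverse_append, List.reverse_singleton, List.singleton_append,
        List.filter_cons, decide_eq_true_eq, G.adj_comm]
  · rintro m' ⟨hr, -⟩ hf
    have e0 : m'.reg 0 = m.reg 0 := by
      simpa using hf.1 0 (by simp [pushLoopBody, sortAdjBody])
    show ¬ m'.reg 2 < m'.reg 0
    rw [hr, e0, hg.reg]
    omega
  · exact ⟨by simp, by simpa using h7, fun w => by simp [hhd, IsLinkedList]⟩
  · rw [sum_map_of_isVertexOrder hX]
    simp [Test.cost, Expr.cost, Finset.sum_add_distrib, ← Finset.mul_sum]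
    omega

end

/-! ### Doubly linked lists -/

/-- `nx` and `pv` are the successor and predecessor functions of the list `L`, closed to a cycle by
the additional element `N`. -/
def Linked (nx pv : ℕ → ℕ) (N : ℕ) (L : List ℕ) : Prop :=
  (N :: L ++ [N]).IsChain fun x y => nx x = y ∧ pv y = x

lemma isChain_congr {nx pv nx' pv' : ℕ → ℕ} {l : List ℕ}
    (h : l.IsChain fun x y => nx x = y ∧ pv y = x) (hnx : ∀ x ∈ l.dropLast, nx' x = nx x)
    (hpv : ∀ x ∈ l.tail, pv' x = pv x) : l.IsChain fun x y => nx' x = y ∧ pv' y = x := by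
  induction l with
  | nil => simp
  | cons x l ih =>
    cases l with
    | nil => simp
    | cons y l =>
      rw [List.isChain_cons_cons] at h ⊢
      simp only [List.dropLast_cons_cons, List.mem_cons, forall_eq_or_imp, List.tail_cons] at hnx hpv
      refine ⟨⟨hnx.1.trans h.1.1, hpv.1.trans h.1.2⟩, ih h.2 hnx.2 fun z hz => hpv.2 z ?_⟩
      simpa using hz

lemma Linked.next {nx pv : ℕ → ℕ} {N : ℕ} {A D : List ℕ} {x y : ℕ}
    (h : Linked nx pv N (A ++ x :: y :: D)) : nx x = y := by
  have : N :: (A ++ x :: y :: D) ++ [N] = (N :: A) ++ x :: y :: (D ++ [N]) := by simp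
  rw [Linked, this, List.isChain_append_cons_cons] at h
  exact h.2.1.1

lemma Linked.next_last {nx pv : ℕ → ℕ} {N : ℕ} {A : List ℕ} {x : ℕ}
    (h : Linked nx pv N (A ++ [x])) : nx x = N := by
  have : N :: (A ++ [x]) ++ [N] = (N :: A) ++ x :: N :: [] := by simp
  rw [Linked, this, List.isChain_append_cons_cons] at h
  exact h.2.1.1

/-- The element `w` is unlinked and inserted again to the left of `f`. -/
lemma Linked.move {nx pv : ℕ → ℕ} {N f w : ℕ} {A B D : List ℕ}
    (h : Linked nx pv N (A ++ f :: B ++ w :: D))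
    (hnd : (N :: (A ++ f :: B ++ w :: D)).Nodup) :
    Linked
      (Function.update (Function.update (Function.update nx (pv w) (nx w)) (pv f) w) w f)
      (Function.update (Function.update (Function.update pv (nx w) (pv w)) w (pv f)) f w)
      N (A ++ w :: f :: B ++ D) := by
  obtain ⟨X₀, g, hX⟩ : ∃ X₀ g, N :: A = X₀ ++ [g] :=
    ⟨_, _, (List.dropLast_append_getLast (List.cons_ne_nil N A)).symm⟩
  obtain ⟨M₀, a, hM⟩ : ∃ M₀ a, f :: B = M₀ ++ [a] :=
    ⟨_, _, (List.dropLast_append_getLast (List.cons_ne_nil f B)).symm⟩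
  obtain ⟨d, Y₁, hY⟩ : ∃ d Y₁, D ++ [N] = d :: Y₁ := by
    cases D with
    | nil => exact ⟨N, [], rfl⟩
    | cons d D => exact ⟨d, D ++ [N], rfl⟩
  have e : N :: (A ++ f :: B ++ w :: D) ++ [N] = (N :: A) ++ ((f :: B) ++ ([w] ++ (D ++ [N]))) := by
    simp
  rw [Linked, e, List.isChain_append, List.isChain_append, List.isChain_append] at h
  obtain ⟨hcX, ⟨hcM, ⟨-, hcY, hwd⟩, haw⟩, hgf⟩ := h
  have hwd := hwd w (by simp) d (by simp [hY])
  have haw := haw a (by simp [hM]) w (by simp)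
  have hgf := hgf g (by simp [hX]) f (by simp)
  rw [hwd.1, haw.2, hgf.2]
  have e' : N :: (A ++ w :: f :: B ++ D) ++ [N] = (N :: A) ++ ([w] ++ ((f :: B) ++ (D ++ [N]))) := by
    simp
  have nd1 : (N :: A).Nodup := by
    have : N :: (A ++ f :: B ++ w :: D) = (N :: A) ++ (f :: B ++ w :: D) := by simp
    rw [this] at hnd
    exact (List.nodup_append.1 hnd).1
  have ndY : (D ++ [N]).Nodup := by
    rw [List.nodup_append]
    simp only [List.nodup_cons, List.nodup_append, List.mem_cons, List.mem_append] at hnd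
    refine ⟨by tauto, by simp, ?_⟩
    rintro x hx y hy rfl
    simp only [List.mem_singleton] at hy
    subst hy
    tauto
  have ndM : (f :: B).Nodup := by
    simp only [List.nodup_cons, List.nodup_append, List.mem_cons, List.mem_append] at hnd ⊢
    tauto
  have hgmem : g ∈ N :: A := by simp [hX]
  have hamem : a ∈ f :: B := by simp [hM]
  have hdmem : d = N ∨ d ∈ D := by
    have : d ∈ D ++ [N] := by simp [hY]
    simpa [or_comm] using this
  rw [hX] at nd1
  rw [hM] at ndM
  rw [hY] at ndY
  have hgX : g ∉ X₀ := fun hc => (List.nodup_append.1 nd1).2.2 g hc g (by simp) rfl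
  have haM : a ∉ M₀ := fun hc => (List.nodup_append.1 ndM).2.2 a hc a (by simp) rfl
  have hdY : d ∉ Y₁ := (List.nodup_cons.1 ndY).1
  have hfB : f ∉ B := by
    have := hM ▸ ndM
    exact (List.nodup_cons.1 this).1
  have e'' : N :: (A ++ f :: B ++ w :: D) = (N :: A) ++ (f :: B ++ w :: D) := by simp
  rw [e''] at hnd
  have hnd' := List.nodup_append.1 hnd
  have disj1 : ∀ x ∈ N :: A, x ∉ f :: B ∧ x ≠ w ∧ x ∉ D := fun x hx =>
    ⟨fun hc => hnd'.2.2 x hx x (by simp at hc ⊢; tauto) rfl,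
      fun hc => hnd'.2.2 x hx x (by simp [hc]) rfl,
      fun hc => hnd'.2.2 x hx x (by simp [hc]) rfl⟩
  have hnd'' := List.nodup_append.1 hnd'.2.1
  have disj2 : ∀ x ∈ f :: B, x ≠ w ∧ x ∉ D := fun x hx =>
    ⟨fun hc => hnd''.2.2 x hx x (by simp [hc]) rfl,
      fun hc => hnd''.2.2 x hx x (by simp [hc]) rfl⟩
  have disj3 : w ∉ D := (List.nodup_cons.1 hnd''.2.1).1
  have hga : g ≠ a := fun hc => (disj1 g hgmem).1 (hc ▸ hamem)
  have hgw : g ≠ w := (disj1 g hgmem).2.1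
  have haw' : a ≠ w := (disj2 a hamem).1
  have hfw : f ≠ w := (disj2 f (by simp)).1
  have hNf : N ∉ f :: B := (disj1 N (by simp)).1
  have hdf : d ∉ f :: B := by
    rcases hdmem with rfl | hd
    · exact hNf
    · exact fun hc => (disj2 d hc).2 hd
  have hdw : d ≠ w := by
    rcases hdmem with rfl | hd
    · exact (disj1 d (by simp)).2.1
    · rintro rfl; exact disj3 hd
  have hdf' : d ≠ f := fun hc => hdf (by simp [hc])
  rw [Linked, e', List.isChain_append, List.isChain_append, List.isChain_append]
  refine ⟨isChain_congr hcX ?_ ?_, ⟨List.isChain_singleton _, ⟨isChain_congr hcM ?_ ?_,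
    isChain_congr hcY ?_ ?_, ?_⟩, ?_⟩, ?_⟩
  · rw [hX, List.dropLast_concat]
    intro x hx
    have hx' : x ∈ N :: A := by simp [hX, hx]
    rw [Function.update_of_ne (disj1 x hx').2.1, Function.update_of_ne (by rintro rfl; exact hgX hx),
      Function.update_of_ne (by rintro rfl; exact (disj1 _ hx').1 hamem)]
  · rw [List.tail_cons]
    intro x hx
    have hx' : x ∈ N :: A := by simp [hx]
    have hxd : x ≠ d := by
      rintro rfl
      rcases hdmem with rfl | hd
      · have := hX ▸ nd1
        exact (List.nodup_cons.1 this).1 hx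
      · exact (disj1 x hx').2.2 hd
    rw [Function.update_of_ne (by rintro rfl; exact (disj1 _ hx').1 (by simp)),
      Function.update_of_ne (disj1 x hx').2.1, Function.update_of_ne hxd]
  · rw [hM, List.dropLast_concat]
    intro x hx
    have hx' : x ∈ f :: B := by simp [hM, hx]
    rw [Function.update_of_ne (disj2 x hx').1,
      Function.update_of_ne (by rintro rfl; exact (disj1 _ hgmem).1 hx'),
      Function.update_of_ne (by rintro rfl; exact haM hx)]
  · rw [List.tail_cons]
    intro x hx
    have hx' : x ∈ f :: B := by simp [hx]
    rw [Function.update_of_ne (by rintro rfl; exact hfB hx),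
      Function.update_of_ne (disj2 x hx').1,
      Function.update_of_ne (by rintro rfl; exact hdf hx')]
  · rw [List.dropLast_concat]
    intro x hx
    rw [Function.update_of_ne (by rintro rfl; exact disj3 hx),
      Function.update_of_ne (by rintro rfl; exact (disj1 _ hgmem).2.2 hx),
      Function.update_of_ne (by rintro rfl; exact (disj2 _ hamem).2 hx)]
  · have hx' : ∀ x ∈ (D ++ [N]).tail, x = N ∨ x ∈ D := fun x hx => by
      simpa [or_comm] using List.mem_of_mem_tail hx
    intro x hx
    have hxd : x ≠ d := by
      rintro rfl
      rw [hY] at hx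
      exact hdY hx
    have hxw : x ≠ w := by
      rcases hx' x hx with rfl | h
      · exact (disj1 x (by simp)).2.1
      · rintro rfl; exact disj3 h
    have hxf : x ≠ f := by
      rcases hx' x hx with rfl | h
      · rintro rfl; exact hNf (by simp)
      · rintro rfl; exact (disj2 x (by simp)).2 h
    rw [Function.update_of_ne hxf, Function.update_of_ne hxw, Function.update_of_ne hxd]
  · intro x hx y hy
    obtain rfl : a = x := by simpa [hM] using hx
    obtain rfl : d = y := by simpa [hY] using hy
    rw [Function.update_of_ne haw', Function.update_of_ne hga.symm, Function.update_self,
      Function.update_of_ne hdf', Function.update_of_ne hdw, Function.update_self]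
    exact ⟨rfl, rfl⟩
  · intro x hx y hy
    obtain rfl : w = x := by simpa using hx
    obtain rfl : f = y := by simpa using hy
    simp
  · intro x hx y hy
    obtain rfl : g = x := by simpa [hX] using hx
    obtain rfl : w = y := by simpa using hy
    rw [Function.update_of_ne hgw, Function.update_self, Function.update_of_ne hfw.symm,
      Function.update_self]
    exact ⟨rfl, rfl⟩

/-! ### Partition refinement -/

section Partition

variable {n : ℕ} {q R : List (Fin n)} {l : List (Fin n → Prop)} {cl fi nc : ℕ → ℕ} {k base : ℕ}
  {S : Fin n → Prop}

/-- The ordered list `R` is sorted by the sets in `l` and then by `q`. The function `cl` numbers the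
classes of vertices that are not distinguished by `l`, by numbers less than `k`, and `fi` maps each
class to its first vertex. -/
structure Classes (q : List (Fin n)) (l : List (Fin n → Prop)) (R : List (Fin n))
    (cl fi nc : ℕ → ℕ) (k : ℕ) : Prop where
  sorted : R.Pairwise (Before l q)
  cl_eq : ∀ x ∈ R, ∀ y ∈ R, cl x = cl y ↔ LexEqv l x y
  cl_lt : ∀ x ∈ R, cl x < k
  first : ∀ x ∈ R, ∃ f ∈ R, fi (cl x) = (f : ℕ) ∧ cl f = cl x ∧ q.idxOf f ≤ q.idxOf x
  nc_lt : ∀ c, nc c < k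

/-- The state of a refinement in which the vertices of `S` have already been moved to new classes.
New classes have a number of at least `base`, and the number of the new class that has been split
off from an old class `c` is `nc c`; if there is no such class, then `nc c < base`. -/
structure Round (q : List (Fin n)) (l : List (Fin n → Prop)) (S : Fin n → Prop) (base : ℕ)
    (R : List (Fin n)) (cl fi nc : ℕ → ℕ) (k : ℕ) : Prop
    extends Classes q (l ++ [S]) R cl fi nc k where
  base_le : base ≤ k
  mem_iff : ∀ x ∈ R, S x ↔ base ≤ cl x
  nc_eq : ∀ x ∈ R, ¬ S x → ∀ y ∈ R, S y → (nc (cl x) = cl y ↔ LexEqv l x y)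
  exists_of_base_le : ∀ x ∈ R, ¬ S x → base ≤ nc (cl x) → ∃ y ∈ R, S y ∧ cl y = nc (cl x)

lemma lexEqv_of_between {a b c : Fin n} (hab : Before l q a b) (hbc : Before l q b c)
    (hac : LexEqv l a c) : LexEqv l a b := by
  rcases hab with hab | ⟨hab, -⟩
  · rcases hbc with hbc | ⟨hbc, -⟩
    · exact absurd hac (hab.trans hbc).not_lexEqv
    · exact absurd hac (hab.trans_eqv hbc).not_lexEqv
  · exact hab

lemma idxOf_lt_of_before {a b : Fin n} (hab : Before l q a b) (h : LexEqv l a b) :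
    q.idxOf a < q.idxOf b := by
  rcases hab with hab | ⟨-, hab⟩
  · exact absurd h hab.not_lexEqv
  · exact hab

/-- The vertex that follows `w` in a sorted list is the next one in the class of `w`, if there is
any. -/
lemma next_of_sorted {A D : List (Fin n)} {w y x : Fin n}
    (hs : (A ++ w :: y :: D).Pairwise (Before l q)) (hx : x ∈ y :: D) (hwx : LexEqv l w x) :
    LexEqv l w y ∧ q.idxOf y ≤ q.idxOf x := by
  have hs' := (List.pairwise_append.1 hs).2.1
  rw [List.pairwise_cons, List.pairwise_cons] at hs'
  rcases List.mem_cons.1 hx with rfl | hxD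
  · exact ⟨hwx, le_rfl⟩
  · have hyx := hs'.2.1 x hxD
    have hwy := lexEqv_of_between (hs'.1 y (by simp)) hyx hwx
    exact ⟨hwy, (idxOf_lt_of_before hyx (hwy.symm.trans hwx)).le⟩

lemma mem_of_sorted {A D : List (Fin n)} {w x : Fin n}
    (hs : (A ++ w :: D).Pairwise (Before l q)) (hx : x ∈ A ++ w :: D) (hxw : x ≠ w)
    (hwx : LexEqv l w x) (hle : q.idxOf w ≤ q.idxOf x) : x ∈ D := by
  simp only [List.mem_append, List.mem_cons, hxw, false_or] at hx
  rcases hx with hx | hx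
  · have := idxOf_lt_of_before ((List.pairwise_append.1 hs).2.2 x hx w (by simp)) hwx.symm
    omega
  · exact hx

/-- The first vertex of the list is removed. -/
lemma Classes.tail {h : Fin n} (hC : Classes q l (h :: R) cl fi nc k) {y : ℕ}
    (hy : ∀ x D, R = x :: D → y = x) :
    Classes q l R cl (Function.update fi (cl h) y) nc k where
  sorted := (List.pairwise_cons.1 hC.sorted).2
  cl_eq x hx z hz := hC.cl_eq x (by simp [hx]) z (by simp [hz])
  cl_lt x hx := hC.cl_lt x (by simp [hx])
  nc_lt := hC.nc_lt
  first x hx := by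
    by_cases hc : cl x = cl h
    · cases R with
      | nil => simp at hx
      | cons z D =>
        obtain rfl := hy z D rfl
        have := next_of_sorted (A := []) hC.sorted hx
          ((hC.cl_eq h (by simp) x (by simp [hx])).1 hc.symm)
        refine ⟨z, by simp, by rw [hc, Function.update_self], ?_, this.2⟩
        rw [hc]
        exact ((hC.cl_eq h (by simp) z (by simp)).2 this.1).symm
    · obtain ⟨f, hf, h1, h2, h3⟩ := hC.first x (by simp [hx])
      refine ⟨f, ?_, by rwa [Function.update_of_ne hc], h2, h3⟩
      rcases List.mem_cons.1 hf with rfl | hf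
      · exact absurd h2.symm hc
      · exact hf

lemma lexPrec_concat_false {a b : Fin n} :
    LexPrec (l ++ [fun _ => False]) a b ↔ LexPrec l a b := by simp [lexPrec_concat]

lemma lexEqv_concat_false {a b : Fin n} :
    LexEqv (l ++ [fun _ => False]) a b ↔ LexEqv l a b := by simp [lexEqv_concat]

lemma Classes.round (hC : Classes q l R cl fi nc k) :
    Round q l (fun _ => False) k R cl fi nc k where
  sorted := hC.sorted.imp fun h => by
    rwa [Before, lexPrec_concat_false, lexEqv_concat_false]
  cl_eq x hx y hy := by rw [lexEqv_concat_false]; exact hC.cl_eq x hx y hy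
  cl_lt := hC.cl_lt
  first := hC.first
  nc_lt := hC.nc_lt
  base_le := le_rfl
  mem_iff x hx := by
    have := hC.cl_lt x hx
    simp only [false_iff]
    omega
  nc_eq := by simp
  exists_of_base_le x hx _ h := by
    have := hC.nc_lt (cl x)
    omega

lemma lexEqv_concat_congr {S' : Fin n → Prop} {a b : Fin n} (ha : S a ↔ S' a) (hb : S b ↔ S' b) :
    LexEqv (l ++ [S]) a b ↔ LexEqv (l ++ [S']) a b := by
  rw [lexEqv_concat, lexEqv_concat, ha, hb]

lemma before_concat_congr {S' : Fin n → Prop} {a b : Fin n} (ha : S a ↔ S' a) (hb : S b ↔ S' b) :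
    Before (l ++ [S]) q a b ↔ Before (l ++ [S']) q a b := by
  rw [Before, Before, lexEqv_concat_congr ha hb, lexPrec_concat, lexPrec_concat, ha, hb]

lemma Classes.congr_set {S' : Fin n → Prop} (hC : Classes q (l ++ [S]) R cl fi nc k)
    (h : ∀ x ∈ R, (S x ↔ S' x)) : Classes q (l ++ [S']) R cl fi nc k where
  sorted := hC.sorted.imp_of_mem fun ha hb => (before_concat_congr (h _ ha) (h _ hb)).1
  cl_eq x hx y hy := by
    rw [← lexEqv_concat_congr (h _ hx) (h _ hy)]; exact hC.cl_eq x hx y hy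
  cl_lt := hC.cl_lt
  first := hC.first
  nc_lt := hC.nc_lt

/-- The vertices of a class form a segment of the list that starts with the first vertex `f` of the
class. Moving `w` to the left of `f` yields the order for the larger set. -/
lemma sorted_move {A B D : List (Fin n)} {f w : Fin n}
    (hs : (A ++ f :: B ++ w :: D).Pairwise (Before (l ++ [S]) q))
    (hfw : LexEqv (l ++ [S]) f w) (hSw : ¬ S w)
    (hA : ∀ x ∈ A, S x → q.idxOf x < q.idxOf w)
    (hf : ∀ x ∈ A, ¬ LexEqv (l ++ [S]) x f) (hnd : (A ++ f :: B ++ w :: D).Nodup) :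
    (A ++ w :: f :: B ++ D).Pairwise (Before (l ++ [fun x => S x ∨ x = w]) q) := by
  have hne : ∀ x ∈ A ++ f :: B ++ D, x ≠ w := by
    rintro x hx rfl
    rw [List.nodup_append, List.nodup_cons] at hnd
    simp only [List.append_assoc, List.mem_append] at hx hnd
    rcases hx with hx | hx | hx
    · exact hnd.2.2 x (.inl hx) x (by simp) rfl
    · exact hnd.2.2 x (.inr hx) x (by simp) rfl
    · exact hnd.2.1.1 hx
  have hrest : (A ++ f :: B ++ D).Pairwise (Before (l ++ [fun x => S x ∨ x = w]) q) := by
    refine (hs.sublist ?_).imp_of_mem fun {a b} ha hb h => ?_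
    · exact List.Sublist.append_left (List.sublist_cons_self w D) _
    · exact (before_concat_congr (by simp [hne _ ha]) (by simp [hne _ hb])).1 h
  rw [List.append_assoc, List.pairwise_append] at hrest hs
  have hs2 := List.pairwise_append.1 hs.2.1
  have hw1 : ∀ x ∈ A, Before (l ++ [fun x => S x ∨ x = w]) q x w := by
    intro x hx
    have hxw : Before (l ++ [S]) q x w := hs.2.2 x hx w (by simp)
    have hxf : ¬ LexEqv (l ++ [S]) x w := fun h => hf x hx (h.trans hfw.symm)
    rcases hxw with hxw | hxw
    · rcases (lexPrec_concat _ _ _ _).1 hxw with h | ⟨h, hS, -⟩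
      · exact .inl ((lexPrec_concat _ _ _ _).2 (.inl h))
      · exact .inr ⟨(lexEqv_concat _ _ _ _).2 ⟨h, by simp [hS]⟩, hA x hx hS⟩
    · exact absurd hxw.1 hxf
  have hw2 : ∀ y ∈ f :: B, Before (l ++ [fun x => S x ∨ x = w]) q w y := by
    intro y hy
    have hyw : LexEqv (l ++ [S]) y w := by
      rcases List.mem_cons.1 hy with rfl | hyB
      · exact hfw
      · have h1 := (List.pairwise_cons.1 hs2.1).1 y hyB
        exact (lexEqv_of_between h1 (hs2.2.2 y hy w (by simp)) hfw).symm.trans hfw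
    rw [lexEqv_concat] at hyw
    refine .inl ((lexPrec_concat _ _ _ _).2 (.inr ⟨hyw.1.symm, by simp, ?_⟩))
    have := hne y (by simp only [List.mem_append]; tauto)
    tauto
  have hw3 : ∀ y ∈ D, Before (l ++ [fun x => S x ∨ x = w]) q w y := by
    intro y hy
    have hyw := (List.pairwise_cons.1 hs2.2.1).1 y hy
    have hne := hne y (by simp [hy])
    rcases hyw with h | ⟨h, -⟩
    · rcases (lexPrec_concat _ _ _ _).1 h with h | ⟨h, h', -⟩
      · exact .inl ((lexPrec_concat _ _ _ _).2 (.inl h))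
      · exact absurd h' hSw
    · rw [lexEqv_concat] at h
      refine .inl ((lexPrec_concat _ _ _ _).2 (.inr ⟨h.1, by simp, ?_⟩))
      tauto
  rw [List.append_assoc, List.cons_append, List.pairwise_append, List.pairwise_cons]
  refine ⟨hrest.1, ⟨fun y hy => ?_, hrest.2.1⟩, fun x hx y hy => ?_⟩
  · rcases List.mem_append.1 hy with hy | hy
    · exact hw2 y hy
    · exact hw3 y hy
  · rcases List.mem_cons.1 hy with rfl | hy
    · exact hw1 x hx
    · exact hrest.2.2 x hx y hy

/-- The list `R'` is obtained from `R` when `w` is moved to the left of `f`, the first vertex of its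
class. If `w` itself is this vertex, then it stays in its place, and `y` is its successor, if there is
one. -/
def MovedTo (R : List (Fin n)) (f w : Fin n) (y : ℕ) (R' : List (Fin n)) : Prop :=
  (f = w ∧ R' = R ∧ ∀ A x D, R = A ++ w :: x :: D → y = x) ∨
    (f ≠ w ∧ ∃ A B D, R = A ++ f :: B ++ w :: D ∧ R' = A ++ w :: f :: B ++ D)

lemma exists_split_of_first (hC : Classes q l R cl fi nc k) {f w : Fin n} (hf : f ∈ R) (hw : w ∈ R)
    (hcl : cl f = cl w) (hle : q.idxOf f ≤ q.idxOf w) (hfw : f ≠ w) :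
    ∃ A B D, R = A ++ f :: B ++ w :: D := by
  obtain ⟨A, D, rfl⟩ := List.append_of_mem hf
  have := mem_of_sorted hC.sorted hw hfw.symm ((hC.cl_eq f hf w hw).1 hcl) hle
  obtain ⟨B, D', rfl⟩ := List.append_of_mem this
  exact ⟨A, B, D', by simp⟩

/-- The vertex `w`, whose class has the number `cl w`, is moved to the new class that is split off
from its class. -/
lemma Round.step (hR : Round q l S base R cl fi nc k) {w f : Fin n}
    (hw : w ∈ R) (hSw : ¬ S w) (hlt : ∀ x ∈ R, S x → q.idxOf x < q.idxOf w) {nc' fi' : ℕ → ℕ}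
    {k' : ℕ}
    (hnew : if nc (cl w) < base then
        nc' = Function.update nc (cl w) k ∧ fi' = Function.update fi k w ∧ k' = k + 1
      else nc' = nc ∧ fi' = fi ∧ k' = k)
    (hf : fi (cl w) = f) {y : ℕ} {R' : List (Fin n)} (hmv : MovedTo R f w y R') :
    Round q l (fun x => S x ∨ x = w) base R' (Function.update cl w (nc' (cl w)))
      (if f = w then Function.update fi' (cl w) y else fi') nc' k' := by
  have hnd : R.Nodup := hR.sorted.imp fun h => by rintro rfl; exact h.asymm h
  have hcw : cl w < base := by
    have := mt (hR.mem_iff w hw).2 hSw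
    omega
  obtain ⟨f₀, hfR, hf1, hf2, hf3⟩ := hR.first w hw
  obtain rfl : f₀ = f := Fin.ext (hf1.symm.trans hf)
  have hperm : ∀ x, x ∈ R' ↔ x ∈ R := by
    intro x
    rcases hmv with ⟨-, rfl, -⟩ | ⟨-, A, B, D, rfl, rfl⟩
    · rfl
    · simp only [List.mem_append, List.mem_cons]; tauto
  have hbase := hR.base_le
  have hkk : k ≤ k' := by split_ifs at hnew <;> omega
  -- the number of the new class
  have hv1 : base ≤ nc' (cl w) ∧ nc' (cl w) < k' := by
    split_ifs at hnew with hif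
    · rw [hnew.1, Function.update_self]; omega
    · have := hR.nc_lt (cl w)
      rw [hnew.1]; omega
  -- the vertices that have been moved to the new class before
  have hv2 : ∀ x ∈ R, x ≠ w → (cl x = nc' (cl w) ↔ S x ∧ LexEqv l x w) := by
    intro x hx hxw
    split_ifs at hnew with hif
    · rw [hnew.1, Function.update_self]
      have h1 := hR.cl_lt x hx
      refine ⟨fun h => by omega, fun h => ?_⟩
      have h2 := (hR.nc_eq w hw hSw x hx h.1).2 h.2.symm
      have h3 := (hR.mem_iff x hx).1 h.1
      omega
    · rw [hnew.1]
      constructor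
      · intro h
        have h1 : S x := (hR.mem_iff x hx).2 (by omega)
        exact ⟨h1, ((hR.nc_eq w hw hSw x hx h1).1 h.symm).symm⟩
      · intro h
        exact ((hR.nc_eq w hw hSw x hx h.1).2 h.2.symm).symm
  have hnc : ∀ c, c ≠ cl w → nc' c = nc c := by
    intro c hc
    split_ifs at hnew
    · rw [hnew.1, Function.update_of_ne hc]
    · rw [hnew.1]
  have hfi : ∀ c < k, fi' c = fi c := by
    intro c hc
    split_ifs at hnew
    · rw [hnew.2.1, Function.update_of_ne (by omega)]
    · rw [hnew.2.1]
  have hclx : ∀ x, x ≠ w → Function.update cl w (nc' (cl w)) x = cl x := fun x hx =>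
    Function.update_of_ne (fun h => hx (Fin.ext h)) _ _
  have hclw : Function.update cl w (nc' (cl w)) w = nc' (cl w) := Function.update_self _ _ _
  have hSx : ∀ x, x ≠ w → ((S x ∨ x = w) ↔ S x) := fun x hx => by simp [hx]
  have hold : ∀ x ∈ R, cl x = cl w → ¬ S x := fun x hx h hS => by
    have := (hR.mem_iff x hx).1 hS
    omega
  have hsame : ∀ x ∈ R, ¬ S x → (cl x = cl w ↔ LexEqv l x w) := by
    intro x hx hS
    rw [hR.cl_eq x hx w hw, lexEqv_concat]
    simp [hS, hSw]
  refine ⟨⟨?_, ?_, ?_, ?_, ?_⟩, by omega, ?_, ?_, ?_⟩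
  · rcases hmv with ⟨rfl, rfl, -⟩ | ⟨hfw, A, B, D, rfl, rfl⟩
    · obtain ⟨A, D, hAD⟩ := List.append_of_mem hw
      have hs := hR.sorted
      have hnw : ∀ x ∈ A, x ≠ f₀ := by
        rintro x hx rfl
        rw [hAD] at hnd
        exact (List.nodup_append.1 hnd).2.2 x hx x (by simp) rfl
      have hnw' : ∀ x ∈ D, x ≠ f₀ := by
        rintro x hx rfl
        rw [hAD] at hnd
        exact (List.nodup_cons.1 (List.nodup_append.1 hnd).2.1).1 hx
      -- the first vertex of a class stays where it is
      rw [hAD, List.pairwise_append, List.pairwise_cons] at hs ⊢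
      refine ⟨hs.1.imp_of_mem fun ha hb h => (before_concat_congr
          (by simp [hnw _ ha]) (by simp [hnw _ hb])).1 h, ⟨fun z hz => ?_,
        hs.2.1.2.imp_of_mem fun ha hb h => (before_concat_congr
          (by simp [hnw' _ ha]) (by simp [hnw' _ hb])).1 h⟩, fun x hx z hz => ?_⟩
      · rcases hs.2.1.1 z hz with h | ⟨h, -⟩
        · rcases (lexPrec_concat _ _ _ _).1 h with h | ⟨h, h', -⟩
          · exact .inl ((lexPrec_concat _ _ _ _).2 (.inl h))
          · exact absurd h' hSw
        · rw [lexEqv_concat] at h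
          refine .inl ((lexPrec_concat _ _ _ _).2 (.inr ⟨h.1, by simp, ?_⟩))
          have := hnw' z hz
          tauto
      · rcases List.mem_cons.1 hz with rfl | hz'
        · rcases hs.2.2 x hx z (by simp) with h | ⟨h, h'⟩
          · rcases (lexPrec_concat _ _ _ _).1 h with h | ⟨h, hS, -⟩
            · exact .inl ((lexPrec_concat _ _ _ _).2 (.inl h))
            · exact .inr ⟨(lexEqv_concat _ _ _ _).2 ⟨h, by simp [hS]⟩,
                hlt x (by simp [hAD, hx]) hS⟩
          · have hxR : x ∈ R' := by simp [hAD, hx]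
            obtain ⟨g, hg, hg1, -, hg3⟩ := hR.first x hxR
            rw [(hR.cl_eq x hxR z hw).2 h, hf1] at hg1
            obtain rfl := Fin.ext hg1
            omega
        · exact (before_concat_congr (by simp [hnw _ hx]) (by simp [hnw' _ hz'])).1
            (hs.2.2 x hx z (by simp [hz']))
    · refine sorted_move hR.sorted ((hR.cl_eq _ hfR _ hw).1 hf2) hSw
        (fun x hx => hlt x (by simp [hx])) ?_ hnd
      intro x hx h
      have hxR : x ∈ A ++ f₀ :: B ++ w :: D := by simp [hx]
      have hbef : Before (l ++ [S]) q x f₀ := by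
        have := hR.sorted
        rw [List.append_assoc, List.pairwise_append] at this
        exact this.2.2 x hx f₀ (by simp)
      have h1 := idxOf_lt_of_before hbef h
      obtain ⟨g, hg, hg1, -, hg3⟩ := hR.first x hxR
      rw [(hR.cl_eq x hxR _ hfR).2 h, hf2, hf1] at hg1
      obtain rfl := Fin.ext hg1
      omega
  · intro x hx z hz
    rw [hperm] at hx hz
    by_cases hxw : x = w <;> by_cases hzw : z = w
    · rw [hxw, hzw]; simp [LexEqv.refl]
    · subst hxw
      rw [hclx z hzw, hclw, eq_comm, hv2 z hz hzw, lexEqv_concat]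
      simp only [hzw, or_false, or_true, true_iff]
      exact ⟨fun h => ⟨h.2.symm, h.1⟩, fun h => ⟨h.2, h.1.symm⟩⟩
    · subst hzw
      rw [hclx x hxw, hclw, hv2 x hx hxw, lexEqv_concat]
      simp only [hxw, or_false, or_true, iff_true]
      exact and_comm
    · rw [hclx x hxw, hclx z hzw, hR.cl_eq x hx z hz]
      exact lexEqv_concat_congr (hSx x hxw).symm (hSx z hzw).symm
  · intro x hx
    rw [hperm] at hx
    by_cases hxw : x = w
    · rw [hxw, hclw]; exact hv1.2
    · rw [hclx x hxw]
      exact (hR.cl_lt x hx).trans_le hkk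
  · intro x hx
    rw [hperm] at hx
    by_cases hxw : x = w
    · subst hxw
      rw [hclw]
      have hne : nc' (cl x) ≠ cl x := by omega
      have hfi2 : (if f₀ = x then Function.update fi' (cl x) y else fi') (nc' (cl x)) =
          fi' (nc' (cl x)) := by
        split_ifs
        · rw [Function.update_of_ne hne]
        · rfl
      rw [hfi2]
      by_cases hif : nc (cl x) < base
      · rw [if_pos hif] at hnew
        refine ⟨x, (hperm x).2 hw, ?_, hclw, le_rfl⟩
        rw [hnew.1, hnew.2.1, Function.update_self, Function.update_self]
      · -- the new class already has a first vertex, which precedes `x` in `q`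
        obtain ⟨z, hz, hzS, hzc⟩ := hR.exists_of_base_le x hw hSw (by omega)
        rw [if_neg hif] at hnew
        obtain ⟨g, hg, hg1, hg2, hg3⟩ := hR.first z hz
        have hgx : g ≠ x := by
          rintro rfl
          exact hold z hz hg2.symm hzS
        have := hlt z hz hzS
        refine ⟨g, (hperm g).2 hg, ?_, ?_, by omega⟩
        · rw [hnew.1, hnew.2.1, ← hzc, hg1]
        · rw [hclx g hgx, hg2, hzc, hnew.1]
    · rw [hclx x hxw]
      by_cases hc : cl x = cl w
      · by_cases hfw : f₀ = w
        · rw [if_pos hfw, hc, Function.update_self]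
          rcases hmv with ⟨-, -, hnext⟩ | ⟨hfw', -⟩
          · obtain ⟨A, D, hAD⟩ := List.append_of_mem hw
            have hwx := (hR.cl_eq w hw x hx).1 hc.symm
            obtain ⟨g, hg, hg1, -, hg3⟩ := hR.first x hx
            rw [hc, hf1] at hg1
            obtain rfl := Fin.ext hg1
            rw [hfw] at hg3
            have hxD : x ∈ D :=
              mem_of_sorted (hAD ▸ hR.sorted) (hAD ▸ hx) hxw hwx hg3
            cases D with
            | nil => simp at hxD
            | cons z D =>
              have hzR : z ∈ R := by simp [hAD]
              have hzw : z ≠ w := by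
                rintro rfl
                rw [hAD] at hnd
                exact (List.nodup_cons.1 (List.nodup_append.1 hnd).2.1).1 (by simp)
              have := next_of_sorted (hAD ▸ hR.sorted) hxD hwx
              refine ⟨z, (hperm z).2 hzR, hnext A z D hAD, ?_, this.2⟩
              rw [hclx z hzw]
              exact ((hR.cl_eq w hw z hzR).2 this.1).symm
          · exact absurd hfw hfw'
        · rw [if_neg hfw, hc, hfi _ (hR.cl_lt w hw)]
          obtain ⟨g, hg, hg1, hg2, hg3⟩ := hR.first x hx
          rw [hc, hf1] at hg1
          obtain rfl := Fin.ext hg1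
          exact ⟨f₀, (hperm f₀).2 hfR, hf1, by rw [hclx f₀ hfw, hf2], hg3⟩
      · have hfi2 : (if f₀ = w then Function.update fi' (cl w) y else fi') (cl x) = fi (cl x) := by
          split_ifs
          · rw [Function.update_of_ne hc, hfi _ (hR.cl_lt x hx)]
          · exact hfi _ (hR.cl_lt x hx)
        obtain ⟨g, hg, hg1, hg2, hg3⟩ := hR.first x hx
        have hgw : g ≠ w := by rintro rfl; exact hc hg2.symm
        exact ⟨g, (hperm g).2 hg, hfi2.trans hg1, by rw [hclx g hgw, hg2], hg3⟩
  · intro c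
    split_ifs at hnew
    · rw [hnew.1]
      by_cases hc : c = cl w
      · rw [hc, Function.update_self]; omega
      · rw [Function.update_of_ne hc]
        have := hR.nc_lt c
        omega
    · rw [hnew.1, hnew.2.2]; exact hR.nc_lt c
  · intro x hx
    rw [hperm] at hx
    by_cases hxw : x = w
    · subst hxw; rw [hclw]; simp [hv1.1]
    · rw [hclx x hxw, hSx x hxw]; exact hR.mem_iff x hx
  · intro x hx hxS z hz hzS
    rw [hperm] at hx hz
    push Not at hxS
    rw [hclx x hxS.2]
    by_cases hzw : z = w
    · subst hzw
      rw [hclw, ← hsame x hx hxS.1]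
      refine ⟨fun h => ?_, fun h => by rw [h]⟩
      by_contra hc
      rw [hnc _ hc] at h
      split_ifs at hnew with hif
      · have := hR.nc_lt (cl x)
        rw [h, hnew.1, Function.update_self] at this
        omega
      · obtain ⟨u, hu, huS, huc⟩ := hR.exists_of_base_le x hx hxS.1 (by omega)
        have h1 := (hR.nc_eq x hx hxS.1 u hu huS).1 huc.symm
        have h2 := (hR.nc_eq z hw hSw u hu huS).1 (by rw [huc, h, hnew.1])
        exact hc ((hsame x hx hxS.1).2 (h1.trans h2.symm))
    · rw [hSx z hzw] at hzS
      rw [hclx z hzw, ← hR.nc_eq x hx hxS.1 z hz hzS]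
      by_cases hc : cl x = cl w
      · rw [hc]
        have h1 := hv2 z hz hzw
        have h2 := hR.nc_eq w hw hSw z hz hzS
        rw [eq_comm, h1, h2]
        exact ⟨fun h => h.2.symm, fun h => ⟨hzS, h.symm⟩⟩
      · rw [hnc _ hc]
  · intro x hx hxS hb
    rw [hperm] at hx
    push Not at hxS
    rw [hclx x hxS.2] at hb ⊢
    by_cases hc : cl x = cl w
    · exact ⟨w, (hperm w).2 hw, .inr rfl, by rw [hclw, hc]⟩
    · rw [hnc _ hc] at hb ⊢
      obtain ⟨u, hu, huS, huc⟩ := hR.exists_of_base_le x hx hxS.1 hb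
      have huw : u ≠ w := by rintro rfl; exact hSw huS
      exact ⟨u, (hperm u).2 hu, .inl huS, by rw [hclx u huw, huc]⟩

end Partition

/-! ### The refinement program -/

/-- If the class in register 10 has not been split yet, a new class is split off, whose first vertex
is the one in register 6. -/
def newClass : Prog :=
  .ite (.lt (.get 12 (.reg 10)) (.reg 9))
    (block [
      .put 12 (.reg 10) (.reg 8),
      .put 11 (.reg 8) (.reg 6),
      .set 8 (.succ (.reg 8))])
    .skip

/-- The vertex in register 6 is moved to the left of the first vertex of the class in register 10.
If it is this first vertex, the class loses its first vertex instead. -/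
def moveVertex : Prog := .seq
  (.set 11 (.get 11 (.reg 10)))
  (.ite (.eq (.reg 11) (.reg 6))
    (.put 11 (.reg 10) (.get 8 (.reg 6)))
    (block [
      .set 12 (.get 9 (.reg 6)),
      .set 13 (.get 8 (.reg 6)),
      .put 8 (.reg 12) (.reg 13),
      .put 9 (.reg 13) (.reg 12),
      .set 14 (.get 9 (.reg 11)),
      .put 8 (.reg 14) (.reg 6),
      .put 9 (.reg 6) (.reg 14),
      .put 8 (.reg 6) (.reg 11),
      .put 9 (.reg 11) (.reg 6)]))

/-- The vertex in register 6 is dealt with if its mark in array 13 is 0. The vertex in register 3,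
plus one, is recorded for it in the array `pa`. -/
def refineStep (pa : ℕ) : Prog :=
  .ite (.eq (.get 13 (.reg 6)) (.const 0))
    (block [
      .put pa (.reg 6) (.succ (.reg 3)),
      .set 10 (.get 10 (.reg 6)),
      newClass,
      .put 10 (.reg 6) (.get 12 (.reg 10)),
      moveVertex])
    .skip

/-- The next neighbour in the linked adjacency list is dealt with. -/
def refineBody (pa : ℕ) : Prog := block [
  .set 6 (.get 4 (.reg 4)),
  refineStep pa,
  .set 4 (.get 5 (.reg 4))]

/-- The partition is refined with the neighbours of the vertex in register 3 whose mark is 0. -/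
def refineBy (pa : ℕ) : Prog := block [
  block [
    .set 9 (.reg 8),
    .set 4 (.get 6 (.reg 3))],
  .while (.lt (.const 0) (.reg 4)) (refineBody pa)]

section

variable {n : ℕ} {q p R : List (Fin n)} {l : List (Fin n → Prop)} {S : Fin n → Prop} {base : ℕ}

/-- The vertices are kept in a doubly linked list `p ++ R`, and `R` is partitioned into classes. -/
structure HasPartition (q : List (Fin n)) (l : List (Fin n → Prop)) (p R : List (Fin n))
    (m : Store) : Prop where
  linked : Linked (m.arr 8) (m.arr 9) n ((p ++ R).map Fin.val)
  nodup : (p ++ R).Nodup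
  classes : Classes q l R (m.arr 10) (m.arr 11) (m.arr 12) (m.reg 8)

/-- The state in the course of a refinement. -/
structure InRound (q : List (Fin n)) (l : List (Fin n → Prop)) (S : Fin n → Prop)
    (p R : List (Fin n)) (m : Store) : Prop where
  linked : Linked (m.arr 8) (m.arr 9) n ((p ++ R).map Fin.val)
  nodup : (p ++ R).Nodup
  round : Round q l S (m.reg 9) R (m.arr 10) (m.arr 11) (m.arr 12) (m.reg 8)

lemma InRound.congr {m m' : Store} (h : InRound q l S p R m) (h8 : m'.arr 8 = m.arr 8)
    (h9 : m'.arr 9 = m.arr 9) (h10 : m'.arr 10 = m.arr 10) (h11 : m'.arr 11 = m.arr 11)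
    (h12 : m'.arr 12 = m.arr 12) (r8 : m'.reg 8 = m.reg 8) (r9 : m'.reg 9 = m.reg 9) :
    InRound q l S p R m' := by
  refine ⟨?_, h.nodup, ?_⟩
  · rw [h8, h9]; exact h.linked
  · rw [h10, h11, h12, r8, r9]; exact h.round

lemma HasPartition.congr {m m' : Store} (h : HasPartition q l p R m) (h8 : m'.arr 8 = m.arr 8)
    (h9 : m'.arr 9 = m.arr 9) (h10 : m'.arr 10 = m.arr 10) (h11 : m'.arr 11 = m.arr 11)
    (h12 : m'.arr 12 = m.arr 12) (r8 : m'.reg 8 = m.reg 8) :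
    HasPartition q l p R m' := by
  refine ⟨?_, h.nodup, ?_⟩
  · rw [h8, h9]; exact h.linked
  · rw [h10, h11, h12, r8]; exact h.classes

lemma refineStep_exec {pa : ℕ} (hpa : pa ∉ [8, 9, 10, 11, 12, 13]) {m : Store}
    (h : InRound q l S p R m) {w : Fin n} (hw : w ∈ R) (hSw : ¬ S w)
    (hlt : ∀ x ∈ R, S x → q.idxOf x < q.idxOf w) (hr : m.reg 6 = w) (hm : m.arr 13 w = 0) :
    (∃ R', R'.Perm R ∧ InRound q l (fun x => S x ∨ x = w) p R' ((refineStep pa).exec m)) ∧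
      ((refineStep pa).exec m).arr pa = Function.update (m.arr pa) w (m.reg 3 + 1) := by
  simp only [List.mem_cons, List.not_mem_nil, or_false, not_or] at hpa
  have hpa' : ¬ 8 = pa ∧ ¬ 9 = pa ∧ ¬ 10 = pa ∧ ¬ 11 = pa ∧ ¬ 12 = pa := by omega
  have hcw : m.arr 10 w < m.reg 9 := by
    have := mt (h.round.mem_iff w hw).2 hSw
    omega
  have hck : m.arr 10 w ≠ m.reg 8 := by
    have := h.round.base_le
    omega
  obtain ⟨f, hfR, hf, hcl, hle⟩ := h.round.first w hw
  have hfw' : (f : ℕ) = w ↔ f = w := Fin.val_inj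
  have hnd : (n :: (p ++ R).map Fin.val).Nodup := by
    refine List.nodup_cons.2 ⟨?_, h.nodup.map Fin.val_injective⟩
    simp only [List.mem_map, not_exists, not_and]
    intro x _ hx
    have := x.2
    omega
  -- the successor of `w` is not `f`, which is to the left of `w`
  have hnext : f ≠ w → m.arr 8 w ≠ f := by
    intro hfw
    obtain ⟨A, B, D, hR⟩ := exists_split_of_first h.round.toClasses hfR hw hcl hle hfw
    have hlink := h.linked
    cases D with
    | nil =>
      rw [hR, ← List.append_assoc, List.map_append, List.map_singleton] at hlink
      rw [hlink.next_last]
      exact f.2.ne'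
    | cons d D =>
      rw [hR, ← List.append_assoc, List.map_append, List.map_cons, List.map_cons] at hlink
      rw [hlink.next]
      intro hdf
      obtain rfl := Fin.ext hdf
      have hnR := (List.nodup_append.1 h.nodup).2.1
      rw [hR, List.nodup_append] at hnR
      exact hnR.2.2 d (by simp) d (by simp) rfl
  obtain ⟨nc', fi', k', hnew, e10, e11, e12, r8, r9, epa, elink⟩ : ∃ nc' fi' k',
      (if m.arr 12 (m.arr 10 w) < m.reg 9 then
        nc' = Function.update (m.arr 12) (m.arr 10 w) (m.reg 8) ∧
          fi' = Function.update (m.arr 11) (m.reg 8) w ∧ k' = m.reg 8 + 1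
      else nc' = m.arr 12 ∧ fi' = m.arr 11 ∧ k' = m.reg 8) ∧
      ((refineStep pa).exec m).arr 10 = Function.update (m.arr 10) w (nc' (m.arr 10 w)) ∧
      ((refineStep pa).exec m).arr 11 =
        (if f = w then Function.update fi' (m.arr 10 w) (m.arr 8 w) else fi') ∧
      ((refineStep pa).exec m).arr 12 = nc' ∧
      ((refineStep pa).exec m).reg 8 = k' ∧
      ((refineStep pa).exec m).reg 9 = m.reg 9 ∧
      ((refineStep pa).exec m).arr pa = Function.update (m.arr pa) w (m.reg 3 + 1) ∧
      if f = w then ((refineStep pa).exec m).arr 8 = m.arr 8 ∧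
        ((refineStep pa).exec m).arr 9 = m.arr 9
      else ((refineStep pa).exec m).arr 8 = Function.update (Function.update (Function.update
          (m.arr 8) (m.arr 9 w) (m.arr 8 w)) (m.arr 9 f) w) w f ∧
        ((refineStep pa).exec m).arr 9 = Function.update (Function.update (Function.update
          (m.arr 9) (m.arr 8 w) (m.arr 9 w)) w (m.arr 9 f)) f w := by
    by_cases hif : m.arr 12 (m.arr 10 w) < m.reg 9
    · refine ⟨Function.update (m.arr 12) (m.arr 10 w) (m.reg 8),
        Function.update (m.arr 11) (m.reg 8) w, m.reg 8 + 1, by simp [hif], ?_⟩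
      by_cases hfw : f = w
      · simp [refineStep, newClass, moveVertex, hr, hm, hif, hf, hfw, hck, hpa, hpa']
      · simp [refineStep, newClass, moveVertex, hr, hm, hif, hf, hfw, hfw', hck, (hnext hfw).symm,
          hpa, hpa']
    · refine ⟨m.arr 12, m.arr 11, m.reg 8, by simp [hif], ?_⟩
      by_cases hfw : f = w
      · simp [refineStep, newClass, moveVertex, hr, hm, hif, hf, hfw, hpa, hpa']
      · simp [refineStep, newClass, moveVertex, hr, hm, hif, hf, hfw, hfw', (hnext hfw).symm,
          hpa, hpa']
  refine ⟨?_, epa⟩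
  by_cases hfw : f = w
  · rw [if_pos hfw] at elink
    have hmv : MovedTo R f w (m.arr 8 w) R := by
      refine .inl ⟨hfw, rfl, fun A x D hR => ?_⟩
      have := h.linked
      rw [hR, ← List.append_assoc, List.map_append, List.map_cons, List.map_cons] at this
      exact this.next
    refine ⟨R, .refl _, ?_, h.nodup, ?_⟩
    · rw [elink.1, elink.2]; exact h.linked
    · rw [e10, e11, e12, r8, r9]
      exact h.round.step hw hSw hlt hnew hf hmv
  · rw [if_neg hfw] at elink
    obtain ⟨A, B, D, hR⟩ := exists_split_of_first h.round.toClasses hfR hw hcl hle hfw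
    have hmv : MovedTo R f w (m.arr 8 w) (A ++ w :: f :: B ++ D) :=
      .inr ⟨hfw, A, B, D, hR, rfl⟩
    have hperm : (A ++ w :: f :: B ++ D).Perm R := by
      rw [hR, List.append_assoc, List.append_assoc]
      exact List.Perm.append_left A (List.perm_middle (l₁ := f :: B)).symm
    refine ⟨_, hperm, ?_, (List.Perm.append_left p hperm).nodup_iff.2 h.nodup, ?_⟩
    · have hlink := h.linked
      have e : (p ++ R).map Fin.val =
          (p ++ A).map Fin.val ++ (f : ℕ) :: B.map Fin.val ++ (w : ℕ) :: D.map Fin.val := by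
        rw [hR]; simp
      rw [e] at hlink hnd
      rw [elink.1, elink.2]
      convert hlink.move hnd using 1
      simp
    · rw [e10, e11, e12, r8, r9]
      exact h.round.step hw hSw hlt hnew hf hmv

lemma refineStep_loopFree (pa : ℕ) : (refineStep pa).LoopFree := by
  simp [refineStep, newClass, moveVertex]

lemma refineStep_terminates {pa : ℕ} (hpa : pa ∉ [8, 9, 10, 11, 12, 13]) {m : Store}
    (h : InRound q l S p R m) {w : Fin n} (hw : m.arr 13 w = 0 → w ∈ R) (hSw : ¬ S w)
    (hlt : ∀ x ∈ R, S x → q.idxOf x < q.idxOf w) (hr : m.reg 6 = w) :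
    Terminates (refineStep pa) m 67 fun m' =>
      (∃ R', R'.Perm R ∧ InRound q l (fun x => S x ∨ (x = w ∧ m.arr 13 w = 0)) p R' m') ∧
      (∀ x : Fin n, m'.arr pa x = if x = w ∧ m.arr 13 w = 0 then m.reg 3 + 1 else m.arr pa x) ∧
      Frame (refineStep pa) m m' := by
  suffices hT : Terminates (refineStep pa) m 67 fun m' =>
      (∃ R', R'.Perm R ∧ InRound q l (fun x => S x ∨ (x = w ∧ m.arr 13 w = 0)) p R' m') ∧
      (∀ x : Fin n, m'.arr pa x = if x = w ∧ m.arr 13 w = 0 then m.reg 3 + 1 else m.arr pa x) from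
    hT.frame.mono le_rfl fun m' h => ⟨h.1.1, h.1.2, h.2⟩
  refine terminates_exec (refineStep_loopFree pa) le_rfl ?_
  by_cases hm : m.arr 13 w = 0
  · obtain ⟨h1, h2⟩ := refineStep_exec hpa h (hw hm) hSw hlt hr hm
    simp only [hm, and_true]
    refine ⟨h1, fun x => ?_⟩
    rw [h2, Function.update_apply]
    simp only [Fin.val_inj]
  · have : (refineStep pa).exec m = m := by simp [refineStep, hr, hm]
    rw [this]
    simpa [hm] using ⟨R, .refl _, h⟩

/-- A refinement takes time proportional to the degree. The adjacency list has to be sorted by `q`, so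
that each vertex comes after those already moved to the same new class. -/
lemma refineBy_terminates {G : SimpleGraph (Fin n)} [DecidableRel G.Adj] {pa : ℕ}
    (hpa : pa ∉ [4, 5, 6, 8, 9, 10, 11, 12, 13]) (hq : IsVertexOrder q) {m : Store}
    (h : HasPartition q l p R m) (hL : HasLists 6 (fun w => q.filter (G.Adj w ·)) m) {v : Fin n}
    (hv : m.reg 3 = v) (hR : ∀ x : Fin n, m.arr 13 x = 0 → x ∈ R) :
    Terminates (refineBy pa) m (81 * G.degree v + 10) fun m' =>
      (∃ R', R'.Perm R ∧
        HasPartition q (l ++ [fun x => G.Adj v x ∧ m.arr 13 x = 0]) p R' m') ∧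
      (∀ x : Fin n, m'.arr pa x =
        if G.Adj v x ∧ m.arr 13 x = 0 then (v : ℕ) + 1 else m.arr pa x) ∧
      Frame (refineBy pa) m m' := by
  have hpa1 : pa ∉ [8, 9, 10, 11, 12, 13] := fun h => hpa (by simp at h ⊢; omega)
  simp only [List.mem_cons, List.not_mem_nil, or_false, not_or] at hpa
  have hpa' : ¬ 4 = pa ∧ ¬ 5 = pa ∧ ¬ 6 = pa ∧ ¬ 13 = pa := by omega
  suffices hT : Terminates (refineBy pa) m (81 * G.degree v + 10) fun m' =>
      (∃ R', R'.Perm R ∧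
        HasPartition q (l ++ [fun x => G.Adj v x ∧ m.arr 13 x = 0]) p R' m') ∧
      (∀ x : Fin n, m'.arr pa x =
        if G.Adj v x ∧ m.arr 13 x = 0 then (v : ℕ) + 1 else m.arr pa x) from
    hT.frame.mono le_rfl fun m' h => ⟨h.1.1, h.1.2, h.2⟩
  refine terminates_block_exec (b := 81 * G.degree v + 3) (by simp)
    (by simp [Prog.maxCost, Expr.cost]; omega) ?_
  set m₁ := (block [.set 9 (.reg 8), .set 4 (.get 6 (.reg 3))]).exec m with hm₁
  have hcard : (q.filter (G.Adj v ·)).length = G.degree v := by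
    rw [← List.toFinset_card_of_nodup (hq.1.filter _), ← G.card_neighborFinset_eq_degree]
    congr 1
    ext x
    simp [hq.2 x]
  have hnd := hq.1.filter (G.Adj v ·)
  have hsorted := (pairwise_idxOf_lt hq.1).sublist (List.filter_sublist (p := (G.Adj v ·)))
  refine (terminates_foreach (q.filter (G.Adj v ·)) (fun a m' =>
    (∀ b, q.filter (G.Adj v ·) = a ++ b →
      IsLinkedList (m.arr 4) (m.arr 5) (m.reg 7) (m'.reg 4) (b.map Fin.val)) ∧
    (∃ R', R'.Perm R ∧ InRound q l (fun x => x ∈ a ∧ m.arr 13 x = 0) p R' m') ∧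
    ∀ x : Fin n, m'.arr pa x = if x ∈ a ∧ m.arr 13 x = 0 then (v : ℕ) + 1 else m.arr pa x)
    (fun _ => 78) ?_ ?_ ?_).mono ?_ ?_
  · rintro a w b m' hab ⟨hl, ⟨R', hperm, hin⟩, hpar⟩ hf
    have e4 : m'.arr 4 = m.arr 4 := by
      simpa [hm₁] using hf.2 4 (by simp [refineBody, refineStep, newClass, moveVertex, hpa'])
    have e5 : m'.arr 5 = m.arr 5 := by
      simpa [hm₁] using hf.2 5 (by simp [refineBody, refineStep, newClass, moveVertex, hpa'])
    have e13 : m'.arr 13 = m.arr 13 := by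
      simpa [hm₁] using hf.2 13 (by simp [refineBody, refineStep, newClass, moveVertex, hpa'])
    have r3 : m'.reg 3 = v := by
      simpa [hm₁, hv] using hf.1 3 (by simp [refineBody, refineStep, newClass, moveVertex])
    obtain ⟨hpos, -, hval, hrest⟩ := hl _ hab
    have hwa : w ∉ a := by
      rw [hab] at hnd
      exact fun hw => (List.nodup_append.1 hnd).2.2 w hw w (by simp) rfl
    refine ⟨by simpa using hpos, terminates_block_exec (b := 75) (by simp) le_rfl ?_⟩
    refine (refineStep_terminates (w := w) hpa1 (hin.congr (by simp) (by simp) (by simp) (by simp)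
      (by simp) (by simp) (by simp)) (fun h13 => hperm.mem_iff.2 (hR w (by simpa [e13] using h13)))
      (fun h => hwa h.1) (fun x _ hx => ?_) (by simp [e4, hval])).block_cons (b₂ := 4)
      (by norm_num) ?_
    · rw [hab] at hsorted
      exact (List.pairwise_append.1 hsorted).2.2 x hx.1 w (by simp)
    · rintro m₂ ⟨⟨R₂, hperm₂, hin₂⟩, hpar₂, hf₂⟩
      have r4 : m₂.reg 4 = m'.reg 4 := by
        simpa using hf₂.1 4 (by simp [refineStep, newClass, moveVertex])
      have e5' : m₂.arr 5 = m'.arr 5 := by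
        simpa using hf₂.2 5 (by simp [refineStep, newClass, moveVertex, hpa'])
      refine terminates_exec (by simp) (by simp [Prog.maxCost, Expr.cost]) ⟨fun b' hb' => ?_,
        ⟨R₂, hperm₂.trans hperm, ?_⟩, fun x => ?_⟩
      · have : b' = b := by
          rw [hab, List.append_assoc, List.append_cancel_left_eq] at hb'
          simpa using hb'.symm
        simpa [r4, e5', e5, this] using hrest
      · have hS : (fun x => x ∈ a ++ [w] ∧ m.arr 13 x = 0) = fun x => (x ∈ a ∧ m.arr 13 x = 0) ∨
            (x = w ∧ ((Prog.set 6 (.get 4 (.reg 4))).exec m').arr 13 w = 0) := by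
          funext x
          by_cases hxw : x = w
          · subst hxw; simp [hwa, e13]
          · simp [hxw]
        rw [hS]
        exact hin₂.congr (by simp) (by simp) (by simp) (by simp) (by simp) (by simp) (by simp)
      · simp only [block_singleton, Prog.exec, Store.setReg]
        rw [hpar₂]
        by_cases hxw : x = w
        · subst hxw; simp [hwa, e13, r3, hpar]
        · simp [hxw, hpar]
  · rintro m' ⟨hl, -⟩ -
    have := hl [] (by simp)
    simpa [IsLinkedList] using this
  · refine ⟨fun b hb => ?_, ⟨R, .refl _, h.linked, h.nodup, ?_⟩, by simp [hm₁]⟩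
    · obtain rfl : _ = b := hb
      simpa [hm₁, hv] using hL.list v
    · simpa [hm₁] using h.classes.round
  · simp [Test.cost, Expr.cost, hcard]
    omega
  · rintro m' ⟨⟨-, ⟨R', hperm, hin⟩, hpar⟩, -⟩
    refine ⟨⟨R', hperm, hin.linked, hin.nodup, ?_⟩, fun x => ?_⟩
    · exact hin.round.toClasses.congr_set fun x _ => by simp [hq.2 x]
    · simp [hpar, hq.2 x]

end

/-! ### The initial partition -/

/-- The next vertex is put in front of the list, whose first element is in register 16. -/
def initListBody : Prog := block [
  .set 3 (.get 0 (.reg 2)),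
  .put 8 (.reg 3) (.reg 16),
  .put 9 (.reg 16) (.reg 3),
  .put 10 (.reg 3) (.reg 8),
  .set 16 (.reg 3),
  .set 2 (.succ (.reg 2))]

/-- Make a linked list of the vertices, in the reverse of the order in array 0, and put all of them
into the same new class. -/
def initList : Prog := block [
  block [
    .set 16 (.reg 0),
    .set 2 (.const 0)],
  .while (.lt (.reg 2) (.reg 0)) initListBody,
  block [
    .put 8 (.reg 0) (.reg 16),
    .put 9 (.reg 16) (.reg 0),
    .put 11 (.reg 8) (.reg 16),
    .set 8 (.succ (.reg 8))]]

section

variable {n : ℕ} {q p R : List (Fin n)} {l : List (Fin n → Prop)}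

/-- A chain is extended to the left. -/
lemma isChain_cons_update {nx pv : ℕ → ℕ} {L : List ℕ} {x y : ℕ} (hx : x ∉ L.dropLast)
    (hy : L.head? = some y) (hyt : y ∉ L.tail)
    (h : L.IsChain fun a b => nx a = b ∧ pv b = a) :
    (x :: L).IsChain fun a b => Function.update nx x y a = b ∧ Function.update pv y x b = a := by
  cases L with
  | nil => simp at hy
  | cons z L =>
    obtain rfl : z = y := by simpa using hy
    rw [List.isChain_cons_cons]
    refine ⟨⟨by simp, by simp⟩, isChain_congr h (fun a ha => ?_) (fun a ha => ?_)⟩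
    · rw [Function.update_of_ne (by rintro rfl; exact hx ha)]
    · rw [Function.update_of_ne (by rintro rfl; exact hyt ha)]

lemma nodup_map_concat {a : List (Fin n)} (h : a.Nodup) : (a.map Fin.val ++ [n]).Nodup := by
  rw [List.nodup_append]
  refine ⟨h.map Fin.val_injective, by simp, ?_⟩
  rintro x hx y hy rfl
  obtain ⟨z, -, rfl⟩ := List.mem_map.1 hx
  have := z.2
  simp at hy
  omega

lemma classes_nil {cl fi nc : ℕ → ℕ} {k : ℕ} (hq : IsVertexOrder q)
    (hcl : ∀ x : Fin n, cl x = k) (hfi : ∀ x D, q = x :: D → fi k = (x : ℕ)) (hnc : ∀ c, nc c ≤ k) :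
    Classes q [] q cl fi nc (k + 1) where
  sorted := (pairwise_idxOf_lt hq.1).imp fun h => .inr ⟨by simp, h⟩
  cl_eq x _ y _ := by simp [hcl]
  cl_lt x _ := by simp [hcl]
  nc_lt c := by have := hnc c; omega
  first x hx := by
    cases q with
    | nil => simp at hx
    | cons y D => exact ⟨y, by simp, by rw [hcl, hfi y D rfl], by simp [hcl], by simp⟩

lemma initList_terminates {m : Store} {ρ : List (Fin n)} (hρ : IsVertexOrder ρ) (h0 : m.reg 0 = n)
    (hρm : ArrayHolds (m.arr 0) ρ) (hnc : ∀ c, m.arr 12 c ≤ m.reg 8) :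
    Terminates initList m (23 * n + 20) fun m' =>
      HasPartition ρ.reverse [] [] ρ.reverse m' ∧ Frame initList m m' := by
  refine Terminates.frame ?_
  have hlen := length_of_isVertexOrder hρ
  refine terminates_block_exec (b := 23 * n + 15) (by simp)
    (by simp [Prog.maxCost, Expr.cost]; omega) ?_
  set m₁ := (block [.set 16 (.reg 0), .set 2 (.const 0)]).exec m with hm₁
  have hloop := terminates_foreach (c := .lt (.reg 2) (.reg 0)) (P := initListBody) (m := m₁) ρ
    (fun a m' => m'.reg 2 = a.length ∧
      (a.reverse.map Fin.val ++ [n]).IsChain (fun x y => m'.arr 8 x = y ∧ m'.arr 9 y = x) ∧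
      (a.reverse.map Fin.val ++ [n]).head? = some (m'.reg 16) ∧
      ∀ x ∈ a, m'.arr 10 x = m.reg 8) (fun _ => 20) ?_ ?_ ?_
  · refine hloop.block_cons (b₂ := 12) ?_ ?_
    · simp [Test.cost, Expr.cost, hlen]
      omega
    · rintro m' ⟨⟨hr2, hchain, hhead, hcl⟩, hf⟩
      have r0 : m'.reg 0 = n := by simpa [hm₁, h0] using hf.1 0 (by simp [initListBody])
      have r8 : m'.reg 8 = m.reg 8 := by simpa [hm₁] using hf.1 8 (by simp [initListBody])
      have e12 : m'.arr 12 = m.arr 12 := by simpa [hm₁] using hf.2 12 (by simp [initListBody])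
      have hnd := nodup_map_concat hρ.reverse.1
      refine terminates_exec (by simp) (by simp [Prog.maxCost, Expr.cost]) ⟨?_, ?_, ?_⟩
      · have hnd' := List.nodup_append.1 hnd
        have := isChain_cons_update (x := n) (y := m'.reg 16) (nx := m'.arr 8) (pv := m'.arr 9)
          (L := ρ.reverse.map Fin.val ++ [n]) ?_ hhead ?_ hchain
        · simpa [Linked, r0] using this
        · rw [List.dropLast_concat]
          exact fun hc => hnd'.2.2 n hc n (by simp) rfl
        · intro hc
          rw [List.head?_eq_some_iff] at hhead
          obtain ⟨L, hL⟩ := hhead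
          rw [hL] at hc hnd
          exact (List.nodup_cons.1 hnd).1 hc
      · simpa using hρ.1
      · have := classes_nil (k := m.reg 8) (cl := m'.arr 10) (nc := m'.arr 12)
          (fi := Function.update (m'.arr 11) (m.reg 8) (m'.reg 16)) hρ.reverse
          (fun x => hcl x (hρ.2 x)) ?_ (by rw [e12]; exact hnc)
        · simpa [r8] using this
        · intro x D hx
          rw [hx] at hhead
          simpa using hhead.symm
  · rintro a v b m' hab ⟨hr2, hchain, hhead, hcl⟩ hf
    have r0 : m'.reg 0 = n := by simpa [hm₁, h0] using hf.1 0 (by simp [initListBody])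
    have r8 : m'.reg 8 = m.reg 8 := by simpa [hm₁] using hf.1 8 (by simp [initListBody])
    have e0 : m'.arr 0 = m.arr 0 := by simpa [hm₁] using hf.2 0 (by simp [initListBody])
    have hlen' : ρ.length = a.length + (b.length + 1) := by simp [hab]
    have hv : m'.arr 0 (m'.reg 2) = v := by
      rw [e0, hr2, hρm a.length (by omega)]
      simp [hab]
    have hnd : (a ++ [v]).Nodup := by
      have := hab ▸ hρ.1
      rw [List.append_cons] at this
      exact (List.nodup_append.1 this).1
    have hnda := List.nodup_append.1 hnd
    have hL := nodup_map_concat (List.nodup_reverse.2 hnda.1)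
    refine ⟨?_, terminates_exec (by simp [initListBody]) (by simp [initListBody, Prog.maxCost,
      Expr.cost]) ⟨by simp [initListBody, hr2], ?_, by simp [initListBody, hv], ?_⟩⟩
    · show m'.reg 2 < m'.reg 0
      omega
    · have := isChain_cons_update (x := v) (y := m'.reg 16) (nx := m'.arr 8) (pv := m'.arr 9)
          (L := a.reverse.map Fin.val ++ [n]) ?_ hhead ?_ hchain
      · simpa [initListBody, hv] using this
      · rw [List.dropLast_concat]
        intro hc
        obtain ⟨x, hx, hxv⟩ := List.mem_map.1 hc
        obtain rfl := Fin.ext hxv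
        exact hnda.2.2 x (by simpa using hx) x (by simp) rfl
      · intro hc
        rw [List.head?_eq_some_iff] at hhead
        obtain ⟨L, hL'⟩ := hhead
        rw [hL'] at hc hL
        exact (List.nodup_cons.1 hL).1 hc
    · intro x hx
      simp only [initListBody, block_cons_cons, block_singleton, Prog.exec, Store.setReg,
        Store.setCell, Expr.eval]
      by_cases hxv : x = v
      · subst hxv; simp [hv, r8]
      · have hxa : x ∈ a := by simpa [hxv] using hx
        have hxv' : (x : ℕ) ≠ v := fun h => hxv (Fin.ext h)
        simp [hv, hxv', hcl x hxa]
  · rintro m' ⟨hr2, -⟩ hf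
    have r0 : m'.reg 0 = n := by simpa [hm₁, h0] using hf.1 0 (by simp [initListBody])
    show ¬ m'.reg 2 < m'.reg 0
    omega
  · simp [hm₁, h0]

end

/-! ### Lexicographic breadth first search by partition refinement -/

/-- The vertex in register 3 is visited: it leaves its class, but not the linked list. -/
def lexBFSBody : Prog := block [
  block [
    .put 11 (.get 10 (.reg 3)) (.get 8 (.reg 3)),
    .put 13 (.reg 3) (.const 1),
    .set 15 (.pred (.reg 15)),
    .put 15 (.reg 15) (.reg 3)],
  refineBy 14,
  .set 3 (.get 8 (.reg 3))]

/-- LexBFS: the first vertex of the list is visited, and the part of the list behind it is refined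
with its neighbours. The order is written from right to left to array 15, and array 14 gets the
parents in the last-in tree, increased by one. -/
def lexBFS : Prog := block [
  block [
    .set 3 (.get 8 (.reg 0)),
    .set 15 (.reg 0)],
  .while (.lt (.reg 3) (.reg 0)) lexBFSBody]

section

variable {n : ℕ} {q p R : List (Fin n)} {G : SimpleGraph (Fin n)} {s : Fin n}

lemma Linked.next_eq_headD {nx pv : ℕ → ℕ} {x : Fin n}
    (h : Linked nx pv n ((p ++ x :: R).map Fin.val)) : nx x = (R.map Fin.val).headD n := by
  rw [List.map_append, List.map_cons] at h
  cases R with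
  | nil => simpa using h.next_last
  | cons y R => simpa using h.next

lemma Linked.next_sentinel_eq_headD {nx pv : ℕ → ℕ} (h : Linked nx pv n (R.map Fin.val)) :
    nx n = (R.map Fin.val).headD n := by
  rw [Linked] at h
  cases R with
  | nil =>
    simp only [List.map_nil, List.singleton_append, List.isChain_pair] at h
    exact h.1
  | cons y R =>
    simp only [List.map_cons, List.cons_append] at h
    rw [List.isChain_cons_cons] at h
    simpa using h.1.1

variable [DecidableRel G.Adj]

/-- When `h` is visited, it becomes the parent of its unvisited neighbours. The other parents do not
change. (A vertex that is not in `p` has the index `p.length` in it.) -/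
lemma isLastInParent_concat {h u x : Fin n} (hh : h ∉ p) :
    IsLastInParent G (p ++ [h]) u x ↔
      if G.Adj h x ∧ x ∉ p then u = h else IsLastInParent G p u x := by
  have key : ∀ y, (p ++ [h]).idxOf y =
      if y ∈ p then p.idxOf y else if y = h then p.length else p.length + 1 := by
    intro y
    by_cases hy : y ∈ p
    · rw [List.idxOf_append_of_mem hy, if_pos hy]
    · rw [List.idxOf_append_of_notMem hy, if_neg hy]
      by_cases hyh : y = h
      · simp [hyh]
      · rw [if_neg hyh, List.idxOf_cons_ne _ (Ne.symm hyh)]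
        simp
  have hlt : ∀ y, y ∈ p → p.idxOf y < p.length := fun y => List.idxOf_lt_length_iff.2
  have heq : ∀ y, y ∉ p → p.idxOf y = p.length := fun y => List.idxOf_eq_length_iff.2
  by_cases hx : x ∈ p
  · have hxl := hlt x hx
    have hiff : ∀ y, (p ++ [h]).idxOf y < (p ++ [h]).idxOf x ↔ p.idxOf y < p.idxOf x := by
      intro y
      rw [key y, key x, if_pos hx]
      by_cases hy : y ∈ p
      · rw [if_pos hy]
      · have := heq y hy
        rw [if_neg hy]
        split_ifs <;> omega
    simp only [hx, not_true, and_false, if_false, IsLastInParent, hiff]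
    refine and_congr_right fun _ => and_congr_right fun hu => ?_
    have hup : u ∈ p := by
      by_contra hc
      have := heq u hc
      omega
    refine forall_congr' fun y => imp_congr_right fun _ => imp_congr_right fun hy => ?_
    have hyp : y ∈ p := by
      by_contra hc
      have := heq y hc
      omega
    rw [key, key, if_pos hup, if_pos hyp]
  · have hxl := heq x hx
    have hpos : ∀ y, p.idxOf y < p.idxOf x ↔ y ∈ p := by
      intro y
      rw [hxl, List.idxOf_lt_length_iff]
    by_cases hxh : x = h
    · subst hxh
      have hiff : ∀ y, (p ++ [x]).idxOf y < (p ++ [x]).idxOf x ↔ y ∈ p := by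
        intro y
        rw [key y, key x, if_neg hh]
        by_cases hy : y ∈ p
        · simpa [hy] using hlt y hy
        · rw [if_neg hy, if_pos rfl]
          split_ifs <;> simp [hy]
      simp only [G.irrefl, false_and, if_false, IsLastInParent, hiff, hpos]
      refine and_congr_right fun _ => and_congr_right fun hu => ?_
      refine forall_congr' fun y => imp_congr_right fun _ => imp_congr_right fun hy => ?_
      rw [key, key, if_pos hu, if_pos hy]
    · have hiff : ∀ y, (p ++ [h]).idxOf y < (p ++ [h]).idxOf x ↔ y ∈ p ∨ y = h := by
        intro y
        rw [key y, key x, if_neg hx, if_neg hxh]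
        by_cases hy : y ∈ p
        · have := hlt y hy
          simp [hy]
          omega
        · rw [if_neg hy]
          split_ifs with hyx <;> simp [hy, hyx]
      by_cases hadj : G.Adj h x
      · simp only [hadj, hx, not_false_eq_true, and_self, if_true, IsLastInParent, hiff]
        constructor
        · rintro ⟨-, hu, hmax⟩
          have := hmax h hadj (.inr rfl)
          rw [key, key, if_neg hh, if_pos rfl] at this
          rcases hu with hu | hu
          · have hul := hlt u hu
            rw [if_pos hu] at this
            omega
          · exact hu
        · rintro rfl
          refine ⟨hadj, .inr rfl, fun y _ hy => ?_⟩
          rw [key, key, if_neg hh, if_pos rfl]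
          rcases hy with hy | rfl
          · rw [if_pos hy]; exact (hlt y hy).le
          · simp [hh]
      · simp only [hadj, false_and, if_false, IsLastInParent, hiff, hpos]
        refine and_congr_right fun hux => ?_
        have hor : ∀ y, G.Adj y x → (y ∈ p ∨ y = h ↔ y ∈ p) := by
          intro y hy
          refine or_iff_left ?_
          rintro rfl
          exact hadj hy
        rw [hor u hux]
        refine and_congr_right fun hu => ?_
        refine forall_congr' fun y => imp_congr_right fun hyx => ?_
        rw [hor y hyx]
        refine imp_congr_right fun hy => ?_
        rw [key, key, if_pos hu, if_pos hy]

/-- The head of the sorted list is the vertex that LexBFS⁺ takes. -/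
lemma lexBFSElig_of_sorted {ρ : List (Fin n)} {v : Fin n} (hρ : IsOrderEndingIn ρ s)
    (ho : IsVertexOrder (p ++ v :: R))
    (hs : (v :: R).Pairwise (Before (p.map fun v => G.Adj v) ρ.reverse)) (hp : p ≠ [] → s ∈ p) :
    lexBFSElig G s p v ∧ ∀ w, lexBFSElig G s p w → w ≠ v → ρ.idxOf w < ρ.idxOf v := by
  have hmem : ∀ w, w ∉ p → w ≠ v → w ∈ R := by
    intro w hw hwv
    have := ho.2 w
    simpa [hw, hwv] using this
  have hb := (List.pairwise_cons.1 hs).1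
  have hv : v ∉ p := fun h => (List.nodup_append.1 ho.1).2.2 v h v (by simp) rfl
  by_cases hpe : p = []
  · subst hpe
    have hvs : v = s := by
      by_contra hc
      have := hb s (hmem s (by simp) (Ne.symm hc))
      rcases this with this | ⟨-, this⟩
      · obtain ⟨x, hx, -⟩ := this.exists_mem
        simp at hx
      · have hhead : ρ.reverse.head? = some s := by rw [List.head?_reverse]; exact hρ.2
        rw [List.head?_eq_some_iff] at hhead
        obtain ⟨D, hD⟩ := hhead
        rw [hD] at this
        simp at this
    simp only [lexBFSElig_nil_iff]
    refine ⟨hvs, ?_⟩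
    rintro w rfl hw
    exact absurd hvs.symm hw
  · have hsp := hp hpe
    have hlen : p.length ≤ Fintype.card (Fin n) := by
      have := length_of_isVertexOrder ho
      rw [List.length_append, List.length_cons] at this
      rw [Fintype.card_fin]
      omega
    have hvs : v ≠ s := by rintro rfl; exact hv hsp
    refine ⟨⟨hv, fun w hw => ?_⟩, fun w hw hwv => ?_⟩
    · by_cases hwv : w = v
      · subst hwv; exact lt_irrefl _
      · have hws : w ≠ s := by rintro rfl; exact hw hsp
        rcases hb w (hmem w hw hwv) with h | ⟨h, -⟩
        · exact lt_asymm (lexBFSLabel_lt G hvs hws hlen h)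
        · rw [lexBFSLabel_eq G hvs hws h]
          exact lt_irrefl _
    · have hws : w ≠ s := by rintro rfl; exact hw.1 hsp
      rcases hb w (hmem w hw.1 hwv) with h | ⟨-, h⟩
      · exact absurd (lexBFSLabel_lt G hvs hws hlen h) (hw.2 v hv)
      · exact (idxOf_reverse_lt_iff hρ.1.1 (hρ.1.2 v) (hρ.1.2 w)).1 h

/-- The state of the search after the vertices of `p` have been visited. -/
structure LexBFSState (G : SimpleGraph (Fin n)) [DecidableRel G.Adj] (s : Fin n)
    (ρ p R : List (Fin n)) (m : Store) : Prop where
  order : IsVertexOrder (p ++ R)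
  partition : HasPartition ρ.reverse (p.map fun v => G.Adj v) p R m
  next : m.reg 3 = (R.map Fin.val).headD n
  length : m.reg 15 = R.length
  visited : ArrayHolds (fun i => m.arr 15 (R.length + i)) p.reverse
  mark : ∀ x : Fin n, m.arr 13 x = 0 ↔ x ∈ R
  parent : ∀ x u : Fin n, m.arr 14 x = u + 1 ↔ IsLastInParent G p u x
  plus : ∀ a v b, p = a ++ v :: b →
    lexBFSElig G s a v ∧ ∀ w, lexBFSElig G s a w → w ≠ v → ρ.idxOf w < ρ.idxOf v

lemma lexBFSBody_terminates {ρ : List (Fin n)} {v : Fin n} {m : Store}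
    (hρ : IsOrderEndingIn ρ s) (h : LexBFSState G s ρ p (v :: R) m)
    (hL : HasLists 6 (fun w => ρ.reverse.filter (G.Adj w ·)) m) :
    Terminates lexBFSBody m (81 * G.degree v + 28) fun m' =>
      ∃ R', R'.Perm R ∧ LexBFSState G s ρ (p ++ [v]) R' m' := by
  have r3 : m.reg 3 = v := by simpa using h.next
  have hnx := h.partition.linked.next_eq_headD
  have hnd := List.nodup_append.1 h.order.1
  have hvR : v ∉ R := (List.nodup_cons.1 hnd.2.1).1
  have hvp : v ∉ p := fun hv => hnd.2.2 v hv v (by simp) rfl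
  have helig := lexBFSElig_of_sorted hρ h.order h.partition.classes.sorted (by
    intro hp
    obtain ⟨x, p', rfl⟩ := List.exists_cons_of_ne_nil hp
    have := (h.plus [] x p' rfl).1
    rw [lexBFSElig_nil_iff] at this
    simp [this])
  refine terminates_block_exec (b := 81 * G.degree v + 14) (by simp)
    (by simp [Prog.maxCost, Expr.cost]; omega) ?_
  set m₁ := (block [.put 11 (.get 10 (.reg 3)) (.get 8 (.reg 3)), .put 13 (.reg 3) (.const 1),
    .set 15 (.pred (.reg 15)), .put 15 (.reg 15) (.reg 3)]).exec m with hm₁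
  -- the vertex `v` is passed from the classes to the visited part of the list
  have hmark₁ : ∀ x : Fin n, m₁.arr 13 x = 0 ↔ x ∈ R := by
    intro x
    by_cases hxv : x = v
    · subst hxv; simp [hm₁, r3, hvR]
    · have : (x : ℕ) ≠ v := fun h => hxv (Fin.ext h)
      simpa [hm₁, r3, hxv, this] using h.mark x
  have hpart₁ : HasPartition ρ.reverse (p.map fun v => G.Adj v) (p ++ [v]) R m₁ := by
    refine ⟨?_, by simpa using h.partition.nodup, ?_⟩
    · simpa [hm₁] using h.partition.linked
    · have := h.partition.classes.tail (y := m.arr 8 v) (by rintro x D rfl; simpa using hnx)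
      simpa [hm₁, r3] using this
  refine (refineBy_terminates (G := G) (pa := 14) (v := v) (by simp) hρ.1.reverse hpart₁
    (hL.congr (by simp [hm₁]) (by simp [hm₁]) (by simp [hm₁]) (by simp [hm₁])) (by simp [hm₁, r3])
    (fun x hx => (hmark₁ x).1 hx)).block_cons (b₂ := 4) (by omega) ?_
  rintro m₂ ⟨⟨R', hperm, hpart⟩, hpar, hf⟩
  have q3 : m₂.reg 3 = v := by
    simpa [hm₁, r3] using hf.1 3 (by simp [refineBy, refineBody, refineStep, newClass, moveVertex])
  have q15 : m₂.reg 15 = R.length := by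
    simpa [hm₁, h.length] using
      hf.1 15 (by simp [refineBy, refineBody, refineStep, newClass, moveVertex])
  have q13 : m₂.arr 13 = m₁.arr 13 :=
    hf.2 13 (by simp [refineBy, refineBody, refineStep, newClass, moveVertex])
  have qa15 : m₂.arr 15 = Function.update (m.arr 15) R.length v := by
    simpa [hm₁, h.length, r3] using
      hf.2 15 (by simp [refineBy, refineBody, refineStep, newClass, moveVertex])
  refine terminates_exec (by simp) (by simp [Prog.maxCost, Expr.cost]) ⟨R', hperm, ?_⟩
  have hlen := hperm.length_eq
  refine ⟨?_, ?_, ?_, by simp [q15, hlen], ?_, ?_, ?_, ?_⟩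
  · have : (p ++ [v] ++ R').Perm (p ++ v :: R) := by
      simpa using List.Perm.append_left p (hperm.cons v)
    exact ⟨this.nodup_iff.2 h.order.1, fun x => this.mem_iff.2 (h.order.2 x)⟩
  · -- on the unvisited vertices, the refining set is the neighbourhood of `v`
    have hcl := hpart.classes.congr_set (S' := G.Adj v) (fun x hx => by
      rw [and_iff_left ((hmark₁ x).2 (hperm.mem_iff.1 hx))])
    have hpart' : HasPartition ρ.reverse (p.map (fun v => G.Adj v) ++ [G.Adj v]) (p ++ [v]) R' m₂ :=
      ⟨hpart.linked, hpart.nodup, hcl⟩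
    rw [List.map_append]
    exact hpart'.congr (by simp) (by simp) (by simp) (by simp) (by simp) (by simp)
  · have := hpart.linked
    rw [List.append_assoc] at this
    simpa [q3] using this.next_eq_headD
  · intro i hi
    simp only [block_singleton, Prog.exec, Store.setReg, qa15, List.reverse_append,
      List.reverse_singleton, List.singleton_append, hlen]
    cases i with
    | zero => simp
    | succ i =>
      have := h.visited i (by simpa using hi)
      simpa [show R.length + (i + 1) = R.length + 1 + i by omega,
        show R.length + 1 + i ≠ R.length by omega] using this
  · intro x
    simp only [block_singleton, Prog.exec, Store.setReg, q13, hmark₁, hperm.mem_iff]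
  · intro x u
    simp only [block_singleton, Prog.exec, Store.setReg, hpar, hmark₁]
    rw [isLastInParent_concat hvp]
    have hiff : G.Adj v x ∧ x ∈ R ↔ G.Adj v x ∧ x ∉ p := by
      refine and_congr_right fun hadj => ?_
      have hx := h.order.2 x
      have hxv : x ≠ v := hadj.ne'
      simp only [List.mem_append, List.mem_cons, hxv, false_or] at hx
      refine ⟨fun hxR hxp => hnd.2.2 x hxp x (by simp [hxR]) rfl, fun hxp => hx.resolve_left hxp⟩
    simp only [hiff]
    split_ifs with hc
    · rw [Nat.add_right_cancel_iff, Fin.val_inj]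
      exact eq_comm
    · rw [← h.parent x u]
      simp [hm₁]
  · intro a w b hab
    rcases List.eq_nil_or_concat b with rfl | ⟨b', y, rfl⟩
    · have := List.append_inj' hab rfl
      obtain ⟨rfl, hw⟩ := this
      obtain rfl : v = w := by simpa using hw
      exact helig
    · rw [List.concat_eq_append, ← List.cons_append, ← List.append_assoc] at hab
      exact h.plus a w b' (List.append_inj' hab rfl).1

/-- LexBFS⁺ takes linear time. -/
lemma lexBFS_terminates {ρ : List (Fin n)} {m : Store} (hρ : IsOrderEndingIn ρ s)
    (h0 : m.reg 0 = n) (h : HasPartition ρ.reverse [] [] ρ.reverse m)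
    (hL : HasLists 6 (fun w => ρ.reverse.filter (G.Adj w ·)) m) (h13 : ∀ x : Fin n, m.arr 13 x = 0)
    (h14 : ∀ x : Fin n, m.arr 14 x = 0) :
    Terminates lexBFS m (81 * ∑ v, G.degree v + 31 * n + 8) fun m' =>
      (∃ π, IsPlusOrder (lexBFSElig G s) ρ π ∧ ArrayHolds (m'.arr 15) π.reverse ∧
        (∀ x u : Fin n, m'.arr 14 x = u + 1 ↔ IsLastInParent G π u x) ∧
        (∀ x : Fin n, m'.arr 13 x ≠ 0) ∧ ∀ c, m'.arr 12 c < m'.reg 8) ∧ Frame lexBFS m m' := by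
  refine Terminates.frame ?_
  have hq := hρ.1.reverse
  refine terminates_block_exec (b := 81 * ∑ v, G.degree v + 31 * n + 3) (by simp)
    (by simp [Prog.maxCost, Expr.cost]; omega) ?_
  set m₁ := (block [.set 3 (.get 8 (.reg 0)), .set 15 (.reg 0)]).exec m with hm₁
  -- the potential is the sum of the times for the unvisited vertices
  refine (terminates_while (k := 81 * ∑ v, G.degree v + 31 * n) (fun k m' => ∃ p R,
    LexBFSState G s ρ p R m' ∧ (R.map fun v => 81 * G.degree v + 31).sum ≤ k) ?_ ?_).mono
    (by simp [Test.cost, Expr.cost]) ?_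
  · rintro k m' ⟨p, R, hst, hk⟩ hf hc
    have r0 : m'.reg 0 = n := by
      simpa [hm₁, h0] using hf.1 0 (by
        simp [lexBFSBody, refineBy, refineBody, refineStep, newClass, moveVertex])
    cases R with
    | nil =>
      have := hst.next
      simp only [Test.Holds, Expr.eval] at hc
      simp at this
      omega
    | cons v R =>
      simp only [List.map_cons, List.sum_cons] at hk
      refine ⟨81 * G.degree v + 28, (R.map fun v => 81 * G.degree v + 31).sum, ?_, ?_⟩
      · show 81 * G.degree v + 28 + 3 + _ ≤ k
        omega
      · refine (lexBFSBody_terminates hρ hst (hL.congr ?_ ?_ ?_ ?_)).mono le_rfl ?_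
        · simpa [hm₁] using hf.1 7 (by
            simp [lexBFSBody, refineBy, refineBody, refineStep, newClass, moveVertex])
        · simpa [hm₁] using hf.2 4 (by
            simp [lexBFSBody, refineBy, refineBody, refineStep, newClass, moveVertex])
        · simpa [hm₁] using hf.2 5 (by
            simp [lexBFSBody, refineBy, refineBody, refineStep, newClass, moveVertex])
        · simpa [hm₁] using hf.2 6 (by
            simp [lexBFSBody, refineBy, refineBody, refineStep, newClass, moveVertex])
        · rintro m'' ⟨R', hperm, hst'⟩
          exact ⟨_, R', hst', (hperm.map _).sum_eq.le⟩
  · refine ⟨[], ρ.reverse, ⟨by simpa using hq, ?_, ?_, ?_, ?_, ?_, ?_, ?_⟩, ?_⟩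
    · exact h.congr (by simp [hm₁]) (by simp [hm₁]) (by simp [hm₁]) (by simp [hm₁])
        (by simp [hm₁]) (by simp [hm₁])
    · simpa [hm₁, h0] using h.linked.next_sentinel_eq_headD
    · simpa [hm₁, h0] using (length_of_isVertexOrder hρ.1).symm
    · intro i hi
      simp at hi
    · intro x
      simp [hm₁, h13, hρ.1.2 x]
    · intro x u
      simp [hm₁, h14, IsLastInParent]
    · intro a v b hab
      simp at hab
    · rw [sum_map_of_isVertexOrder hq, Finset.sum_add_distrib, ← Finset.mul_sum]
      simp [mul_comm]
  · rintro m' ⟨⟨k, ⟨p, R, hst, -⟩, hc⟩, hf⟩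
    have r0 : m'.reg 0 = n := by
      simpa [hm₁, h0] using hf.1 0 (by
        simp [lexBFSBody, refineBy, refineBody, refineStep, newClass, moveVertex])
    cases R with
    | cons v R =>
      exfalso
      have := hst.next
      simp only [Test.Holds, Expr.eval] at hc
      simp at this
      omega
    | nil =>
      refine ⟨p, ⟨by simpa using hst.order, hst.plus⟩, by simpa using hst.visited, hst.parent, ?_,
        hst.partition.classes.nc_lt⟩
      intro x hx
      simpa using (hst.mark x).1 hx

end

/-! ### Refinement with the neighbours to the left -/

/-- The next vertex is taken from array 15, and is marked after the refinement. -/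
def refineLeftBody : Prog := block [
  .set 3 (.get 15 (.reg 2)),
  refineBy 18,
  block [
    .put 13 (.reg 3) (.const 0),
    .set 2 (.succ (.reg 2))]]

/-- The partition is refined, for each vertex in the order in array 15, with the neighbours to the
left of it. The vertices that have been dealt with are those of mark 0. -/
def refineLeft : Prog := block [
  .set 2 (.const 0),
  .while (.lt (.reg 2) (.reg 0)) refineLeftBody]

/-- The vertex in register 3 is appended to array 16, and its successor is taken. -/
def copyListBody : Prog := block [
  .put 16 (.reg 2) (.reg 3),
  .set 2 (.succ (.reg 2)),
  .set 3 (.get 8 (.reg 3))]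

/-- The linked list of vertices is copied to array 16. -/
def copyList : Prog := block [
  block [
    .set 3 (.get 8 (.reg 0)),
    .set 2 (.const 0)],
  .while (.lt (.reg 3) (.reg 0)) copyListBody]

section

variable {n : ℕ} {q R : List (Fin n)} {l : List (Fin n → Prop)}

lemma refineLeft_terminates {G : SimpleGraph (Fin n)} [DecidableRel G.Adj] {β : List (Fin n)}
    {m : Store} (hq : IsVertexOrder q) (hβ : IsVertexOrder β) (h0 : m.reg 0 = n)
    (h15 : ArrayHolds (m.arr 15) β) (h : HasPartition q [] [] q m)
    (hL : HasLists 6 (fun w => q.filter (G.Adj w ·)) m) (h13 : ∀ x : Fin n, m.arr 13 x ≠ 0) :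
    Terminates refineLeft m (81 * ∑ v, G.degree v + 23 * n + 5) fun m' =>
      (∃ R, R.Perm q ∧ HasPartition q (leftSets G β) [] R m') ∧ Frame refineLeft m m' := by
  refine Terminates.frame ?_
  have hlen := length_of_isVertexOrder hβ
  refine terminates_block_exec (b := 81 * ∑ v, G.degree v + 23 * n + 3) (by simp)
    (by simp [Prog.maxCost, Expr.cost]; omega) ?_
  set m₁ := (Prog.set 2 (.const 0)).exec m with hm₁
  refine (terminates_foreach β (fun a m' => m'.reg 2 = a.length ∧
      (∀ x : Fin n, m'.arr 13 x = 0 ↔ x ∈ a) ∧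
      ∃ R, R.Perm q ∧
        HasPartition q (a.map fun v w => G.Adj v w ∧ β.idxOf w < β.idxOf v) [] R m')
      (fun v => 81 * G.degree v + 20) ?_ ?_ ?_).mono ?_ ?_
  · rintro a v b m' hab ⟨hr2, hmark, R, hperm, hpart⟩ hf
    have r0 : m'.reg 0 = n := by
      simpa [hm₁, h0] using hf.1 0 (by
        simp [refineLeftBody, refineBy, refineBody, refineStep, newClass, moveVertex])
    have e15 : m'.arr 15 = m.arr 15 := by
      simpa [hm₁] using hf.2 15 (by
        simp [refineLeftBody, refineBy, refineBody, refineStep, newClass, moveVertex])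
    have hL' : HasLists 6 (fun w => q.filter (G.Adj w ·)) m' := by
      refine hL.congr ?_ ?_ ?_ ?_
      · simpa [hm₁] using hf.1 7 (by
          simp [refineLeftBody, refineBy, refineBody, refineStep, newClass, moveVertex])
      · simpa [hm₁] using hf.2 4 (by
          simp [refineLeftBody, refineBy, refineBody, refineStep, newClass, moveVertex])
      · simpa [hm₁] using hf.2 5 (by
          simp [refineLeftBody, refineBy, refineBody, refineStep, newClass, moveVertex])
      · simpa [hm₁] using hf.2 6 (by
          simp [refineLeftBody, refineBy, refineBody, refineStep, newClass, moveVertex])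
    have hlen' : β.length = a.length + (b.length + 1) := by simp [hab]
    have hv : m'.arr 15 a.length = v := by
      rw [e15, h15 a.length (by omega)]
      simp [hab]
    refine ⟨?_, terminates_block_exec (b := 81 * G.degree v + 16) (by simp)
      (by simp [Prog.maxCost, Expr.cost]; omega) ?_⟩
    · show m'.reg 2 < m'.reg 0
      omega
    refine (refineBy_terminates (G := G) (pa := 18) (v := v) (by simp) hq
      (hpart.congr (by simp) (by simp) (by simp) (by simp) (by simp) (by simp))
      (hL'.congr (by simp) (by simp) (by simp) (by simp)) (by simp [hr2, hv])
      (fun x _ => hperm.mem_iff.2 (hq.2 x))).block_cons (b₂ := 6) (by omega) ?_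
    rintro m₂ ⟨⟨R', hperm', hpart'⟩, -, hf'⟩
    have r3 : m₂.reg 3 = v := by
      simpa [hr2, hv] using
        hf'.1 3 (by simp [refineBy, refineBody, refineStep, newClass, moveVertex])
    have r2 : m₂.reg 2 = a.length := by
      simpa [hr2] using
        hf'.1 2 (by simp [refineBy, refineBody, refineStep, newClass, moveVertex])
    have e13 : m₂.arr 13 = m'.arr 13 := by
      simpa using hf'.2 13 (by simp [refineBy, refineBody, refineStep, newClass, moveVertex])
    refine terminates_exec (by simp) (by simp [Prog.maxCost, Expr.cost]) ⟨by simp [r2], ?_, R',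
      hperm'.trans hperm, ?_⟩
    · intro x
      by_cases hxv : x = v
      · subst hxv; simp [r3]
      · have : (x : ℕ) ≠ v := fun h => hxv (Fin.ext h)
        simpa [r3, hxv, this, e13] using hmark x
    · have hS : (fun x : Fin n => G.Adj v x ∧
            ((Prog.set 3 (.get 15 (.reg 2))).exec m').arr 13 x = 0) =
          fun x => G.Adj v x ∧ β.idxOf x < β.idxOf v := by
        funext x
        rw [← mem_iff_idxOf_lt hβ.1 hab x, ← hmark x]
        simp
      rw [hS] at hpart'
      rw [List.map_append]
      exact hpart'.congr (by simp) (by simp) (by simp) (by simp) (by simp) (by simp)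
  · rintro m' ⟨hr2, -⟩ hf
    have r0 : m'.reg 0 = n := by
      simpa [hm₁, h0] using hf.1 0 (by
        simp [refineLeftBody, refineBy, refineBody, refineStep, newClass, moveVertex])
    show ¬ m'.reg 2 < m'.reg 0
    omega
  · exact ⟨by simp [hm₁], by simpa [hm₁] using h13, q, .refl _,
      h.congr (by simp [hm₁]) (by simp [hm₁]) (by simp [hm₁]) (by simp [hm₁]) (by simp [hm₁])
        (by simp [hm₁])⟩
  · rw [sum_map_of_isVertexOrder hβ, Finset.sum_add_distrib, Finset.sum_add_distrib,
      ← Finset.mul_sum]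
    simp [Test.cost, Expr.cost]
    omega
  · rintro m' ⟨⟨-, -, R, hR⟩, -⟩
    exact ⟨R, hR⟩

lemma copyList_terminates {m : Store} (hR : IsVertexOrder R) (h0 : m.reg 0 = n)
    (h : HasPartition q l [] R m) :
    Terminates copyList m (12 * n + 8) fun m' => ArrayHolds (m'.arr 16) R ∧ Frame copyList m m' := by
  refine Terminates.frame ?_
  have hlen := length_of_isVertexOrder hR
  refine terminates_block_exec (b := 12 * n + 3) (by simp)
    (by simp [Prog.maxCost, Expr.cost]; omega) ?_
  set m₁ := (block [.set 3 (.get 8 (.reg 0)), .set 2 (.const 0)]).exec m with hm₁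
  have hlink : Linked (m.arr 8) (m.arr 9) n (R.map Fin.val) := h.linked
  refine (terminates_foreach R (fun a m' => m'.reg 2 = a.length ∧
      (∀ b, R = a ++ b → m'.reg 3 = (b.map Fin.val).headD n) ∧ ArrayHolds (m'.arr 16) a)
      (fun _ => 9) ?_ ?_ ?_).mono ?_ ?_
  · rintro a v b m' hab ⟨hr2, hr3, harr⟩ hf
    have r0 : m'.reg 0 = n := by simpa [hm₁, h0] using hf.1 0 (by simp [copyListBody])
    have e8 : m'.arr 8 = m.arr 8 := by simpa [hm₁] using hf.2 8 (by simp [copyListBody])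
    have hv : m'.reg 3 = v := by simpa using hr3 _ hab
    refine ⟨?_, terminates_exec (by simp [copyListBody]) (by simp [copyListBody, Prog.maxCost,
      Expr.cost]) ⟨by simp [copyListBody, hr2], fun b' hb' => ?_, ?_⟩⟩
    · show m'.reg 3 < m'.reg 0
      have := v.2
      omega
    · have : b' = b := by
        rw [hab, List.append_assoc, List.append_cancel_left_eq] at hb'
        simpa using hb'.symm
      subst this
      rw [hab] at hlink
      simpa [copyListBody, hv, e8] using hlink.next_eq_headD
    · intro i hi
      rw [List.length_append, List.length_singleton] at hi
      by_cases hia : i = a.length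
      · subst hia
        simp [copyListBody, hr2, hv]
      · have := harr i (by omega)
        rw [List.getElem_append_left (by omega), ← this]
        simp [copyListBody, hr2, hia]
  · rintro m' ⟨-, hr3, -⟩ hf
    have r0 : m'.reg 0 = n := by simpa [hm₁, h0] using hf.1 0 (by simp [copyListBody])
    have := hr3 [] (by simp)
    simp only [List.map_nil, List.headD_nil] at this
    show ¬ m'.reg 3 < m'.reg 0
    omega
  · refine ⟨by simp [hm₁], ?_, fun i hi => by simp at hi⟩
    rintro b rfl
    simpa [hm₁, h0] using hlink.next_sentinel_eq_headD
  · simp [Test.cost, Expr.cost, hlen]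
    omega
  · rintro m' ⟨⟨-, -, harr⟩, -⟩
    exact harr

end

/-- The next neighbour is pushed if its parent is the vertex in register 3. -/
def pushChild : Prog := block [
  .set 6 (.get 4 (.reg 4)),
  .ite (.eq (.get 14 (.reg 6)) (.succ (.reg 3)))
    (block [
      .put 17 (.reg 17) (.reg 6),
      .set 17 (.succ (.reg 17))])
    .skip,
  .set 4 (.get 5 (.reg 4))]

/-- The vertex on the top of the stack is visited. Register 17 is the height of the stack, register 18
the number of visited vertices. -/
def stackSearchBody : Prog := block [
  block [
    .set 17 (.pred (.reg 17)),
    .set 3 (.get 17 (.reg 17)),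
    .put 3 (.reg 18) (.reg 3),
    .set 18 (.succ (.reg 18)),
    .set 4 (.get 7 (.reg 3))],
  .while (.lt (.const 0) (.reg 4)) pushChild]

/-- Depth first search of the tree, with the stack in array 17. The children of a vertex are found
by going through its adjacency list and comparing parents. The order is written to array 3. -/
def stackSearch : Prog := block [
  block [
    .put 17 (.const 0) (.reg 1),
    .set 17 (.const 1),
    .set 18 (.const 0)],
  .while (.lt (.const 0) (.reg 17)) stackSearchBody]

section

variable {n : ℕ} {G : SimpleGraph (Fin n)} [DecidableRel G.Adj] {s : Fin n} {π L p S : List (Fin n)}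

lemma ArrayHolds.concat {f : ℕ → ℕ} {l : List (Fin n)} (h : ArrayHolds f l) (x : Fin n) :
    ArrayHolds (Function.update f l.length x) (l ++ [x]) := by
  intro i hi
  rw [List.length_append, List.length_singleton] at hi
  by_cases hil : i = l.length
  · subst hil
    simp
  · rw [List.getElem_append_left (by omega), Function.update_of_ne hil]
    exact h i (by omega)

lemma stackSearchBody_terminates {v : Fin n} {m : Store} (hL : IsVertexOrder L)
    (h : HasLists 7 (fun w => L.reverse.filter (G.Adj w ·)) m)
    (h14 : ∀ x u : Fin n, m.arr 14 x = u + 1 ↔ IsLastInParent G π u x)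
    (h17 : m.reg 17 = S.length + 1) (hS : ArrayHolds (m.arr 17) (v :: S).reverse) :
    Terminates stackSearchBody m (21 * G.degree v + 18) fun m' =>
      (∃ C, (C.Pairwise fun x y => L.idxOf x < L.idxOf y) ∧
        (∀ w, w ∈ C ↔ IsLastInParent G π v w) ∧ m'.reg 17 = (C ++ S).length ∧
        ArrayHolds (m'.arr 17) (C ++ S).reverse) ∧
      m'.reg 18 = m.reg 18 + 1 ∧ m'.arr 3 = Function.update (m.arr 3) (m.reg 18) v := by
  refine terminates_block_exec (b := 21 * G.degree v + 3) (by simp)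
    (by simp [Prog.maxCost, Expr.cost]; omega) ?_
  set m₁ := (block [.set 17 (.pred (.reg 17)), .set 3 (.get 17 (.reg 17)), .put 3 (.reg 18) (.reg 3),
    .set 18 (.succ (.reg 18)), .set 4 (.get 7 (.reg 3))]).exec m with hm₁
  have hv : m.arr 17 S.length = v := by
    have := hS S.length (by simp)
    simpa using this
  have hcard : (L.reverse.filter (G.Adj v ·)).length = G.degree v := by
    rw [← List.toFinset_card_of_nodup (hL.reverse.1.filter _), ← G.card_neighborFinset_eq_degree]
    congr 1
    ext x
    simp [hL.2 x]
  refine (terminates_foreach (L.reverse.filter (G.Adj v ·)) (fun a m' =>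
    (∀ b, L.reverse.filter (G.Adj v ·) = a ++ b →
      IsLinkedList (m.arr 4) (m.arr 5) (m.reg 7) (m'.reg 4) (b.map Fin.val)) ∧
    m'.reg 17 = (S.reverse ++ a.filter (fun x : Fin n => m.arr 14 x = v + 1)).length ∧
    ArrayHolds (m'.arr 17) (S.reverse ++ a.filter (fun x : Fin n => m.arr 14 x = v + 1)))
    (fun _ => 18) ?_ ?_ ?_).mono ?_ ?_
  · rintro a w b m' hab ⟨hl, hr17, h17'⟩ hf
    have e4 : m'.arr 4 = m.arr 4 := by simpa [hm₁] using hf.2 4 (by simp [pushChild])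
    have e5 : m'.arr 5 = m.arr 5 := by simpa [hm₁] using hf.2 5 (by simp [pushChild])
    have e14 : m'.arr 14 = m.arr 14 := by simpa [hm₁] using hf.2 14 (by simp [pushChild])
    have r3 : m'.reg 3 = v := by
      simpa [hm₁, h17, hv] using hf.1 3 (by simp [pushChild])
    obtain ⟨hpos, -, hval, hrest⟩ := hl _ hab
    refine ⟨by simpa using hpos, terminates_exec (by simp [pushChild]) (by simp [pushChild,
      Prog.maxCost, Expr.cost, Test.cost]) ?_⟩
    have key : (pushChild.exec m').reg 4 = m.arr 5 (m'.reg 4) ∧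
        (pushChild.exec m').reg 17 = (if m.arr 14 w = v + 1 then m'.reg 17 + 1 else m'.reg 17) ∧
        (pushChild.exec m').arr 17 = if m.arr 14 w = v + 1 then
          Function.update (m'.arr 17) (m'.reg 17) w else m'.arr 17 := by
      by_cases hw : m.arr 14 w = v + 1 <;> simp [pushChild, e4, e5, hval, e14, r3, hw]
    rw [key.1, key.2.1, key.2.2]
    refine ⟨fun b' hb' => ?_, ?_⟩
    · have : b' = b := by
        rw [hab, List.append_assoc, List.append_cancel_left_eq] at hb'
        simpa using hb'.symm
      simpa [this] using hrest
    · rw [List.filter_append, ← List.append_assoc]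
      by_cases hw : m.arr 14 w = v + 1
      · have := h17'.concat w
        rw [← hr17] at this
        rw [if_pos hw, if_pos hw, List.filter_singleton, decide_eq_true hw, cond_true]
        exact ⟨by rw [List.length_append, List.length_singleton, hr17], this⟩
      · rw [if_neg hw, if_neg hw, List.filter_singleton, decide_eq_false hw, cond_false,
          List.append_nil]
        exact ⟨hr17, h17'⟩
  · rintro m' ⟨hl, -⟩ -
    have := hl [] (by simp)
    simpa [IsLinkedList] using this
  · refine ⟨fun b hb => ?_, by simp [hm₁, h17], fun i hi => ?_⟩
    · obtain rfl : _ = b := hb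
      simpa [hm₁, h17, hv] using h.list v
    · have hi' : i < S.length := by simpa using hi
      have := hS i (by simp; omega)
      simp only [List.reverse_cons, List.filter_nil, List.append_nil] at this ⊢
      rw [List.getElem_append_left (by simpa using hi')] at this
      simpa [hm₁] using this
  · rw [List.map_const', hcard, List.sum_replicate]
    simp [Test.cost, Expr.cost]
    omega
  · rintro m' ⟨⟨-, hr17, h17'⟩, hf⟩
    have hC : S.reverse ++
          (L.reverse.filter (G.Adj v ·)).filter (fun x : Fin n => m.arr 14 x = v + 1) =
        (L.filter (fun x : Fin n => m.arr 14 x = v + 1) ++ S).reverse := by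
      rw [List.reverse_append, List.filter_filter, List.filter_reverse]
      congr 2
      refine List.filter_congr fun x _ => ?_
      by_cases hx : m.arr 14 x = v + 1
      · simp [hx, ((h14 x v).1 hx).1]
      · simp [hx]
    rw [hC] at hr17 h17'
    refine ⟨⟨_, (pairwise_idxOf_lt hL.1).sublist List.filter_sublist, fun w => ?_, ?_, h17'⟩, ?_, ?_⟩
    · simp [hL.2 w, h14]
    · rw [hr17, List.length_reverse]
    · simpa [hm₁] using hf.1 18 (by simp [pushChild])
    · simpa [hm₁, h17, hv] using hf.2 3 (by simp [pushChild])

lemma stackSearch_terminates {m : Store} (hπ : IsCliqueOrder G s π) (hL : IsVertexOrder L)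
    (h1 : m.reg 1 = s) (h : HasLists 7 (fun w => L.reverse.filter (G.Adj w ·)) m)
    (h14 : ∀ x u : Fin n, m.arr 14 x = u + 1 ↔ IsLastInParent G π u x) :
    Terminates stackSearch m (21 * ∑ v, G.degree v + 21 * n + 10) fun m' =>
      ∃ σ, IsDFSState G s π L σ [] ∧ ArrayHolds (m'.arr 3) σ := by
  refine terminates_block_exec (b := 21 * ∑ v, G.degree v + 21 * n + 3) (by simp)
    (by simp [Prog.maxCost, Expr.cost]; omega) ?_
  set m₁ := (block [.put 17 (.const 0) (.reg 1), .set 17 (.const 1), .set 18 (.const 0)]).exec m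
    with hm₁
  have hsum : ∀ p : List (Fin n), p.Nodup → (p.map fun v => 21 * G.degree v + 21).sum ≤
      21 * ∑ v, G.degree v + 21 * n := by
    intro p hp
    rw [← List.sum_toFinset _ hp]
    refine (Finset.sum_le_univ_sum_of_nonneg fun _ => Nat.zero_le _).trans ?_
    rw [Finset.sum_add_distrib, ← Finset.mul_sum]
    simp [mul_comm]
  -- the potential and the times for the visited vertices add up to the whole time
  refine (terminates_while (k := 21 * ∑ v, G.degree v + 21 * n) (fun k m' => ∃ p S,
    IsDFSState G s π L p S ∧ m'.reg 17 = S.length ∧ ArrayHolds (m'.arr 17) S.reverse ∧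
    m'.reg 18 = p.length ∧ ArrayHolds (m'.arr 3) p ∧
    (p.map fun v => 21 * G.degree v + 21).sum + k = 21 * ∑ v, G.degree v + 21 * n) ?_ ?_).mono
    (by simp [Test.cost, Expr.cost]) ?_
  · rintro k m' ⟨p, S, hst, hr17, h17, hr18, h3, hk⟩ hf hc
    have e14 : m'.arr 14 = m.arr 14 := by
      simpa [hm₁] using hf.2 14 (by simp [stackSearchBody, pushChild])
    have h' : HasLists 7 (fun w => L.reverse.filter (G.Adj w ·)) m' := by
      refine h.congr ?_ ?_ ?_ ?_
      · simpa [hm₁] using hf.1 7 (by simp [stackSearchBody, pushChild])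
      · simpa [hm₁] using hf.2 4 (by simp [stackSearchBody, pushChild])
      · simpa [hm₁] using hf.2 5 (by simp [stackSearchBody, pushChild])
      · simpa [hm₁] using hf.2 7 (by simp [stackSearchBody, pushChild])
    cases S with
    | nil =>
      simp only [Test.Holds, Expr.eval] at hc
      simp at hr17
      omega
    | cons v S =>
      have hnd : (p ++ [v]).Nodup := by
        rw [List.nodup_append]
        refine ⟨hst.nodup, by simp, ?_⟩
        rintro x hx y hy rfl
        obtain rfl : x = v := by simpa using hy
        exact ((hst.mem_stack x).1 (by simp)).1 hx
      have hle := hsum _ hnd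
      simp only [List.map_append, List.sum_append, List.map_cons, List.map_nil, List.sum_cons,
        List.sum_nil, add_zero] at hle
      refine ⟨21 * G.degree v + 18, k - (21 * G.degree v + 21), ?_, ?_⟩
      · show 21 * G.degree v + 18 + 3 + _ ≤ k
        omega
      · refine (stackSearchBody_terminates hL h' (by rwa [e14]) hr17 h17).mono le_rfl ?_
        rintro m'' ⟨⟨C, hC, hmem, hr17', h17'⟩, hr18', h3'⟩
        refine ⟨p ++ [v], C ++ S, hst.step hπ hC hmem, hr17', h17', by simp [hr18', hr18], ?_, ?_⟩
        · rw [h3', hr18]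
          exact h3.concat v
        · simp only [List.map_append, List.sum_append, List.map_cons, List.map_nil, List.sum_cons,
            List.sum_nil, add_zero]
          omega
  · refine ⟨[], [s], .init G s π L, by simp [hm₁], fun i hi => ?_, by simp [hm₁], fun i hi => ?_,
      by simp⟩
    · obtain rfl : i = 0 := by simpa using hi
      simp [hm₁, h1]
    · simp at hi
  · rintro m' ⟨⟨k, ⟨p, S, hst, hr17, -, -, h3, -⟩, hc⟩, -⟩
    obtain rfl : S = [] := by simpa [hr17] using hc
    exact ⟨p, hst, h3⟩

end

/-! ### The whole program -/

/-- The lists in array 6 are sorted by `ρ⁻`, the ones in array 7 by the classes of the partition and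
then by `ρ⁻`, in the reverse order. -/
def chordalLexDFSPlus : Prog := block [
  .set 7 (.const 1),
  sortAdj 0 6,
  initList,
  lexBFS,
  initList,
  refineLeft,
  copyList,
  sortAdj 16 7,
  stackSearch]

section

attribute [local simp] Prog.exec Prog.regs Prog.arrs Prog.LoopFree block_singleton block_cons_cons
  Store.setReg Store.setCell Expr.eval sortAdj sortAdjBody pushLoopBody initList initListBody
  lexBFS lexBFSBody refineLeft refineLeftBody refineBy refineBody refineStep newClass moveVertex
  copyList copyListBody

/-- The program computes an output of the algorithm in linear time. The bound is the sum of the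
bounds for its parts, and `2` for the first assignment. -/
lemma chordalLexDFSPlus_terminates {n : ℕ} {G : SimpleGraph (Fin n)} [DecidableRel G.Adj]
    (hG : G.Connected) (hc : IsChordal G) {s : Fin n} {ρ : List (Fin n)} (hρ : IsOrderEndingIn ρ s)
    {adj : Fin n → List (Fin n)} (hadj : IsAdjacencyList G adj) :
    Terminates chordalLexDFSPlus (inputStore adj s ρ) (229 * ∑ v, G.degree v + 179 * n + 83)
      fun m' => ∃ σ, ChordalLexDFSPlusOutput G s ρ σ ∧ IsVertexOrder σ ∧
        ArrayHolds (m'.arr 3) σ := by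
  have hlen : ∑ v, (adj v).length = ∑ v, G.degree v := by
    refine Finset.sum_congr rfl fun v _ => ?_
    rw [← List.toFinset_card_of_nodup (hadj v).1, ← G.card_neighborFinset_eq_degree]
    congr 1
    ext x
    simp [(hadj v).2 x]
  refine terminates_block_exec (b := 229 * ∑ v, G.degree v + 179 * n + 81) (by simp)
    (by simp [Prog.maxCost, Expr.cost]; omega) ?_
  set m₀ := (Prog.set 7 (.const 1)).exec (inputStore adj s ρ) with hm₀
  have hg₀ : HasGraph adj m₀ :=
    (hasGraph_inputStore adj s ρ).congr (by simp [hm₀]) (by simp [hm₀]) (by simp [hm₀])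
  have zero₀ : ∀ a, 3 ≤ a → m₀.arr a = fun _ => 0 := by
    intro a ha
    obtain ⟨a, rfl⟩ := Nat.exists_eq_add_of_le' ha
    rfl
  have a0 : ArrayHolds (m₀.arr 0) ρ := arrayHolds_cells ρ
  refine (sortAdj_terminates hadj (by simp) (by simp) (by simp) (by simp) (by simp) hg₀ hρ.1 a0
    (by simp [zero₀]) (by simp [hm₀])).block_cons
    (b₂ := 206 * ∑ v, G.degree v + 156 * n + 76) (by rw [hlen]; omega) ?_
  rintro m₁ ⟨hL₁, hf₁⟩
  have hg₁ : HasGraph adj m₁ :=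
    hg₀.congr (hf₁.1 0 (by simp)) (hf₁.2 1 (by simp)) (hf₁.2 2 (by simp))
  have e0 : m₁.arr 0 = m₀.arr 0 := hf₁.2 0 (by simp)
  have zero₁ : ∀ a ∈ [7, 12, 13, 14], m₁.arr a = fun _ => 0 := by
    intro a ha
    rw [hf₁.2 a (by simp at ha ⊢; omega), zero₀ a (by simp at ha; omega)]
  refine (initList_terminates hρ.1 hg₁.reg (e0 ▸ a0) (by simp [zero₁])).block_cons
    (b₂ := 206 * ∑ v, G.degree v + 133 * n + 56) (by omega) ?_
  rintro m₂ ⟨hP₂, hf₂⟩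
  have hg₂ : HasGraph adj m₂ :=
    hg₁.congr (hf₂.1 0 (by simp)) (hf₂.2 1 (by simp)) (hf₂.2 2 (by simp))
  have hL₂ := hL₁.congr (hf₂.1 7 (by simp)) (hf₂.2 4 (by simp)) (hf₂.2 5 (by simp))
    (hf₂.2 6 (by simp))
  have e0₂ : m₂.arr 0 = m₁.arr 0 := hf₂.2 0 (by simp)
  refine (lexBFS_terminates hρ hg₂.reg hP₂ hL₂ (by simp [hf₂.2 13 (by simp), zero₁])
    (by simp [hf₂.2 14 (by simp), zero₁])).block_cons
    (b₂ := 125 * ∑ v, G.degree v + 102 * n + 48) (by omega) ?_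
  rintro m₃ ⟨⟨π, hπ, h15, h14, h13, h12⟩, hf₃⟩
  have hg₃ : HasGraph adj m₃ :=
    hg₂.congr (hf₃.1 0 (by simp)) (hf₃.2 1 (by simp)) (hf₃.2 2 (by simp))
  have hL₃ := hL₂.congr (hf₃.1 7 (by simp)) (hf₃.2 4 (by simp)) (hf₃.2 5 (by simp))
    (hf₃.2 6 (by simp))
  have e0₃ : m₃.arr 0 = m₂.arr 0 := hf₃.2 0 (by simp)
  refine (initList_terminates hρ.1 hg₃.reg (by rwa [e0₃, e0₂, e0]) fun c => (h12 c).le).block_cons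
    (b₂ := 125 * ∑ v, G.degree v + 79 * n + 28) (by omega) ?_
  rintro m₄ ⟨hP₄, hf₄⟩
  have hg₄ : HasGraph adj m₄ :=
    hg₃.congr (hf₄.1 0 (by simp)) (hf₄.2 1 (by simp)) (hf₄.2 2 (by simp))
  have hL₄ := hL₃.congr (hf₄.1 7 (by simp)) (hf₄.2 4 (by simp)) (hf₄.2 5 (by simp))
    (hf₄.2 6 (by simp))
  refine (refineLeft_terminates hρ.1.reverse hπ.1.reverse hg₄.reg
    (by rwa [hf₄.2 15 (by simp)]) hP₄ hL₄ (by rwa [hf₄.2 13 (by simp)])).block_cons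
    (b₂ := 44 * ∑ v, G.degree v + 56 * n + 23) (by omega) ?_
  rintro m₅ ⟨⟨R, hperm, hP₅⟩, hf₅⟩
  have hR : IsVertexOrder R := ⟨hperm.nodup_iff.2 hρ.1.reverse.1,
    fun x => hperm.mem_iff.2 (hρ.1.reverse.2 x)⟩
  have hg₅ : HasGraph adj m₅ :=
    hg₄.congr (hf₅.1 0 (by simp)) (hf₅.2 1 (by simp)) (hf₅.2 2 (by simp))
  have hL₅ := hL₄.congr (hf₅.1 7 (by simp)) (hf₅.2 4 (by simp)) (hf₅.2 5 (by simp))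
    (hf₅.2 6 (by simp))
  refine (copyList_terminates hR hg₅.reg hP₅).block_cons
    (b₂ := 44 * ∑ v, G.degree v + 44 * n + 15) (by omega) ?_
  rintro m₆ ⟨h16, hf₆⟩
  have hg₆ : HasGraph adj m₆ :=
    hg₅.congr (hf₆.1 0 (by simp)) (hf₆.2 1 (by simp)) (hf₆.2 2 (by simp))
  have hL₆ := hL₅.congr (hf₆.1 7 (by simp)) (hf₆.2 4 (by simp)) (hf₆.2 5 (by simp))
    (hf₆.2 6 (by simp))
  have e7 : m₆.arr 7 = fun _ => 0 := by
    rw [hf₆.2 7 (by simp), hf₅.2 7 (by simp), hf₄.2 7 (by simp), hf₃.2 7 (by simp),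
      hf₂.2 7 (by simp), zero₁ 7 (by simp)]
  refine (sortAdj_terminates (src := 16) (hd := 7) hadj (by simp) (by simp) (by simp) (by simp)
    (by simp) hg₆ hR h16 (by simp [e7]) hL₆.pos).block_cons
    (b₂ := 21 * ∑ v, G.degree v + 21 * n + 10) (by rw [hlen]; omega) ?_
  rintro m₇ ⟨hL₇, hf₇⟩
  have e1 : m₇.reg 1 = s := by
    rw [hf₇.1 1 (by simp), hf₆.1 1 (by simp), hf₅.1 1 (by simp), hf₄.1 1 (by simp),
      hf₃.1 1 (by simp), hf₂.1 1 (by simp), hf₁.1 1 (by simp)]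
    rfl
  have e14 : m₇.arr 14 = m₃.arr 14 := by
    rw [hf₇.2 14 (by simp), hf₆.2 14 (by simp), hf₅.2 14 (by simp), hf₄.2 14 (by simp)]
  have hclique : IsCliqueOrder G s π :=
    hπ.isSearchOrder.isMNSOrder_of_lexBFS.isCliqueOrder hG hc hπ.isSearchOrder.lexBFS_cons
  refine (stackSearch_terminates hclique hR e1 hL₇ (by rwa [e14])).mono le_rfl ?_
  rintro m₈ ⟨σ, hσ, h3⟩
  exact ⟨σ, hσ.chordalLexDFSPlusOutput hclique hρ.1 hπ hR hP₅.classes.sorted,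
    hσ.isVertexOrder hclique, h3⟩

end

lemma holds_of_arrayHolds {n : ℕ} {m : Store} {σ : List (Fin n)} (hσ : IsVertexOrder σ)
    (h : ArrayHolds (m.arr 3) σ) : Holds m σ := by
  have hlen := length_of_isVertexOrder hσ
  refine List.ext_getElem (by simp [hlen]) fun i _ hi => ?_
  simpa using h i (by simpa using hi)

end Ram

/-- First part: for every finite connected chordal graph and each of its LexDFS orders `σ`, the
chordal LexDFS⁺ algorithm on the input `(G, s, σ⁻)`, where `s` is the first vertex of `σ`, has an
output, and its only output, whichever BFS order it chooses on the way, is `σ`.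
Second part: the algorithm has a linear-time implementation. -/
theorem mainTheorem7 :
    (∀ (V : Type*) [Fintype V] [DecidableEq V] (G : SimpleGraph V) [DecidableRel G.Adj],
      G.Connected → GraphSearch.IsChordal G →
      ∀ (s : V) (σ : List V), GraphSearch.IsLexDFSOrder G s σ →
        GraphSearch.IsOrderEndingIn σ.reverse s ∧
        ∀ τ : List V, GraphSearch.ChordalLexDFSPlusOutput G s σ.reverse τ ↔ τ = σ) ∧
    (∃ (P : Ram.Prog) (C : ℕ),
      ∀ (n : ℕ) (G : SimpleGraph (Fin n)) [DecidableRel G.Adj],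
        G.Connected → GraphSearch.IsChordal G →
        ∀ (s : Fin n) (ρ : List (Fin n)), GraphSearch.IsOrderEndingIn ρ s →
        ∀ adj : Fin n → List (Fin n), Ram.IsAdjacencyList G adj →
        ∃ (σ : List (Fin n)) (t : ℕ) (m : Ram.Store),
          GraphSearch.ChordalLexDFSPlusOutput G s ρ σ ∧
          Ram.Runs P (Ram.inputStore adj s ρ) t m ∧ Ram.Holds m σ ∧
          t ≤ C * (n + G.edgeFinset.card)) := by
  refine ⟨?_, Ram.chordalLexDFSPlus, 500, ?_⟩
  · intro V _ _ G _ hG hc s σ hσ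
    exact ⟨hσ.isOrderEndingIn, hσ.chordalLexDFSPlusOutput_iff hG hc⟩
  · intro n G _ hG hc s ρ hρ adj hadj
    obtain ⟨t, m, hr, ht, σ, hout, hσ, h3⟩ := Ram.chordalLexDFSPlus_terminates hG hc hρ hadj
    refine ⟨σ, t, m, hout, hr, Ram.holds_of_arrayHolds hσ h3, ht.trans ?_⟩
    -- `229 * (2 * m) + 179 * n + 83 ≤ 500 * (n + m)`, as `n` is positive
    rw [G.sum_degrees_eq_twice_card_edges]
    have := s.pos
    omega
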